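/- Let $V$ be a two-sided quaternionic Banach space and let $(\mathcal U_T(t))_{t\in\mathbb R}$ be a strongly continuous group of bounded right linear operators on $V$ with infinitesimal generator $T$ ($Tv=\lim_{h\to0^+}\frac1h(\mathcal U_T(h)v-v)$ on the domain where the limit exists). Let $M>0$ and $\omega\ge 0$ satisfy $\|\mathcal U_T(t)\|\le Me^{\omega|t|}$ for all $t\in\mathbb R$. Let $\mu$ be a quaternionic measure on the Borel sets of $\mathbb R$ with $\int_{\mathbb R}e^{(\omega+\varepsilon)|t|}\,d|\mu|(t)<\infty$ for some $\varepsilon>0$, and let $f$ be a quaternion-valued function of a quaternionic variable with $$f(s)=\int_{\mathbb R}d\mu(t)\,e^{-st}\qquad\text{for } |\mathrm{Re}(s)|<\omega+\varepsilon .$$ Suppose that $f$ is also right slice regular at infinity, that is, $f$ is right slice regular on $\{s\in\mathbb H: |s|>r\}$ for some $r>0$ and $f(\infty):=\lim_{s\to\infty}f(s)$ exists in $\mathbb H$. Then $$f(T)v:=\int_{\mathbb R}d\mu(t)\,\mathcal U_T(-t)v\qquad(v\in V)$$ defines a bounded right linear operator on $V$, the operator $f[T]$ of the $S$-functional calculus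 for unbounded operators is defined, and $f(T)=f[T]$. Here $f[T]$ is defined as follows. Let $\mathbb S$ be the set of imaginary units of $\mathbb H$ and $\mathbb C_I=\mathbb R+I\mathbb R$ for $I\in\mathbb S$. The $S$-resolvent set $\rho_S(T)$ consists of all $s\in\mathbb H$ for which $T^2-2\mathrm{Re}(s)T+|s|^2\mathcal I:\mathcal D(T^2)\to V$ has a bounded inverse on $V$, and $\sigma_S(T)=\mathbb H\setminus\rho_S(T)$. A $T$-admissible set is an axially symmetric slice domain $U\supset\sigma_S(T)$ such that every $\partial(U\cap\mathbb C_I)$, $I\in\mathbb S$, is a finite union of continuously differentiable Jordan curves. It is required that $\rho_S(T)\cap\mathbb R\ne\emptyset$, that $f$ is right slice regular at infinity, and that $f$ is right slice regular on an open superset of the closure of some $T$-admissible set. For $\alpha\in\rho_S(T)\cap\mathbb R$ put $A=(T-\alpha\mathcal I)^{-1}$, $g(p)=f(p^{-1}+\alpha)$ for $p\neq0$ and $g(0)=f(\infty)$; then $$f[T]:=g[A]:=\frac1{2\pi}\int_{\partial(U\cap\mathbb C_I)}g(s)\,ds_I\,S_R^{-1}(s,A),\qquad ds_I=-ds\,I,\quad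 S_R^{-1}(s,A)=-(A-\overline s\,\mathcal I)(A^2-2\mathrm{Re}(s)A+|s|^2\mathcal I)^{-1},$$ where $I\in\mathbb S$, $U$ is a bounded $A$-admissible set such that $g$ is right slice regular on an open superset of $\overline U$, and $\partial(U\cap\mathbb C_I)$ is positively oriented. Such $U$ exist for every $\alpha$, and the value does not depend on $\alpha$, $U$ or $I$. -/

import Mathlib

open Filter Topology MeasureTheory
open scoped Quaternion MulOpposite

noncomputable section

/-! ### Slices of the quaternions and slice regular functions -/

/-- The sphere of imaginary units. -/
def ImagUnits : Set ℍ[ℝ] := {I | I.re = 0 ∧ ‖I‖ = 1}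

/-- The parametrization `x₀ + i x₁ ↦ x₀ + I x₁` of the plane `ℂ_I = ℝ + I ℝ` by `ℂ`. -/
def sliceEmb (I : ℍ[ℝ]) (z : ℂ) : ℍ[ℝ] := (z.re : ℍ[ℝ]) + z.im • I

/-- The set `U ∩ ℂ_I`, as a subset of `ℂ`. -/
def slice (I : ℍ[ℝ]) (U : Set ℍ[ℝ]) : Set ℂ := sliceEmb I ⁻¹' U

/-- `f` is right slice regular on the open set `U`: it is real differentiable and on each plane
`ℂ_I` it satisfies `½ (∂f/∂x₀ + (∂f/∂x₁) I) = 0` on `U ∩ ℂ_I`. Since `f` is real differentiable,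
the partial derivatives of `f` restricted to `ℂ_I` are the derivatives of `f` in the directions
`1` and `I`. -/
def RightSliceRegularOn (f : ℍ[ℝ] → ℍ[ℝ]) (U : Set ℍ[ℝ]) : Prop :=
  IsOpen U ∧ (∀ x ∈ U, DifferentiableAt ℝ f x) ∧
    ∀ I ∈ ImagUnits, ∀ z ∈ slice I U,
      (1 / 2 : ℝ) • (fderiv ℝ f (sliceEmb I z) 1 + fderiv ℝ f (sliceEmb I z) I * I) = 0

/-- `f` is right slice regular at infinity: it is right slice regular on `{r < |s|}` for some
`r > 0`, and `f(s)` has a limit as `s → ∞`. -/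
def RightSliceRegularAtInfinity (f : ℍ[ℝ] → ℍ[ℝ]) : Prop :=
  (∃ r : ℝ, 0 < r ∧ RightSliceRegularOn f {s | r < ‖s‖}) ∧
    ∃ L : ℍ[ℝ], Tendsto f (Bornology.cobounded ℍ[ℝ]) (𝓝 L)

/-- `U` contains with each point `x₀ + I x₁` the whole sphere of the points `x₀ + J x₁`. -/
def AxiallySymmetric (U : Set ℍ[ℝ]) : Prop :=
  ∀ I ∈ ImagUnits, ∀ J ∈ ImagUnits, slice I U ⊆ slice J U

/-- `U` is a domain that meets the real axis and whose slices `U ∩ ℂ_I` are domains. -/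
def IsSliceDomain (U : Set ℍ[ℝ]) : Prop :=
  IsOpen U ∧ IsConnected U ∧ (∃ x : ℝ, (x : ℍ[ℝ]) ∈ U) ∧
    ∀ I ∈ ImagUnits, IsConnected (slice I U)

/-! ### Boundaries that consist of Jordan curves -/

/-- A continuously differentiable Jordan curve, parametrized with period `1`. -/
def IsC1JordanCurve (γ : ℝ → ℂ) : Prop :=
  ContDiff ℝ 1 γ ∧ Function.Periodic γ 1 ∧ Set.InjOn γ (Set.Ico 0 1)

/-- The boundary of `D` is the union of the finitely many `C¹` Jordan curves `γ k`. -/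
def IsJordanBoundary (D : Set ℂ) {n : ℕ} (γ : Fin n → ℝ → ℂ) : Prop :=
  (∀ k, IsC1JordanCurve (γ k)) ∧ ⋃ k, Set.range (γ k) = frontier D

/-- The winding number of the closed curve `γ` about the point `z`. -/
def windingNumber (γ : ℝ → ℂ) (z : ℂ) : ℂ :=
  (2 * (Real.pi : ℂ) * Complex.I)⁻¹ * ∫ t in (0 : ℝ)..1, deriv γ t / (γ t - z)

/-- The Jordan curves `γ k` make up the boundary of the bounded set `D` with positive
orientation: they wind once around each point of `D`, and not around the points outside its
closure. -/
def IsPositiveJordanBoundary (D : Set ℂ) {n : ℕ} (γ : Fin n → ℝ → ℂ) : Prop :=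
  IsJordanBoundary D γ ∧ (∀ z ∈ D, ∑ k, windingNumber (γ k) z = 1) ∧
    ∀ z ∉ closure D, ∑ k, windingNumber (γ k) z = 0

/-- Admissible sets for an operator with S-spectrum `σ`: axially symmetric slice domains that
contain `σ` and for which all the boundaries `∂(U ∩ ℂ_I)` are finite unions of `C¹` Jordan
curves. -/
def IsAdmissible (σ U : Set ℍ[ℝ]) : Prop :=
  AxiallySymmetric U ∧ IsSliceDomain U ∧ σ ⊆ U ∧
    ∀ I ∈ ImagUnits, ∃ (n : ℕ) (γ : Fin n → ℝ → ℂ), IsJordanBoundary (slice I U) γ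

/-- `f` is right slice regular on some open superset of the closure of `U`. -/
def RightSliceRegularNear (f : ℍ[ℝ] → ℍ[ℝ]) (U : Set ℍ[ℝ]) : Prop :=
  ∃ O : Set ℍ[ℝ], closure U ⊆ O ∧ RightSliceRegularOn f O

/-! ### S-spectrum and S-functional calculus

`V` is a two-sided quaternionic vector space. Right linear operators are the linear operators for
the action of the opposite ring of the quaternions. -/

section Operators

variable {V : Type*} [NormedAddCommGroup V] [NormedSpace ℝ V]
  [Module ℍ[ℝ] V] [IsScalarTower ℝ ℍ[ℝ] V] [IsBoundedSMul ℍ[ℝ] V]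
  [Module ℍ[ℝ]ᵐᵒᵖ V] [IsScalarTower ℝ ℍ[ℝ]ᵐᵒᵖ V] [IsBoundedSMul ℍ[ℝ]ᵐᵒᵖ V]
  [SMulCommClass ℍ[ℝ]ᵐᵒᵖ ℍ[ℝ] V]

/-- `u` lies in the domain of `T²` and `(T² - 2 Re(s) T + |s|² I) u = w`. -/
def SPencilRel (T : V →ₗ.[ℍ[ℝ]ᵐᵒᵖ] V) (s : ℍ[ℝ]) (u w : V) : Prop :=
  ∃ u₁ u₂ : V, (u, u₁) ∈ T.graph ∧ (u₁, u₂) ∈ T.graph ∧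
    w = u₂ - (2 * s.re) • u₁ + (‖s‖ ^ 2) • u

/-- The S-resolvent set of a closed operator `T`: the operator `T² - 2 Re(s) T + |s|² I` from the
domain of `T²` to `V` has an inverse `Q` that is a bounded right linear operator on `V`. -/
def sResolventSet (T : V →ₗ.[ℍ[ℝ]ᵐᵒᵖ] V) : Set ℍ[ℝ] :=
  {s | ∃ Q : V →L[ℍ[ℝ]ᵐᵒᵖ] V, ∀ u w : V, Q w = u ↔ SPencilRel T s u w}

/-- The S-spectrum of a closed operator. -/
def sSpectrum (T : V →ₗ.[ℍ[ℝ]ᵐᵒᵖ] V) : Set ℍ[ℝ] := (sResolventSet T)ᶜ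

/-- The operator `A² - 2 Re(s) A + |s|² I` for a bounded operator `A`. -/
def sPencil (A : V →L[ℍ[ℝ]ᵐᵒᵖ] V) (s : ℍ[ℝ]) : V →L[ℍ[ℝ]ᵐᵒᵖ] V :=
  A * A - (2 * s.re) • A + (‖s‖ ^ 2) • (1 : V →L[ℍ[ℝ]ᵐᵒᵖ] V)

/-- The S-spectrum of a bounded operator: the `s` for which `A² - 2 Re(s) A + |s|² I` is not
invertible among the bounded right linear operators. -/
def boundedSSpectrum (A : V →L[ℍ[ℝ]ᵐᵒᵖ] V) : Set ℍ[ℝ] := {s | ¬ IsUnit (sPencil A s)}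

/-- The right S-resolvent operator `-(A - s̄ I) (A² - 2 Re(s) A + |s|² I)⁻¹` of a bounded
operator, where `s̄ I` is the operator `v ↦ s̄ v`. -/
def rightSResolvent (s : ℍ[ℝ]) (A : V →L[ℍ[ℝ]ᵐᵒᵖ] V) : V →L[ℍ[ℝ]ᵐᵒᵖ] V :=
  -(A - star s • (1 : V →L[ℍ[ℝ]ᵐᵒᵖ] V)) * Ring.inverse (sPencil A s)

/-- The integral `1/(2π) ∫ g(s) ds_I S_R⁻¹(s, A) v` along the closed curves `γ k` in `ℂ_I`, where
`ds_I = -ds I`. -/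
def sIntegral (A : V →L[ℍ[ℝ]ᵐᵒᵖ] V) (g : ℍ[ℝ] → ℍ[ℝ]) (I : ℍ[ℝ])
    {n : ℕ} (γ : Fin n → ℝ → ℂ) (v : V) : V :=
  (2 * Real.pi)⁻¹ • ∑ k, ∫ t in (0 : ℝ)..1,
    (g (sliceEmb I (γ k t)) * (-(sliceEmb I (deriv (γ k) t) * I))) •
      rightSResolvent (sliceEmb I (γ k t)) A v

/-- `B` is the operator `g[A]` of the S-functional calculus for the bounded operator `A`: `g` is
right slice regular near the closure of some bounded admissible set `U`, with positively
oriented boundaries, and, for every choice of such a `U`, of the imaginary unit `I`, and of the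
parametrization of `∂(U ∩ ℂ_I)`, the integral that defines `g[A]` has the value `B`. -/
def IsBoundedSCalculus (A : V →L[ℍ[ℝ]ᵐᵒᵖ] V) (g : ℍ[ℝ] → ℍ[ℝ]) (B : V →L[ℍ[ℝ]ᵐᵒᵖ] V) : Prop :=
  (∃ U : Set ℍ[ℝ], Bornology.IsBounded U ∧ IsAdmissible (boundedSSpectrum A) U ∧
    RightSliceRegularNear g U ∧ ∀ I ∈ ImagUnits, ∃ (n : ℕ) (γ : Fin n → ℝ → ℂ),
      IsPositiveJordanBoundary (slice I U) γ) ∧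
  ∀ U : Set ℍ[ℝ], Bornology.IsBounded U → IsAdmissible (boundedSSpectrum A) U →
    RightSliceRegularNear g U → ∀ I ∈ ImagUnits, ∀ (n : ℕ) (γ : Fin n → ℝ → ℂ),
      IsPositiveJordanBoundary (slice I U) γ → ∀ v : V, B v = sIntegral A g I γ v

/-- The function `f ∘ Φ_α⁻¹`, where `Φ_α(s) = (s - α)⁻¹`, `Φ_α(∞) = 0` and `f(∞) = L`. -/
def invTransport (f : ℍ[ℝ] → ℍ[ℝ]) (L : ℍ[ℝ]) (α : ℝ) (p : ℍ[ℝ]) : ℍ[ℝ] :=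
  open Classical in if p = 0 then L else f (p⁻¹ + (α : ℍ[ℝ]))

/-- `A` is the bounded operator `(T - α I)⁻¹`. -/
def IsRealResolvent (T : V →ₗ.[ℍ[ℝ]ᵐᵒᵖ] V) (α : ℝ) (A : V →L[ℍ[ℝ]ᵐᵒᵖ] V) : Prop :=
  ∀ u w : V, A w = u ↔ (u, w + α • u) ∈ T.graph

/-- `B` is the operator `f[T]` of the S-functional calculus for the closed operator `T`: the
S-resolvent set of `T` contains a real number, `f` is right slice regular near the closure of a
`T`-admissible set and at infinity, and `(f ∘ Φ_α⁻¹)[(T - α I)⁻¹] = B` for every real `α` in the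
S-resolvent set. -/
def IsSCalculus (T : V →ₗ.[ℍ[ℝ]ᵐᵒᵖ] V) (f : ℍ[ℝ] → ℍ[ℝ]) (B : V →L[ℍ[ℝ]ᵐᵒᵖ] V) : Prop :=
  (∃ α : ℝ, (α : ℍ[ℝ]) ∈ sResolventSet T) ∧
  (∃ U : Set ℍ[ℝ], IsAdmissible (sSpectrum T) U ∧ RightSliceRegularNear f U) ∧
  RightSliceRegularAtInfinity f ∧
  ∀ L : ℍ[ℝ], Tendsto f (Bornology.cobounded ℍ[ℝ]) (𝓝 L) →
    ∀ α : ℝ, (α : ℍ[ℝ]) ∈ sResolventSet T →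
      ∃ A : V →L[ℍ[ℝ]ᵐᵒᵖ] V, IsRealResolvent T α A ∧ IsBoundedSCalculus A (invTransport f L α) B

/-! ### Strongly continuous groups -/

/-- A strongly continuous group of bounded right linear operators. -/
def IsStronglyContinuousGroup (Z : ℝ → V →L[ℍ[ℝ]ᵐᵒᵖ] V) : Prop :=
  (∀ v, Z 0 v = v) ∧ (∀ s t v, Z (s + t) v = Z s (Z t v)) ∧ ∀ v, Continuous fun t => Z t v

/-- `T` is the infinitesimal generator of `Z`: its domain consists of all `v` for which
`(Z(h)v - v)/h` has a limit as `h → 0⁺`, and `T v` is this limit. -/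
def IsGenerator (Z : ℝ → V →L[ℍ[ℝ]ᵐᵒᵖ] V) (T : V →ₗ.[ℍ[ℝ]ᵐᵒᵖ] V) : Prop :=
  ∀ v w : V, (v, w) ∈ T.graph ↔ Tendsto (fun h : ℝ => h⁻¹ • (Z h v - v)) (𝓝[>] 0) (𝓝 w)

/-! ### Quaternionic measures and the Laplace–Stieltjes transform -/

/-- The integral `∫ dμ(t) F(t)` of a vector valued function with respect to a quaternionic
measure, the values of the measure acting by multiplication from the left. -/
def leftIntegral (μ : VectorMeasure ℝ ℍ[ℝ]) (F : ℝ → V) : V :=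
  μ.integral F (ContinuousLinearMap.lsmul ℝ ℍ[ℝ]).flip

end Operators

/-- The quaternionic bilateral (right) Laplace–Stieltjes transform `∫ dμ(t) e^{-st}`. -/
def laplaceStieltjes (μ : VectorMeasure ℝ ℍ[ℝ]) (s : ℍ[ℝ]) : ℍ[ℝ] :=
  leftIntegral μ fun t : ℝ => NormedSpace.exp (-(t • s))

/-- `∫ e^{(ω+ε)|t|} d|μ|(t)` is finite for some `ε > 0`, and `f` is the Laplace–Stieltjes transform
of `μ` on the strip `|Re s| < ω + ε`. -/
def IsTransformOf (ω : ℝ) (f : ℍ[ℝ] → ℍ[ℝ]) (μ : VectorMeasure ℝ ℍ[ℝ]) : Prop :=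
  ∃ ε : ℝ, 0 < ε ∧ Integrable (fun t : ℝ => Real.exp ((ω + ε) * |t|)) μ.variation ∧
    ∀ s : ℍ[ℝ], |s.re| < ω + ε → f s = laplaceStieltjes μ s

end

/-! Put A = (T - α)⁻¹, and let z = α + 1/q be the point of the plane of T that belongs to the point
q of a contour for A. Where |Re z| > ω, the right S-resolvent of A is a Laplace integral of the
group, S_R⁻¹(q, A)v = q⁻¹v - q⁻² ∫ κ_z(τ) Z(-τ)v dτ with a one-sided exponential κ_z
(`IsGroupResolvent.rightSResolvent_apply`). Integrating this against g(q) dq_I over a contour with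
|Re z| ≥ a > ω and applying Fubini yields c v + ∫ k(τ) Z(-τ)v dτ, where k(τ) = O(e^(-a|τ|)). The
quaternion c and the kernel k depend on f and the contour, but neither on the group nor on V.

This universality identifies c δ₀ + k dτ with 2πμ. For V = ℍ and the scalar group Z(t) = e^(tx) with
x real, Cauchy's formula gives the same contour integral the value 2π f(x), and f(x) is the Laplace
transform of μ (`DiscFamily.IsAdapted.laplace_eq`). The two measures thus have equal Laplace
transforms on a real interval, and by uniqueness (`integral_smul_eq_of_laplace`) they have equal
integrals against t ↦ Z(-t)v, whose growth rate ω is smaller than a. Hence 2π f[T]v = 2π ∫ dμ(t)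
Z(-t)v.

The contours are images under q = (z - α)⁻¹ of circles: two large ones in {|Re z| ≥ a}, outside of
which f is regular, and, if |α| ≤ ω, a small one about α, since α corresponds to q = ∞ and a bounded
domain has to avoid it. On the small circle the resolvent is no Laplace integral, but it is q⁻¹v
plus a term whose integral vanishes by Cauchy's theorem, so it only contributes to c
(`integral_contour_small`). Any other admissible contour gives the same value
(`sum_integral_rightSResolvent_eq`), by the homology form of Cauchy's theorem, proved with Dixon's
argument.

Noncommutativity is handled by complex structures. Right slice regular functions are holomorphic for
q ↦ qI and the resolvent for v ↦ Iv; their product becomes holomorphic after splitting the first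
factor into its part in ℂ_I and the orthogonal part. Invertibility of the real quadratic pencils is
proved with right multiplication by I, which commutes with A and lets the pencil factor. The
resolvent itself is characterized as the unique solution Y of qY - YA = 1. -/

/-! ### Cauchy's theorem for measures whose Cauchy transform vanishes off the domain -/

open Metric in
/-- Integrals of holomorphic functions that are locally bounded, uniformly in the parameter, are
holomorphic. -/
lemma differentiableOn_integral_of_locally_bounded {X : Type*} [MeasurableSpace X] {m : Measure X}
    {N : Set ℂ} (hN : IsOpen N) {ρ : X → ℂ} (hρ : Integrable ρ m) {φ : ℂ → X → ℂ}
    (hφ : ∀ x, DifferentiableOn ℂ (fun z => φ z x) N)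
    (hm : ∀ z ∈ N, AEStronglyMeasurable (φ z) m)
    (hb : ∀ z ∈ N, ∃ r > 0, ∃ M, ball z r ⊆ N ∧ ∀ w ∈ ball z r, ∀ x, ‖φ w x‖ ≤ M) :
    DifferentiableOn ℂ (fun z => ∫ x, ρ x * φ z x ∂m) N := by
  intro z hz
  obtain ⟨r, hr, M, hrN, hM⟩ := hb z hz
  have hda : ∀ x, ∀ w ∈ ball z r, DifferentiableAt ℂ (fun z => φ z x) w := fun x w hw =>
    (hφ x).differentiableAt (hN.mem_nhds (hrN hw))
  have hmeas : AEStronglyMeasurable (fun x => deriv (fun z => φ z x) z) m := by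
    -- The derivative is measurable as a limit of difference quotients; the steps r/(n + 2) are at
    -- most r/2 and so stay in the ball.
    have hu : Tendsto (fun n : ℕ => (((r / (n + 2) : ℝ)) : ℂ)) atTop (𝓝[≠] 0) := by
      rw [tendsto_nhdsWithin_iff]
      constructor
      · have : Tendsto (fun n : ℕ => r / ((n : ℝ) + 2)) atTop (𝓝 0) :=
          tendsto_const_nhds.div_atTop
            (tendsto_atTop_add_const_right _ _ tendsto_natCast_atTop_atTop)
        have h := (Complex.continuous_ofReal.tendsto 0).comp this
        rwa [Complex.ofReal_zero] at h
      · refine Eventually.of_forall fun n => ?_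
        have : (0 : ℝ) < r / (n + 2) := by positivity
        exact Complex.ofReal_ne_zero.2 this.ne'
    refine aestronglyMeasurable_of_tendsto_ae atTop
      (f := fun (n : ℕ) x => (((r / (n + 2) : ℝ)) : ℂ)⁻¹ •
        (φ (z + ((r / (n + 2) : ℝ) : ℂ)) x - φ z x)) (fun n => ?_) ?_
    · refine AEStronglyMeasurable.const_smul
        (f := fun x => φ (z + ((r / (n + 2) : ℝ) : ℂ)) x - φ z x)
        (AEStronglyMeasurable.sub (hm _ (hrN ?_)) (hm z hz)) (((r / (n + 2) : ℝ)) : ℂ)⁻¹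
      have : (0 : ℝ) < r / (n + 2) := by positivity
      rw [mem_ball_iff_norm, add_sub_cancel_left, Complex.norm_real, Real.norm_eq_abs,
        abs_of_pos this, div_lt_iff₀ (by positivity)]
      nlinarith [Nat.cast_nonneg (α := ℝ) n]
    · refine Eventually.of_forall fun x => ?_
      exact ((hda x z (mem_ball_self hr)).hasDerivAt.tendsto_slope_zero).comp hu
  -- The constant M/(r/2) is Cauchy's estimate on discs of radius r/2 about the points of the half
  -- ball.
  have key := hasDerivAt_integral_of_dominated_loc_of_deriv_le (μ := m) (x₀ := z)
    (F := fun w x => ρ x * φ w x) (F' := fun w x => ρ x * deriv (fun z => φ z x) w)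
    (bound := fun x => ‖ρ x‖ * (M / (r / 2))) (ball_mem_nhds z (half_pos hr)) ?_ ?_ ?_ ?_ ?_ ?_
  · exact key.2.differentiableAt.differentiableWithinAt
  · filter_upwards [hN.mem_nhds hz] with w hw using hρ.aestronglyMeasurable.mul (hm w hw)
  · exact hρ.mul_bdd (hm z hz) (Eventually.of_forall (hM z (mem_ball_self hr)))
  · exact hρ.aestronglyMeasurable.mul hmeas
  · refine Eventually.of_forall fun x w hw => ?_
    rw [norm_mul]
    gcongr
    refine Complex.norm_deriv_le_of_forall_mem_sphere_norm_le (half_pos hr) ?_ ?_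
    · refine DifferentiableOn.diffContOnCl fun u hu => ((hφ x).mono ?_) u hu
      rw [closure_ball _ (half_pos hr).ne']
      refine (closedBall_subset_ball' ?_).trans hrN
      have := mem_ball.1 hw
      linarith
    · intro u hu
      refine hM u ?_ x
      have h1 := mem_ball.1 hw
      have h2 := mem_sphere.1 hu
      have := dist_triangle u w z
      rw [mem_ball]
      linarith
  · exact hρ.norm.mul_const _
  · refine Eventually.of_forall fun x w hw => ?_
    exact ((hda x w (ball_subset_ball (by linarith) hw)).hasDerivAt).const_mul _

/-- The difference quotient of a holomorphic function is jointly continuous. -/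
lemma continuousOn_dslope_prod {Ω : Set ℂ} (hΩ : IsOpen Ω) {F : ℂ → ℂ}
    (hF : DifferentiableOn ℂ F Ω) :
    ContinuousOn (fun p : ℂ × ℂ => dslope F p.1 p.2) (Ω ×ˢ Ω) := by
  rintro ⟨a, b⟩ ⟨ha, hb⟩
  refine ContinuousAt.continuousWithinAt ?_
  simp only at ha hb
  by_cases hab : a = b
  · subst hab
    -- Strict differentiability controls the quotient when both points move; continuity of F'
    -- controls it on the diagonal.
    have hst : HasStrictDerivAt F (deriv F a) a :=
      (hF.analyticAt (hΩ.mem_nhds ha)).hasStrictDerivAt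
    have hdc : ContinuousAt (deriv F) a :=
      ((hF.deriv hΩ).differentiableAt (hΩ.mem_nhds ha)).continuousAt
    rw [ContinuousAt, Metric.tendsto_nhds]
    intro ε hε
    have h1 : ∀ᶠ p : ℂ × ℂ in 𝓝 (a, a),
        ‖F p.1 - F p.2 - (p.1 - p.2) * deriv F a‖ ≤ ε / 2 * ‖p.1 - p.2‖ := by
      have := (hasStrictFDerivAt_iff_isLittleO.1 hst.hasStrictFDerivAt).bound (half_pos hε)
      simpa using this
    have h2 : ∀ᶠ p : ℂ × ℂ in 𝓝 (a, a), dist (deriv F p.1) (deriv F a) < ε :=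
      (continuous_fst.tendsto (a, a)).eventually (Metric.tendsto_nhds.1 hdc ε hε)
    filter_upwards [h1, h2] with p hp1 hp2
    simp only [dslope_same]
    by_cases hp : p.2 = p.1
    · rw [hp, dslope_same]; exact hp2
    · rw [dslope_of_ne _ hp, slope_def_field, dist_eq_norm]
      have hne : p.2 - p.1 ≠ 0 := sub_ne_zero.2 hp
      have : (F p.2 - F p.1) / (p.2 - p.1) - deriv F a =
          (F p.1 - F p.2 - (p.1 - p.2) * deriv F a) / (p.1 - p.2) := by
        have : p.1 - p.2 ≠ 0 := sub_ne_zero.2 (Ne.symm hp)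
        field_simp
        ring
      rw [this, norm_div, div_lt_iff₀ (norm_pos_iff.2 (sub_ne_zero.2 (Ne.symm hp)))]
      have : 0 < ‖p.1 - p.2‖ := norm_pos_iff.2 (sub_ne_zero.2 (Ne.symm hp))
      nlinarith
  · have hne : ∀ᶠ p : ℂ × ℂ in 𝓝 (a, b), p.2 ≠ p.1 :=
      (isOpen_ne_fun continuous_snd continuous_fst).mem_nhds (Ne.symm hab)
    have : ContinuousAt (fun p : ℂ × ℂ => (F p.2 - F p.1) / (p.2 - p.1)) (a, b) := by
      have h1 : ContinuousAt F a := (hF.differentiableAt (hΩ.mem_nhds ha)).continuousAt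
      have h2 : ContinuousAt F b := (hF.differentiableAt (hΩ.mem_nhds hb)).continuousAt
      refine ContinuousAt.div ?_ (by fun_prop) (sub_ne_zero.2 (Ne.symm hab))
      exact (ContinuousAt.comp (f := Prod.snd) (x := (a, b)) h2 continuousAt_snd).sub
        (ContinuousAt.comp (f := Prod.fst) (x := (a, b)) h1 continuousAt_fst)
    refine this.congr ?_
    filter_upwards [hne] with p hp
    rw [dslope_of_ne _ hp, slope_def_field]

lemma dslope_symm (F : ℂ → ℂ) (a b : ℂ) : dslope F a b = dslope F b a := by
  by_cases h : a = b
  · rw [h]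
  · rw [dslope_of_ne _ (Ne.symm h), dslope_of_ne _ h, slope_comm]

/-- Extension of g by zero off K makes it Borel without changing g ∘ γ. -/
lemma measurable_comp_of_continuousOn {X : Type*} [MeasurableSpace X] {K : Set ℂ}
    (hK : IsCompact K) {g : ℂ → ℂ} (hg : ContinuousOn g K) {γ : X → ℂ} (hγ : Measurable γ)
    (hγK : ∀ x, γ x ∈ K) : Measurable fun x => g (γ x) := by
  classical
  have h1 : Measurable (K.piecewise g fun _ => 0) :=
    hg.measurable_piecewise continuousOn_const hK.measurableSet
  have h2 : (fun x => g (γ x)) = (K.piecewise g fun _ => 0) ∘ γ := by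
    ext x; simp [Set.piecewise, hγK x]
  rw [h2]; exact h1.comp hγ

open Metric in
lemma exists_bound_of_continuousOn_prod {N K : Set ℂ} (hN : IsOpen N) (hK : IsCompact K)
    {Φ : ℂ × ℂ → ℂ} (hΦ : ContinuousOn Φ (N ×ˢ K)) {z : ℂ} (hz : z ∈ N) :
    ∃ r > 0, ∃ M, ball z r ⊆ N ∧ ∀ w ∈ ball z r, ∀ u ∈ K, ‖Φ (w, u)‖ ≤ M := by
  obtain ⟨r, hr, hrN⟩ := nhds_basis_closedBall.mem_iff.1 (hN.mem_nhds hz)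
  obtain ⟨M, hM⟩ := ((isCompact_closedBall z r).prod hK).exists_bound_of_continuousOn
    (hΦ.mono (Set.prod_mono hrN le_rfl))
  exact ⟨r, hr, M, ball_subset_closedBall.trans hrN, fun w hw u hu =>
    hM (w, u) ⟨ball_subset_closedBall hw, hu⟩⟩

open Metric in
/-- Dixon's argument: a measure whose Cauchy transform vanishes off `Ω` annihilates the difference
quotients of the holomorphic functions on `Ω`. -/
theorem integral_dslope_eq_zero_of_cauchyTransform {X : Type*} [MeasurableSpace X] {m : Measure X}
    {Ω W K : Set ℂ} (hΩ : IsOpen Ω) (hW : IsOpen W) (hcov : ∀ z, z ∈ Ω ∨ z ∈ W)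
    (hWinf : W ∈ Bornology.cobounded ℂ) (hK : IsCompact K) (hKΩ : K ⊆ Ω)
    {γ ρ : X → ℂ} (hγ : Measurable γ) (hγK : ∀ x, γ x ∈ K) (hρ : Integrable ρ m)
    (h0 : ∀ z ∈ W, z ∉ K → ∫ x, ρ x * (γ x - z)⁻¹ ∂m = 0)
    {F : ℂ → ℂ} (hF : DifferentiableOn ℂ F Ω) {p : ℂ} (hp : p ∈ Ω) :
    ∫ x, ρ x * dslope F p (γ x) ∂m = 0 := by
  classical
  have hcd := continuousOn_dslope_prod hΩ hF
  have hN : IsOpen (W ∩ Kᶜ) := hW.inter hK.isClosed.isOpen_compl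
  have hFK : ContinuousOn F K := (hF.continuousOn).mono hKΩ
  have hdΩ : DifferentiableOn ℂ (fun z => ∫ x, ρ x * dslope F z (γ x) ∂m) Ω := by
    refine differentiableOn_integral_of_locally_bounded hΩ hρ (fun x => ?_) (fun z hz => ?_) ?_
    · simp_rw [dslope_symm F _ (γ x)]
      exact (Complex.differentiableOn_dslope (hΩ.mem_nhds (hKΩ (hγK x)))).2 hF
    · refine (measurable_comp_of_continuousOn hK ?_ hγ hγK).aestronglyMeasurable
      exact ((Complex.differentiableOn_dslope (hΩ.mem_nhds hz)).2 hF).continuousOn.mono hKΩ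
    · intro z hz
      obtain ⟨r, hr, M, h1, h2⟩ := exists_bound_of_continuousOn_prod hΩ hK
        (hcd.mono (Set.prod_mono le_rfl hKΩ)) hz
      exact ⟨r, hr, M, h1, fun w hw x => h2 w hw _ (hγK x)⟩
  have hcont2 : ContinuousOn (fun p : ℂ × ℂ => F p.2 * (p.2 - p.1)⁻¹) ((W ∩ Kᶜ) ×ˢ K) := by
    refine (hFK.comp continuousOn_snd fun p hp => hp.2).mul
      (ContinuousOn.inv₀ (by fun_prop) ?_)
    rintro ⟨a, b⟩ ⟨ha, hb⟩
    exact sub_ne_zero.2 fun h => ha.2 (h ▸ hb)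
  have hdW : DifferentiableOn ℂ (fun z => ∫ x, ρ x * (F (γ x) * (γ x - z)⁻¹) ∂m) (W ∩ Kᶜ) := by
    refine differentiableOn_integral_of_locally_bounded hN hρ (fun x => ?_) (fun z hz => ?_) ?_
    · intro z hz
      have : γ x - z ≠ 0 := sub_ne_zero.2 fun h => hz.2 (h ▸ hγK x)
      exact (((differentiableAt_const _).sub differentiableAt_id).inv this).const_mul _
        |>.differentiableWithinAt
    · refine (measurable_comp_of_continuousOn hK (g := fun w => F w * (w - z)⁻¹)
        (hcont2.comp (f := fun w => (z, w)) (by fun_prop) fun w hw => ⟨hz, hw⟩)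
        hγ hγK).aestronglyMeasurable
    · intro z hz
      obtain ⟨r, hr, M, h1, h2⟩ := exists_bound_of_continuousOn_prod hN hK hcont2 hz
      exact ⟨r, hr, M, h1, fun w hw x => h2 w hw _ (hγK x)⟩
  have hbdd : ∀ z, z ∉ K → ∃ M, ∀ x, ‖(γ x - z)⁻¹‖ ≤ M := by
    intro z hz
    have : ContinuousOn (fun w : ℂ => (w - z)⁻¹) K := by
      refine ContinuousOn.inv₀ (by fun_prop) fun w hw => sub_ne_zero.2 ?_
      rintro rfl
      exact hz hw
    obtain ⟨M, hM⟩ := hK.exists_bound_of_continuousOn this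
    exact ⟨M, fun x => hM _ (hγK x)⟩
  obtain ⟨MF, hMF⟩ := hK.exists_bound_of_continuousOn hFK
  have hFmeas : Measurable fun x => F (γ x) := measurable_comp_of_continuousOn hK hFK hγ hγK
  have heq : ∀ z ∈ Ω, z ∈ W ∩ Kᶜ → ∫ x, ρ x * dslope F z (γ x) ∂m =
      ∫ x, ρ x * (F (γ x) * (γ x - z)⁻¹) ∂m := by
    intro z hz hzW
    obtain ⟨M, hM⟩ := hbdd z hzW.2
    have e1 : ∀ x, ρ x * dslope F z (γ x) =
        ρ x * (F (γ x) * (γ x - z)⁻¹) - F z * (ρ x * (γ x - z)⁻¹) := by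
      intro x
      have : γ x ≠ z := fun h => hzW.2 (h ▸ hγK x)
      rw [dslope_of_ne _ this, slope_def_field, div_eq_mul_inv]
      ring
    have i1 : Integrable (fun x => ρ x * (γ x - z)⁻¹) m :=
      hρ.mul_bdd (c := M) (by fun_prop) (Eventually.of_forall hM)
    have i2 : Integrable (fun x => ρ x * (F (γ x) * (γ x - z)⁻¹)) m := by
      refine hρ.mul_bdd (c := MF * M)
        (hFmeas.mul (hγ.sub_const z).inv).aestronglyMeasurable (Eventually.of_forall fun x => ?_)
      rw [norm_mul]
      gcongr
      · exact (norm_nonneg _).trans (hMF _ (hγK x))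
      · exact hMF _ (hγK x)
      · exact hM x
    simp_rw [e1]
    rw [integral_sub i2 (i1.const_mul _), integral_const_mul, h0 z hzW.1 hzW.2]
    simp
  -- On the overlap the two integrals differ by F(z) times the Cauchy transform, which vanishes
  -- there. They glue to an entire function that tends to 0 at infinity, so Liouville's theorem
  -- applies.
  set h : ℂ → ℂ := fun z => if z ∈ Ω then ∫ x, ρ x * dslope F z (γ x) ∂m else
    ∫ x, ρ x * (F (γ x) * (γ x - z)⁻¹) ∂m with hdef
  have hW' : ∀ z ∈ W ∩ Kᶜ, h z = ∫ x, ρ x * (F (γ x) * (γ x - z)⁻¹) ∂m := by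
    intro z hz
    by_cases hzΩ : z ∈ Ω
    · simp only [hdef, hzΩ, if_true]; exact heq z hzΩ hz
    · simp only [hdef, hzΩ, if_false]
  have hΩ' : ∀ z ∈ Ω, h z = ∫ x, ρ x * dslope F z (γ x) ∂m := by
    intro z hz
    simp only [hdef, hz, if_true]
  have hentire : Differentiable ℂ h := by
    intro z
    by_cases hz : z ∈ Ω
    · refine (hdΩ.differentiableAt (hΩ.mem_nhds hz)).congr_of_eventuallyEq ?_
      filter_upwards [hΩ.mem_nhds hz] with w hw using hΩ' w hw
    · have hz' : z ∈ W ∩ Kᶜ := ⟨(hcov z).resolve_left hz, fun h => hz (hKΩ h)⟩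
      refine (hdW.differentiableAt (hN.mem_nhds hz')).congr_of_eventuallyEq ?_
      filter_upwards [hN.mem_nhds hz'] with w hw using hW' w hw
  have hlim : Tendsto h (cocompact ℂ) (𝓝 0) := by
    obtain ⟨R, hR⟩ := hK.isBounded.exists_norm_le
    rw [← cobounded_eq_cocompact]
    have hnorm : Tendsto (fun z : ℂ => (∫ x, ‖ρ x‖ ∂m) * (MF * (‖z‖ - R)⁻¹))
        (Bornology.cobounded ℂ) (𝓝 0) := by
      have h1 : Tendsto (fun z : ℂ => ‖z‖ - R) (Bornology.cobounded ℂ) atTop :=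
        tendsto_atTop_add_const_right _ _ tendsto_norm_cobounded_atTop
      simpa using (h1.inv_tendsto_atTop.const_mul MF).const_mul (∫ x, ‖ρ x‖ ∂m)
    refine squeeze_zero_norm' ?_ hnorm
    have hbig : ∀ᶠ z : ℂ in Bornology.cobounded ℂ, R < ‖z‖ :=
      tendsto_norm_cobounded_atTop.eventually_gt_atTop R
    filter_upwards [hWinf, hbig] with z hz1 hz2
    have hzK : z ∉ K := fun hzK => absurd (hR z hzK) (not_le.2 hz2)
    rw [hW' z ⟨hz1, hzK⟩, ← integral_mul_const]
    refine norm_integral_le_of_norm_le (hρ.norm.mul_const _) (Eventually.of_forall fun x => ?_)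
    rw [norm_mul, norm_mul, norm_inv]
    have h1 : ‖F (γ x)‖ ≤ MF := hMF _ (hγK x)
    have h2 : ‖z‖ - R ≤ ‖γ x - z‖ := by
      have := norm_sub_norm_le z (γ x)
      rw [norm_sub_rev] at this
      linarith [hR _ (hγK x)]
    have h3 : 0 < ‖z‖ - R := by linarith
    have : 0 ≤ MF := (norm_nonneg _).trans h1
    gcongr
  rw [← hΩ' p hp]
  exact hentire.apply_eq_of_tendsto_cocompact p hlim

/-- `ρ` is a density along `γ`, with values in a compact part of the open set `Ω`, whose Cauchy
transform vanishes on an open set that covers the complement of `Ω` and a neighbourhood of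
infinity. -/
structure IsCauchyNull {X : Type*} [MeasurableSpace X] (m : Measure X) (Ω : Set ℂ)
    (γ ρ : X → ℂ) : Prop where
  isOpen : IsOpen Ω
  measurable : Measurable γ
  integrable : Integrable ρ m
  exists_compact : ∃ K : Set ℂ, IsCompact K ∧ K ⊆ Ω ∧ (∀ x, γ x ∈ K) ∧
    ∃ W : Set ℂ, IsOpen W ∧ (∀ z, z ∈ Ω ∨ z ∈ W) ∧ W ∈ Bornology.cobounded ℂ ∧
      ∀ z ∈ W, z ∉ K → ∫ x, ρ x * (γ x - z)⁻¹ ∂m = 0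

namespace IsCauchyNull

variable {X : Type*} [MeasurableSpace X] {m : Measure X} {Ω : Set ℂ} {γ ρ : X → ℂ}

lemma integral_dslope (h : IsCauchyNull m Ω γ ρ) {F : ℂ → ℂ} (hF : DifferentiableOn ℂ F Ω) {p : ℂ}
    (hp : p ∈ Ω) : ∫ x, ρ x * dslope F p (γ x) ∂m = 0 := by
  obtain ⟨K, hK, hKΩ, hγK, W, hW, hcov, hinf, h0⟩ := h.exists_compact
  exact integral_dslope_eq_zero_of_cauchyTransform h.isOpen hW hcov hinf hK hKΩ h.measurable hγK
    h.integrable h0 hF hp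

/-- Cauchy's theorem. -/
lemma integral_mul_eq_zero (h : IsCauchyNull m Ω γ ρ) {F : ℂ → ℂ} (hF : DifferentiableOn ℂ F Ω) :
    ∫ x, ρ x * F (γ x) ∂m = 0 := by
  obtain ⟨K, hK, hKΩ, hγK, -⟩ := h.exists_compact
  rcases isEmpty_or_nonempty X with hX | ⟨⟨x₀⟩⟩
  · exact integral_of_isEmpty
  have hp : γ x₀ ∈ Ω := hKΩ (hγK x₀)
  -- The difference quotient of (w - γ x₀) F(w) at γ x₀ is F itself.
  have key := h.integral_dslope (F := fun w => (w - γ x₀) * F w)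
    ((differentiableOn_id.sub_const _).mul hF) hp
  rw [← key]
  refine integral_congr_ae (Eventually.of_forall fun x => congrArg (ρ x * ·) ?_)
  by_cases hx : γ x = γ x₀
  · rw [hx, dslope_same]
    have h1 : HasDerivAt (fun w => (w - γ x₀) * F w) (1 * F (γ x₀) + (γ x₀ - γ x₀) *
        deriv F (γ x₀)) (γ x₀) :=
      ((hasDerivAt_id _).sub_const _).mul (hF.differentiableAt (h.isOpen.mem_nhds hp)).hasDerivAt
    rw [h1.deriv]
    simp
  · rw [dslope_of_ne _ hx, slope_def_field]
    have : γ x - γ x₀ ≠ 0 := sub_ne_zero.2 hx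
    field_simp
    ring

lemma exists_bound (h : IsCauchyNull m Ω γ ρ) {E : Type*} [NormedAddCommGroup E] {F : ℂ → E}
    (hF : ContinuousOn F Ω) : ∃ C, ∀ x, ‖F (γ x)‖ ≤ C := by
  obtain ⟨K, hK, hKΩ, hγK, -⟩ := h.exists_compact
  obtain ⟨C, hC⟩ := hK.exists_bound_of_continuousOn (hF.mono hKΩ)
  exact ⟨C, fun x => hC _ (hγK x)⟩

lemma aestronglyMeasurable (h : IsCauchyNull m Ω γ ρ) {F : ℂ → ℂ} (hF : ContinuousOn F Ω) :
    AEStronglyMeasurable (fun x => F (γ x)) m := by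
  obtain ⟨K, hK, hKΩ, hγK, -⟩ := h.exists_compact
  exact (measurable_comp_of_continuousOn hK (hF.mono hKΩ) h.measurable hγK).aestronglyMeasurable

/-- Cauchy's formula. -/
lemma integral_mul_inv_sub (h : IsCauchyNull m Ω γ ρ) {F : ℂ → ℂ} (hF : DifferentiableOn ℂ F Ω)
    {p : ℂ} (hp : p ∈ Ω) {δ : ℝ} (hδ : 0 < δ) (hpγ : ∀ x, δ ≤ ‖γ x - p‖) :
    ∫ x, ρ x * (γ x - p)⁻¹ * F (γ x) ∂m = (∫ x, ρ x * (γ x - p)⁻¹ ∂m) * F p := by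
  have hb : ∀ x, ‖(γ x - p)⁻¹‖ ≤ δ⁻¹ := fun x => by
    rw [norm_inv]; exact inv_anti₀ hδ (hpγ x)
  have i1 : Integrable (fun x => ρ x * (γ x - p)⁻¹) m :=
    h.integrable.mul_bdd (c := δ⁻¹) ((h.measurable.sub_const p).inv).aestronglyMeasurable
      (Eventually.of_forall hb)
  obtain ⟨C, hC⟩ := h.exists_bound hF.continuousOn
  have i2 : Integrable (fun x => ρ x * (γ x - p)⁻¹ * F (γ x)) m :=
    i1.mul_bdd (h.aestronglyMeasurable hF.continuousOn) (Eventually.of_forall hC)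
  have key := h.integral_dslope hF hp
  have e : ∀ x, ρ x * dslope F p (γ x) =
      ρ x * (γ x - p)⁻¹ * F (γ x) - ρ x * (γ x - p)⁻¹ * F p := by
    intro x
    have hx : γ x ≠ p := fun h => by
      have := hpγ x
      rw [h, sub_self, norm_zero] at this
      linarith
    rw [dslope_of_ne _ hx, slope_def_field, div_eq_mul_inv]
    ring
  simp_rw [e] at key
  rw [integral_sub i2 (i1.mul_const _), integral_mul_const, sub_eq_zero] at key
  exact key

end IsCauchyNull

/-! ### Functions that are holomorphic for a complex structure -/

section ComplexStructure

variable {E : Type*} [NormedAddCommGroup E] [NormedSpace ℝ E]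

/-- Multiplication by a complex number for the complex structure `J`. -/
def jsmul (J : E →L[ℝ] E) (z : ℂ) (v : E) : E := z.re • v + z.im • J v

/-- Complex differentiability for the complex structure `J`. -/
def JDiffAt (J : E →L[ℝ] E) (Ψ : ℂ → E) (z : ℂ) : Prop :=
  DifferentiableAt ℝ Ψ z ∧ fderiv ℝ Ψ z Complex.I = J (fderiv ℝ Ψ z 1)

/-- The complex linear functional with real part `φ`. -/
noncomputable def complexify (J : E →L[ℝ] E) (φ : E →L[ℝ] ℝ) : E →L[ℝ] ℂ :=
  Complex.ofRealCLM.comp φ - Complex.I • Complex.ofRealCLM.comp (φ.comp J)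

lemma complexify_apply (J : E →L[ℝ] E) (φ : E →L[ℝ] ℝ) (v : E) :
    complexify J φ v = (φ v : ℂ) - Complex.I * (φ (J v) : ℂ) := by
  simp [complexify]

lemma complexify_re (J : E →L[ℝ] E) (φ : E →L[ℝ] ℝ) (v : E) :
    (complexify J φ v).re = φ v := by
  simp [complexify_apply]

lemma complexify_jsmul {J : E →L[ℝ] E} (hJ : ∀ v, J (J v) = -v) (φ : E →L[ℝ] ℝ) (z : ℂ) (v : E) :
    complexify J φ (jsmul J z v) = z * complexify J φ v := by
  apply Complex.ext <;> simp [complexify_apply, jsmul, hJ]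
  ring

/-- Reduces Cauchy's theorem for `J` to scalar functions: the real parts of the functionals
`complexify J φ` are all real functionals, and these separate points. -/
lemma JDiffAt.complexify {J : E →L[ℝ] E} (hJ : ∀ v, J (J v) = -v) (φ : E →L[ℝ] ℝ) {Ψ : ℂ → E}
    {z : ℂ} (h : JDiffAt J Ψ z) : DifferentiableAt ℂ (fun w => complexify J φ (Ψ w)) z := by
  rw [differentiableAt_complex_iff_differentiableAt_real]
  have h1 : HasFDerivAt (fun w => _root_.complexify J φ (Ψ w))
      ((_root_.complexify J φ).comp (fderiv ℝ Ψ z)) z :=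
    (_root_.complexify J φ).hasFDerivAt.comp z h.1.hasFDerivAt
  refine ⟨h1.differentiableAt, ?_⟩
  rw [h1.fderiv]
  simp only [ContinuousLinearMap.comp_apply, h.2, smul_eq_mul]
  have := complexify_jsmul hJ φ Complex.I (fderiv ℝ Ψ z 1)
  simpa [jsmul] using this

lemma continuous_jsmul (J : E →L[ℝ] E) : Continuous fun p : ℂ × E => jsmul J p.1 p.2 := by
  unfold jsmul
  exact ((Complex.continuous_re.comp continuous_fst).smul continuous_snd).add
    ((Complex.continuous_im.comp continuous_fst).smul (J.continuous.comp continuous_snd))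

lemma norm_jsmul_le (J : E →L[ℝ] E) (z : ℂ) (v : E) : ‖jsmul J z v‖ ≤ ‖z‖ * ((1 + ‖J‖) * ‖v‖) := by
  have h1 : ‖z.re • v‖ ≤ ‖z‖ * ‖v‖ := by
    rw [norm_smul]
    gcongr
    exact Complex.abs_re_le_norm z
  have h2 : ‖z.im • J v‖ ≤ ‖z‖ * (‖J‖ * ‖v‖) := by
    rw [norm_smul]
    gcongr
    · exact Complex.abs_im_le_norm z
    · exact J.le_opNorm v
  calc ‖jsmul J z v‖ ≤ _ := norm_add_le _ _
    _ ≤ _ := add_le_add h1 h2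
    _ = _ := by ring

lemma integrable_jsmul {X : Type*} [MeasurableSpace X] {m : Measure X} (J : E →L[ℝ] E) {ρ : X → ℂ}
    {u : X → E} (hρ : Integrable ρ m) (hu : AEStronglyMeasurable u m) {C : ℝ}
    (hC : ∀ x, ‖u x‖ ≤ C) : Integrable (fun x => jsmul J (ρ x) (u x)) m := by
  refine Integrable.mono' (hρ.norm.mul_const ((1 + ‖J‖) * C))
    ((continuous_jsmul J).comp_aestronglyMeasurable (hρ.aestronglyMeasurable.prodMk hu))
    (Eventually.of_forall fun x => (norm_jsmul_le J _ _).trans ?_)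
  gcongr
  exact hC x

variable [CompleteSpace E] {X : Type*} [MeasurableSpace X] {m : Measure X} {Ω : Set ℂ}
  {γ ρ : X → ℂ}

/-- Cauchy's theorem for a complex structure. -/
lemma IsCauchyNull.integral_jsmul_eq_zero (h : IsCauchyNull m Ω γ ρ) {J : E →L[ℝ] E}
    (hJ : ∀ v, J (J v) = -v) {Ψ : ℂ → E} (hΨ : ∀ z ∈ Ω, JDiffAt J Ψ z)
    (hm : AEStronglyMeasurable (fun x => Ψ (γ x)) m) :
    ∫ x, jsmul J (ρ x) (Ψ (γ x)) ∂m = 0 := by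
  obtain ⟨C, hC⟩ := h.exists_bound (F := Ψ)
    fun z hz => (hΨ z hz).1.continuousAt.continuousWithinAt
  have hi := integrable_jsmul J h.integrable hm hC
  refine SeparatingDual.eq_zero_of_forall_dual_eq_zero (R := ℝ) fun φ => ?_
  have h1 := h.integral_mul_eq_zero (F := fun w => complexify J φ (Ψ w))
    fun z hz => ((hΨ z hz).complexify hJ φ).differentiableWithinAt
  simp_rw [← complexify_jsmul hJ] at h1
  rw [(complexify J φ).integral_comp_comm hi] at h1
  rw [← complexify_re J φ, h1, Complex.zero_re]

/-- Cauchy's formula for a complex structure. -/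
lemma IsCauchyNull.integral_jsmul_inv_sub (h : IsCauchyNull m Ω γ ρ) {J : E →L[ℝ] E}
    (hJ : ∀ v, J (J v) = -v) {Ψ : ℂ → E} (hΨ : ∀ z ∈ Ω, JDiffAt J Ψ z)
    (hm : AEStronglyMeasurable (fun x => Ψ (γ x)) m) {p : ℂ} (hp : p ∈ Ω) {δ : ℝ} (hδ : 0 < δ)
    (hpγ : ∀ x, δ ≤ ‖γ x - p‖) :
    ∫ x, jsmul J (ρ x * (γ x - p)⁻¹) (Ψ (γ x)) ∂m =
      jsmul J (∫ x, ρ x * (γ x - p)⁻¹ ∂m) (Ψ p) := by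
  obtain ⟨C, hC⟩ := h.exists_bound (F := Ψ)
    fun z hz => (hΨ z hz).1.continuousAt.continuousWithinAt
  have i1 : Integrable (fun x => ρ x * (γ x - p)⁻¹) m :=
    h.integrable.mul_bdd (c := δ⁻¹) ((h.measurable.sub_const p).inv).aestronglyMeasurable
      (Eventually.of_forall fun x => by rw [norm_inv]; exact inv_anti₀ hδ (hpγ x))
  have hi := integrable_jsmul J i1 hm hC
  rw [← sub_eq_zero]
  refine SeparatingDual.eq_zero_of_forall_dual_eq_zero (R := ℝ) fun φ => ?_
  have h1 := h.integral_mul_inv_sub (F := fun w => complexify J φ (Ψ w))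
    (fun z hz => ((hΨ z hz).complexify hJ φ).differentiableWithinAt) hp hδ hpγ
  simp_rw [← complexify_jsmul hJ] at h1
  rw [(complexify J φ).integral_comp_comm hi, ← sub_eq_zero, ← map_sub] at h1
  rw [← complexify_re J φ, h1, Complex.zero_re]

end ComplexStructure

/-! ### The planes `ℂ_I` -/

section Slices

lemma ImagUnits.mul_self {I : ℍ[ℝ]} (hI : I ∈ ImagUnits) : I * I = -1 := by
  obtain ⟨h1, h2⟩ := hI
  have h3 : star I = -I := Quaternion.star_eq_neg.2 h1
  have h4 : I * star I = ((Quaternion.normSq I : ℝ) : ℍ[ℝ]) := Quaternion.self_mul_star I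
  rw [h3, Quaternion.normSq_eq_norm_mul_self, h2] at h4
  simpa [neg_eq_iff_eq_neg] using h4

lemma ImagUnits.neg_mem {I : ℍ[ℝ]} (hI : I ∈ ImagUnits) : -I ∈ ImagUnits :=
  ⟨by simpa using hI.1, by simpa using hI.2⟩

/-- The embedding of `ℂ` as `ℂ_I`, as a homomorphism of algebras. -/
noncomputable def sliceHom {I : ℍ[ℝ]} (hI : I ∈ ImagUnits) : ℂ →ₐ[ℝ] ℍ[ℝ] :=
  Complex.lift ⟨I, ImagUnits.mul_self hI⟩

lemma sliceHom_apply {I : ℍ[ℝ]} (hI : I ∈ ImagUnits) (z : ℂ) : sliceHom hI z = sliceEmb I z := by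
  simp [sliceHom, sliceEmb, Complex.liftAux_apply]

variable {I : ℍ[ℝ]}

lemma sliceEmb_add (z w : ℂ) : sliceEmb I (z + w) = sliceEmb I z + sliceEmb I w := by
  simp [sliceEmb, add_smul]; abel

lemma sliceEmb_mul (hI : I ∈ ImagUnits) (z w : ℂ) :
    sliceEmb I (z * w) = sliceEmb I z * sliceEmb I w := by
  simp only [← sliceHom_apply hI, map_mul]

lemma sliceEmb_neg (z : ℂ) : sliceEmb I (-z) = -sliceEmb I z := by
  simp [sliceEmb]; abel

lemma sliceEmb_sub (z w : ℂ) : sliceEmb I (z - w) = sliceEmb I z - sliceEmb I w := by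
  rw [sub_eq_add_neg, sliceEmb_add, sliceEmb_neg, sub_eq_add_neg]

lemma sliceEmb_ofReal (x : ℝ) : sliceEmb I (x : ℂ) = (x : ℍ[ℝ]) := by simp [sliceEmb]

lemma sliceEmb_zero : sliceEmb I 0 = 0 := by simp [sliceEmb]

lemma sliceEmb_one : sliceEmb I 1 = 1 := by simp [sliceEmb]

lemma sliceEmb_I : sliceEmb I Complex.I = I := by simp [sliceEmb]

lemma sliceEmb_inv (hI : I ∈ ImagUnits) (z : ℂ) : sliceEmb I z⁻¹ = (sliceEmb I z)⁻¹ := by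
  simp only [← sliceHom_apply hI, map_inv₀]

lemma sliceEmb_re (hI : I ∈ ImagUnits) (z : ℂ) : (sliceEmb I z).re = z.re := by
  simp [sliceEmb, hI.1]

lemma sliceEmb_conj (hI : I ∈ ImagUnits) (z : ℂ) :
    star (sliceEmb I z) = sliceEmb I (starRingEnd ℂ z) := by
  simp [sliceEmb, Quaternion.star_eq_neg.2 hI.1]

lemma sliceEmb_real_smul (r : ℝ) (z : ℂ) : sliceEmb I (r • z) = r • sliceEmb I z := by
  simp [sliceEmb, smul_smul, smul_add, Quaternion.coe_mul, Quaternion.coe_mul_eq_smul]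

lemma normSq_sliceEmb (hI : I ∈ ImagUnits) (z : ℂ) :
    ‖sliceEmb I z‖ ^ 2 = ‖z‖ ^ 2 := by
  have h := Quaternion.self_mul_star (sliceEmb I z)
  rw [sliceEmb_conj hI, ← sliceEmb_mul hI, Complex.mul_conj, sliceEmb_ofReal,
    Quaternion.normSq_eq_norm_mul_self] at h
  have h2 := Quaternion.coe_injective h
  rw [sq, ← h2, Complex.normSq_eq_norm_sq]

lemma norm_sliceEmb (hI : I ∈ ImagUnits) (z : ℂ) : ‖sliceEmb I z‖ = ‖z‖ :=
  (sq_eq_sq₀ (norm_nonneg _) (norm_nonneg _)).1 (normSq_sliceEmb hI z)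

variable (I) in
/-- The parametrization of `ℂ_I` as a continuous linear map. -/
noncomputable def sliceCLM : ℂ →L[ℝ] ℍ[ℝ] :=
  Complex.reCLM.smulRight 1 + Complex.imCLM.smulRight I

lemma sliceCLM_apply (z : ℂ) : sliceCLM I z = sliceEmb I z := by
  have : (z.re : ℍ[ℝ]) = z.re • (1 : ℍ[ℝ]) := by simpa using Algebra.algebraMap_eq_smul_one (A := ℍ[ℝ]) z.re
  simp [sliceCLM, sliceEmb, this]

variable (I) in
lemma continuous_sliceEmb : Continuous (sliceEmb I) := by
  have : sliceEmb I = sliceCLM I := funext fun z => (sliceCLM_apply z).symm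
  rw [this]; exact (sliceCLM I).continuous

variable (I) in
lemma hasFDerivAt_sliceEmb (z : ℂ) : HasFDerivAt (sliceEmb I) (sliceCLM I) z := by
  have : sliceEmb I = sliceCLM I := funext fun z => (sliceCLM_apply z).symm
  rw [this]; exact (sliceCLM I).hasFDerivAt

lemma exp_sliceEmb (hI : I ∈ ImagUnits) (z : ℂ) :
    NormedSpace.exp (sliceEmb I z) = sliceEmb I (NormedSpace.exp z) := by
  have hc : Continuous (sliceHom hI) := by
    have : (sliceHom hI : ℂ → ℍ[ℝ]) = sliceEmb I := funext (sliceHom_apply hI)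
    rw [this]; exact continuous_sliceEmb I
  rw [← sliceHom_apply hI, ← sliceHom_apply hI]
  exact (NormedSpace.map_exp (sliceHom hI) hc z).symm

lemma exists_imagUnit : ∃ I : ℍ[ℝ], I ∈ ImagUnits := by
  have h : ∀ q : ℍ[ℝ], Quaternion.normSq q = 1 → ‖q‖ = 1 := fun q hq => by
    rw [Quaternion.normSq_eq_norm_mul_self, ← sq] at hq
    exact (pow_eq_one_iff_of_nonneg (norm_nonneg q) two_ne_zero).1 hq
  refine ⟨⟨0, 1, 0, 0⟩, rfl, h _ ((Quaternion.normSq_def' _).trans ?_)⟩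
  change (0 : ℝ) ^ 2 + 1 ^ 2 + 0 ^ 2 + 0 ^ 2 = 1
  norm_num

lemma exists_sliceEmb (s : ℍ[ℝ]) : ∃ I ∈ ImagUnits, ∃ z : ℂ, s = sliceEmb I z := by
  by_cases h : s.im = 0
  · obtain ⟨I, hI⟩ := exists_imagUnit
    refine ⟨I, hI, s.re, ?_⟩
    rw [sliceEmb_ofReal]
    conv_lhs => rw [← s.re_add_im, h, add_zero]
  · have hn : ‖s.im‖ ≠ 0 := norm_ne_zero_iff.2 h
    refine ⟨‖s.im‖⁻¹ • s.im, ⟨by simp, by rw [norm_smul, norm_inv, norm_norm, inv_mul_cancel₀ hn]⟩,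
      ⟨s.re, ‖s.im‖⟩, ?_⟩
    simp only [sliceEmb, smul_smul, mul_inv_cancel₀ hn, one_smul]
    exact s.re_add_im.symm

variable (I) in
/-- Right multiplication by `I`. -/
noncomputable def rightMulCLM : ℍ[ℝ] →L[ℝ] ℍ[ℝ] := (ContinuousLinearMap.mul ℝ ℍ[ℝ]).flip I

lemma rightMulCLM_apply (q : ℍ[ℝ]) : rightMulCLM I q = q * I := rfl

lemma rightMulCLM_sq (hI : I ∈ ImagUnits) (q : ℍ[ℝ]) :
    rightMulCLM I (rightMulCLM I q) = -q := by
  simp [rightMulCLM_apply, mul_assoc, ImagUnits.mul_self hI]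

lemma jsmul_rightMul (z : ℂ) (q : ℍ[ℝ]) : jsmul (rightMulCLM I) z q = q * sliceEmb I z := by
  simp [jsmul, rightMulCLM_apply, sliceEmb, mul_add, Quaternion.mul_coe_eq_smul]

/-- Multiplied by I from the right, ∂₀f + (∂₁f) I = 0 becomes ∂₁f = (∂₀f) I, the Cauchy–Riemann
equation for the complex structure q ↦ qI. -/
lemma RightSliceRegularOn.jDiffAt {f : ℍ[ℝ] → ℍ[ℝ]} {U : Set ℍ[ℝ]} (hf : RightSliceRegularOn f U)
    (hI : I ∈ ImagUnits) {z : ℂ} (hz : z ∈ slice I U) :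
    JDiffAt (rightMulCLM I) (fun w => f (sliceEmb I w)) z := by
  have h1 : HasFDerivAt (fun w => f (sliceEmb I w))
      ((fderiv ℝ f (sliceEmb I z)).comp (sliceCLM I)) z :=
    (hf.2.1 _ hz).hasFDerivAt.comp z (hasFDerivAt_sliceEmb I z)
  refine ⟨h1.differentiableAt, ?_⟩
  have h2 := hf.2.2 I hI z hz
  rw [smul_eq_zero_iff_right (by norm_num)] at h2
  rw [h1.fderiv]
  simp only [ContinuousLinearMap.comp_apply, sliceCLM_apply, sliceEmb_I, sliceEmb_one,
    rightMulCLM_apply]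
  have h3 := congrArg (· * I) h2
  simp only [add_mul, zero_mul, mul_assoc, ImagUnits.mul_self hI, mul_neg, mul_one] at h3
  rw [add_neg_eq_zero] at h3
  exact h3.symm

end Slices

/-! ### Cauchy's theorem for cycles -/

/-- The `C¹` curves `γ i`, with the weights `w i`, form a cycle in the open set `Ω` that is
homologous to zero. -/
structure IsNullCycle {ι : Type*} [Fintype ι] (Ω : Set ℂ) (γ : ι → ℝ → ℂ) (w : ι → ℝ) : Prop where
  isOpen : IsOpen Ω
  contDiff : ∀ i, ContDiff ℝ 1 (γ i)
  exists_compact : ∃ K : Set ℂ, IsCompact K ∧ K ⊆ Ω ∧ (∀ i t, γ i t ∈ K) ∧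
    ∃ W : Set ℂ, IsOpen W ∧ (∀ z, z ∈ Ω ∨ z ∈ W) ∧ W ∈ Bornology.cobounded ℂ ∧
      ∀ z ∈ W, z ∉ K → ∑ i, (w i : ℂ) * windingNumber (γ i) z = 0

section Cycles

variable {ι : Type*} [Fintype ι]

/-- The sum of the Lebesgue measures on `ι` copies of the unit interval. -/
noncomputable def cycleMeasure (ι : Type*) [Fintype ι] [MeasurableSpace ι] : Measure (ι × ℝ) :=
  ∑ i : ι, (volume.restrict (Set.Ioc (0 : ℝ) 1)).map (Prod.mk i)

variable [MeasurableSpace ι] [MeasurableSingletonClass ι]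

lemma integrable_cycleMeasure {E : Type*} [NormedAddCommGroup E] {F : ι × ℝ → E}
    (hF : ∀ i, Continuous fun t => F (i, t)) : Integrable F (cycleMeasure ι) := by
  rw [cycleMeasure, integrable_finsetSum_measure]
  intro i _
  rw [(measurableEmbedding_prodMk_left i).integrable_map_iff]
  exact ((hF i).intervalIntegrable 0 1).1

lemma integral_cycleMeasure {E : Type*} [NormedAddCommGroup E] [NormedSpace ℝ E] {F : ι × ℝ → E}
    (hF : ∀ i, Continuous fun t => F (i, t)) :
    ∫ x, F x ∂(cycleMeasure ι) = ∑ i, ∫ t in (0 : ℝ)..1, F (i, t) := by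
  have h := integrable_cycleMeasure hF
  rw [cycleMeasure, integrable_finsetSum_measure] at h
  rw [cycleMeasure, integral_finsetSum_measure h]
  refine Finset.sum_congr rfl fun i _ => ?_
  rw [(measurableEmbedding_prodMk_left i).integral_map, intervalIntegral.integral_of_le zero_le_one]

end Cycles

section

variable {ι : Type*} [Fintype ι] {Ω : Set ℂ} {γ : ι → ℝ → ℂ} {w : ι → ℝ}
variable {E : Type*} [NormedAddCommGroup E] [NormedSpace ℝ E] [CompleteSpace E]

/-- The Cauchy transform of the density w_i γ_i'(t) is 2πi times the weighted sum of the winding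
numbers. -/
lemma IsNullCycle.isCauchyNull [MeasurableSpace ι] [DiscreteMeasurableSpace ι]
    (h : IsNullCycle Ω γ w) :
    IsCauchyNull (cycleMeasure ι) Ω (fun x => γ x.1 x.2)
      (fun x => (w x.1 : ℂ) * deriv (γ x.1) x.2) := by
  have hd : ∀ i, Continuous (deriv (γ i)) := fun i => (h.contDiff i).continuous_deriv le_rfl
  obtain ⟨K, hK, hKΩ, hγK, W, hW, hcov, hinf, h0⟩ := h.exists_compact
  refine ⟨h.isOpen, measurable_from_prod_countable_right fun i => (h.contDiff i).continuous.measurable,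
    integrable_cycleMeasure fun i => (hd i).const_mul (w i : ℂ),
    K, hK, hKΩ, fun x => hγK _ _, W, hW, hcov, hinf, fun z hz hzK => ?_⟩
  have hne : ∀ i t, γ i t - z ≠ 0 := fun i t => sub_ne_zero.2 fun e => hzK (e ▸ hγK i t)
  rw [integral_cycleMeasure fun i => ((hd i).const_mul (w i : ℂ)).mul
    (((h.contDiff i).continuous.sub continuous_const).inv₀ (hne i))]
  have := h0 z hz hzK
  simp only [windingNumber] at this
  have hpi : (2 * (Real.pi : ℂ) * Complex.I)⁻¹ ≠ 0 := by simp [Real.pi_ne_zero]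
  simp_rw [mul_left_comm (_ : ℂ) (2 * (Real.pi : ℂ) * Complex.I)⁻¹] at this
  rw [← Finset.mul_sum, mul_eq_zero, or_iff_right hpi] at this
  rw [← this]
  refine Finset.sum_congr rfl fun i _ => ?_
  rw [← intervalIntegral.integral_const_mul]
  simp only [div_eq_mul_inv, mul_assoc]

/-- Cauchy's theorem for cycles and complex structures. -/
theorem IsNullCycle.sum_integral_jsmul_eq_zero (h : IsNullCycle Ω γ w) {J : E →L[ℝ] E}
    (hJ : ∀ v, J (J v) = -v) {Ψ : ℂ → E} (hΨ : ∀ z ∈ Ω, JDiffAt J Ψ z) :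
    ∑ i, w i • ∫ t in (0 : ℝ)..1, jsmul J (deriv (γ i) t) (Ψ (γ i t)) = 0 := by
  let : MeasurableSpace ι := ⊤
  have hd : ∀ i, Continuous (deriv (γ i)) := fun i => (h.contDiff i).continuous_deriv le_rfl
  obtain ⟨K, hK, hKΩ, hγK, -⟩ := h.exists_compact
  have hc : ∀ i, Continuous fun t => Ψ (γ i t) := fun i => continuous_iff_continuousAt.2 fun t =>
    ContinuousAt.comp (f := γ i) (hΨ _ (hKΩ (hγK i t))).1.continuousAt
      (h.contDiff i).continuous.continuousAt
  have key := h.isCauchyNull.integral_jsmul_eq_zero hJ hΨ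
    (integrable_cycleMeasure hc).aestronglyMeasurable
  rw [integral_cycleMeasure fun i => (continuous_jsmul J).comp
    (((hd i).const_mul (w i : ℂ)).prodMk (hc i))] at key
  rw [← key]
  refine Finset.sum_congr rfl fun i _ => ?_
  rw [← intervalIntegral.integral_smul]
  refine intervalIntegral.integral_congr fun t _ => ?_
  simp [jsmul, smul_add, smul_smul]

/-- Cauchy's formula for cycles and complex structures. -/
theorem IsNullCycle.sum_integral_jsmul_inv_sub (h : IsNullCycle Ω γ w) {J : E →L[ℝ] E}
    (hJ : ∀ v, J (J v) = -v) {Ψ : ℂ → E} (hΨ : ∀ z ∈ Ω, JDiffAt J Ψ z) {p : ℂ} (hp : p ∈ Ω)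
    {δ : ℝ} (hδ : 0 < δ) (hpγ : ∀ i t, δ ≤ ‖γ i t - p‖) :
    ∑ i, w i • ∫ t in (0 : ℝ)..1, jsmul J (deriv (γ i) t * (γ i t - p)⁻¹) (Ψ (γ i t)) =
      jsmul J (2 * Real.pi * Complex.I * ∑ i, (w i : ℂ) * windingNumber (γ i) p) (Ψ p) := by
  let : MeasurableSpace ι := ⊤
  have hd : ∀ i, Continuous (deriv (γ i)) := fun i => (h.contDiff i).continuous_deriv le_rfl
  have hne : ∀ i t, γ i t - p ≠ 0 := fun i t e => by
    have := hpγ i t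
    rw [e, norm_zero] at this
    linarith
  have hinv : ∀ i, Continuous fun t => (γ i t - p)⁻¹ := fun i =>
    ((h.contDiff i).continuous.sub continuous_const).inv₀ (hne i)
  obtain ⟨K, hK, hKΩ, hγK, -⟩ := h.exists_compact
  have hc : ∀ i, Continuous fun t => Ψ (γ i t) := fun i => continuous_iff_continuousAt.2 fun t =>
    ContinuousAt.comp (f := γ i) (hΨ _ (hKΩ (hγK i t))).1.continuousAt
      (h.contDiff i).continuous.continuousAt
  have key := h.isCauchyNull.integral_jsmul_inv_sub hJ hΨ
    (integrable_cycleMeasure hc).aestronglyMeasurable hp hδ fun x => hpγ x.1 x.2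
  rw [integral_cycleMeasure fun i => (continuous_jsmul J).comp
    ((((hd i).const_mul (w i : ℂ)).mul (hinv i)).prodMk (hc i)),
    integral_cycleMeasure fun i => ((hd i).const_mul (w i : ℂ)).mul (hinv i)] at key
  have e : ∑ i, ∫ t in (0 : ℝ)..1, (w i : ℂ) * deriv (γ i) t * (γ i t - p)⁻¹ =
      2 * Real.pi * Complex.I * ∑ i, (w i : ℂ) * windingNumber (γ i) p := by
    rw [Finset.mul_sum]
    refine Finset.sum_congr rfl fun i _ => ?_
    simp_rw [mul_assoc, intervalIntegral.integral_const_mul, windingNumber, div_eq_mul_inv]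
    have : (Real.pi : ℂ) ≠ 0 := by simp [Real.pi_ne_zero]
    field_simp
  rw [e] at key
  rw [← key]
  refine Finset.sum_congr rfl fun i _ => ?_
  rw [← intervalIntegral.integral_smul]
  refine intervalIntegral.integral_congr fun t _ => ?_
  simp [jsmul, smul_add, smul_smul, mul_assoc, mul_sub, mul_add]

end

/-! ### Cauchy's theorem for products of right and left holomorphic functions. -/

section Pairing

variable {V : Type*} [NormedAddCommGroup V] [NormedSpace ℝ V]
  [Module ℍ[ℝ] V] [IsScalarTower ℝ ℍ[ℝ] V] [IsBoundedSMul ℍ[ℝ] V] {I : ℍ[ℝ]}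

variable (V) in
/-- Left multiplication by `q`. -/
noncomputable def leftMulCLM (q : ℍ[ℝ]) : V →L[ℝ] V := ContinuousLinearMap.lsmul ℝ ℍ[ℝ] q

lemma leftMulCLM_apply (q : ℍ[ℝ]) (v : V) : leftMulCLM V q v = q • v := rfl

lemma leftMulCLM_sq (hI : I ∈ ImagUnits) (v : V) : leftMulCLM V I (leftMulCLM V I v) = -v := by
  simp [leftMulCLM_apply, smul_smul, ImagUnits.mul_self hI]

omit [IsBoundedSMul ℍ[ℝ] V] in
lemma real_smul_eq_quaternion_smul (r : ℝ) (v : V) : (r : ℍ[ℝ]) • v = r • v := by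
  have : (r : ℍ[ℝ]) = r • (1 : ℍ[ℝ]) := by
    simpa using Algebra.algebraMap_eq_smul_one (A := ℍ[ℝ]) r
  rw [this, smul_assoc, one_smul]

lemma jsmul_leftMul (z : ℂ) (v : V) : jsmul (leftMulCLM V I) z v = sliceEmb I z • v := by
  rw [jsmul, sliceEmb, add_smul, real_smul_eq_quaternion_smul, leftMulCLM_apply, smul_assoc]

/-- The product of a right holomorphic function with values in `ℂ_I` or in its orthogonal
complement and a left holomorphic function is holomorphic. -/
lemma JDiffAt.pairing {P : ℍ[ℝ] →L[ℝ] ℍ[ℝ]} {J : ℍ[ℝ]} (h1 : ∀ q, P (q * I) = J * P q)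
    (h2 : ∀ q, P q * I = J * P q) {G : ℂ → ℍ[ℝ]} {S : ℂ → V} {z : ℂ}
    (hG : JDiffAt (rightMulCLM I) G z) (hS : JDiffAt (leftMulCLM V I) S z) :
    JDiffAt (leftMulCLM V J) (fun w => P (G w) • S w) z := by
  have hPG : HasFDerivAt (fun w => P (G w)) (P.comp (fderiv ℝ G z)) z :=
    P.hasFDerivAt.comp z hG.1.hasFDerivAt
  have h := (ContinuousLinearMap.lsmul ℝ ℍ[ℝ] (E := V)).hasFDerivAt_of_bilinear hPG
    hS.1.hasFDerivAt
  refine ⟨h.differentiableAt, ?_⟩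
  have h' : HasFDerivAt (fun w => P (G w) • S w) _ z := h
  have e : ∀ u, fderiv ℝ (fun w => P (G w) • S w) z u =
      P (G z) • fderiv ℝ S z u + P (fderiv ℝ G z u) • S z := fun u => by rw [h'.fderiv]; rfl
  -- In the product rule `h2` moves I past P(G), where it came from the derivative of S, and `h1`
  -- takes it out of P(G'I); in both terms it ends up as J on the left.
  simp only [e, hG.2, hS.2, leftMulCLM_apply, rightMulCLM_apply, h1, smul_add, smul_smul, h2]

variable [CompleteSpace V] {ι : Type*} [Fintype ι] {Ω : Set ℂ} {γ : ι → ℝ → ℂ} {w : ι → ℝ}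

variable (I) in
/-- The component in `ℂ_I` (for `ε = -1`) or orthogonal to it (for `ε = 1`). -/
noncomputable def slicePart (ε : ℝ) : ℍ[ℝ] →L[ℝ] ℍ[ℝ] :=
  (1 / 2 : ℝ) • (ContinuousLinearMap.id ℝ ℍ[ℝ] +
    ε • (ContinuousLinearMap.mul ℝ ℍ[ℝ] I).comp (rightMulCLM I))

lemma slicePart_apply (ε : ℝ) (q : ℍ[ℝ]) :
    slicePart I ε q = (1 / 2 : ℝ) • (q + ε • (I * (q * I))) := by
  simp [slicePart, rightMulCLM_apply]

/-- Cauchy's theorem for the product of a right holomorphic and a left holomorphic function. -/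
theorem IsNullCycle.sum_integral_pairing_eq_zero (h : IsNullCycle Ω γ w) (hI : I ∈ ImagUnits)
    {G : ℂ → ℍ[ℝ]} {S : ℂ → V} (hG : ∀ z ∈ Ω, JDiffAt (rightMulCLM I) G z)
    (hS : ∀ z ∈ Ω, JDiffAt (leftMulCLM V I) S z) :
    ∑ i, w i • ∫ t in (0 : ℝ)..1, (G (γ i t) * sliceEmb I (deriv (γ i) t)) • S (γ i t) = 0 := by
  have hII := ImagUnits.mul_self hI
  have hII' : ∀ q : ℍ[ℝ], I * (I * q) = -q := fun q => by rw [← mul_assoc, hII, neg_one_mul]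
  -- The part (q - IqI)/2 commutes with I and meets the hypotheses of `JDiffAt.pairing` with J = I;
  -- the part (q + IqI)/2 anticommutes with I and meets them with J = -I. Cauchy's theorem is
  -- applied to each part with its own complex structure.
  have a1 : ∀ q, slicePart I (-1) (q * I) = I * slicePart I (-1) q := fun q => by
    simp [slicePart_apply, mul_assoc, hII, mul_add, hII', add_comm]
  have a2 : ∀ q, slicePart I (-1) q * I = I * slicePart I (-1) q := fun q => by
    simp [slicePart_apply, mul_assoc, hII, mul_add, add_mul, hII', add_comm]
  have b1 : ∀ q, slicePart I 1 (q * I) = -I * slicePart I 1 q := fun q => by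
    simp [slicePart_apply, mul_assoc, hII, mul_add, hII', add_comm]
  have b2 : ∀ q, slicePart I 1 q * I = -I * slicePart I 1 q := fun q => by
    simp [slicePart_apply, mul_assoc, hII, mul_add, add_mul, hII', add_comm]
  have hsum : ∀ q, q = slicePart I (-1) q + slicePart I 1 q := fun q => by
    rw [slicePart_apply, slicePart_apply, ← smul_add]
    simp only [neg_smul, one_smul]
    rw [show q + -(I * (q * I)) + (q + I * (q * I)) = (2 : ℝ) • q by rw [two_smul]; abel, smul_smul]
    norm_num
  have k1 := h.sum_integral_jsmul_eq_zero (leftMulCLM_sq (V := V) hI)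
    fun z hz => JDiffAt.pairing a1 a2 (hG z hz) (hS z hz)
  have k2 := h.sum_integral_jsmul_eq_zero (leftMulCLM_sq (V := V) (ImagUnits.neg_mem hI))
    fun z hz => JDiffAt.pairing b1 b2 (hG z hz) (hS z hz)
  have hd : ∀ i, Continuous (deriv (γ i)) := fun i => (h.contDiff i).continuous_deriv le_rfl
  obtain ⟨K, hK, hKΩ, hγK, -⟩ := h.exists_compact
  have hcG : ∀ i, Continuous fun t => G (γ i t) := fun i => continuous_iff_continuousAt.2 fun t =>
    ContinuousAt.comp (f := γ i) (hG _ (hKΩ (hγK i t))).1.continuousAt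
      (h.contDiff i).continuous.continuousAt
  have hcS : ∀ i, Continuous fun t => S (γ i t) := fun i => continuous_iff_continuousAt.2 fun t =>
    ContinuousAt.comp (f := γ i) (hS _ (hKΩ (hγK i t))).1.continuousAt
      (h.contDiff i).continuous.continuousAt
  have hint : ∀ (J : ℍ[ℝ]) (ε : ℝ) i, IntervalIntegrable (fun t => jsmul (leftMulCLM V J)
      (deriv (γ i) t) (slicePart I ε (G (γ i t)) • S (γ i t))) volume 0 1 := fun J ε i =>
    Continuous.intervalIntegrable ((continuous_jsmul _).comp ((hd i).prodMk
      (((slicePart I ε).continuous.comp (hcG i)).smul (hcS i)))) _ _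
  rw [← add_zero (0 : V)]
  nth_rw 1 [← k1]
  rw [← k2, ← Finset.sum_add_distrib]
  refine Finset.sum_congr rfl fun i _ => ?_
  rw [← smul_add, ← intervalIntegral.integral_add (hint _ _ i) (hint _ _ i)]
  congr 1
  refine intervalIntegral.integral_congr fun t _ => ?_
  simp only [jsmul_leftMul, smul_smul, ← add_smul]
  congr 1
  -- For the anticommuting part q z = z̄ q, and z̄ on the left is multiplication by z for the
  -- structure -I.
  conv_lhs => rw [hsum (G (γ i t)), add_mul]
  simp only [sliceEmb, mul_add, add_mul, Quaternion.mul_coe_eq_smul, Quaternion.coe_mul_eq_smul,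
    mul_smul_comm, smul_mul_assoc, a2, b2]

end Pairing

/-! ### Domains bounded by circles with real centres -/

/-- The circle with centre `m` and radius `R`, with period `1` and orientation `σ`. -/
noncomputable def orientedCircle (m R σ t : ℝ) : ℂ := circleMap m R (2 * Real.pi * σ * t)

section OrientedCircle

variable {m R σ : ℝ}

lemma hasDerivAt_orientedCircle (t : ℝ) : HasDerivAt (orientedCircle m R σ)
    ((2 * Real.pi * σ) • deriv (circleMap m R) (2 * Real.pi * σ * t)) t := by
  have h := (hasDerivAt_circleMap (m : ℂ) R (2 * Real.pi * σ * t)).scomp t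
    ((hasDerivAt_id t).const_mul (2 * Real.pi * σ))
  rw [deriv_circleMap]
  rw [mul_one] at h
  exact h

lemma contDiff_orientedCircle : ContDiff ℝ 1 (orientedCircle m R σ) :=
  (contDiff_circleMap (m : ℂ) R).comp (contDiff_const.mul contDiff_id)

lemma isC1JordanCurve_orientedCircle (hR : 0 < R) (hσ : σ = 1 ∨ σ = -1) :
    IsC1JordanCurve (orientedCircle m R σ) := by
  refine ⟨contDiff_orientedCircle, fun t => ?_, ?_⟩
  · have hp := periodic_circleMap (m : ℂ) R
    rcases hσ with rfl | rfl
    · simpa [orientedCircle, mul_add] using hp (2 * Real.pi * t)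
    · simpa [orientedCircle, mul_add, sub_eq_add_neg] using hp.sub_eq (2 * Real.pi * (-1) * t)
  · intro s hs t ht hst
    have hpi := Real.pi_pos
    rcases hσ with rfl | rfl
    · have h := injOn_circleMap_of_abs_sub_le' (a := 0) (b := 2 * Real.pi) (c := (m : ℂ)) hR.ne'
        (by simp) (x₁ := 2 * Real.pi * 1 * s) (x₂ := 2 * Real.pi * 1 * t)
        ⟨by nlinarith [hs.1], by nlinarith [hs.2]⟩ ⟨by nlinarith [ht.1], by nlinarith [ht.2]⟩ hst
      have : (2 * Real.pi) * (s - t) = 0 := by linarith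
      rcases mul_eq_zero.1 this with h0 | h0 <;> linarith
    · have h := injOn_circleMap_of_abs_sub_le (a := -(2 * Real.pi)) (b := 0) (c := (m : ℂ)) hR.ne'
        (by simp [abs_of_pos hpi])
        (x₁ := 2 * Real.pi * (-1) * s) (x₂ := 2 * Real.pi * (-1) * t)
        (by rw [Set.uIoc_of_le (by linarith)]
            exact ⟨by nlinarith [hs.2], by nlinarith [hs.1]⟩)
        (by rw [Set.uIoc_of_le (by linarith)]
            exact ⟨by nlinarith [ht.2], by nlinarith [ht.1]⟩) hst
      have : (2 * Real.pi) * (s - t) = 0 := by linarith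
      rcases mul_eq_zero.1 this with h0 | h0 <;> linarith

lemma range_orientedCircle (hR : 0 < R) (hσ : σ = 1 ∨ σ = -1) :
    Set.range (orientedCircle m R σ) = {z : ℂ | ‖z - m‖ = R} := by
  have h1 : Set.range (orientedCircle m R σ) = Set.range (circleMap m R) := by
    have hc : (2 * Real.pi * σ) ≠ 0 := by
      rcases hσ with rfl | rfl <;> simp [Real.pi_ne_zero]
    have : orientedCircle m R σ = circleMap m R ∘ fun t => (2 * Real.pi * σ) * t := rfl
    rw [this, (mul_left_surjective₀ hc).range_comp]
  rw [h1, range_circleMap, abs_of_pos hR]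
  ext z; simp [mem_sphere_iff_norm]

lemma windingNumber_orientedCircle (hσ : σ = 1 ∨ σ = -1) (z : ℂ) :
    windingNumber (orientedCircle m R σ) z =
      (2 * (Real.pi : ℂ) * Complex.I)⁻¹ * (σ * ∮ w in C((m : ℂ), R), (w - z)⁻¹) := by
  have hc : (2 * Real.pi * σ) ≠ 0 := by
    rcases hσ with rfl | rfl <;> simp [Real.pi_ne_zero]
  rw [windingNumber]
  congr 1
  set f : ℝ → ℂ := fun θ => deriv (circleMap m R) θ * (circleMap m R θ - z)⁻¹ with hf
  have hper : Function.Periodic f (2 * Real.pi) := by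
    intro θ
    simp only [hf, deriv_circleMap]
    rw [periodic_circleMap, periodic_circleMap]
  have h1 : ∫ t in (0 : ℝ)..1, deriv (orientedCircle m R σ) t / (orientedCircle m R σ t - z) =
      ∫ t in (0 : ℝ)..1, (2 * Real.pi * σ) • f ((2 * Real.pi * σ) * t) := by
    refine intervalIntegral.integral_congr fun t _ => ?_
    simp only [(hasDerivAt_orientedCircle t).deriv, hf, orientedCircle, div_eq_mul_inv,
      smul_mul_assoc]
  rw [h1, intervalIntegral.integral_smul, intervalIntegral.smul_integral_comp_mul_left, mul_zero,
    mul_one]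
  have h2 : (∮ w in C((m : ℂ), R), (w - z)⁻¹) = ∫ θ in (0 : ℝ)..(2 * Real.pi), f θ := by
    simp [circleIntegral, hf]
  rw [h2]
  rcases hσ with rfl | rfl
  · simp
  · have := hper.intervalIntegral_add_eq (-(2 * Real.pi)) 0
    simp only [neg_add_cancel, zero_add] at this
    rw [mul_neg_one, intervalIntegral.integral_symm, this]
    simp

lemma windingNumber_orientedCircle_of_lt (hσ : σ = 1 ∨ σ = -1) {z : ℂ}
    (hz : ‖z - m‖ < R) : windingNumber (orientedCircle m R σ) z = σ := by
  rw [windingNumber_orientedCircle hσ, circleIntegral.integral_sub_inv_of_mem_ball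
    (by simpa [dist_eq_norm] using hz)]
  have : (Real.pi : ℂ) ≠ 0 := by simp [Real.pi_ne_zero]
  field_simp

lemma windingNumber_orientedCircle_of_gt (hR : 0 < R) (hσ : σ = 1 ∨ σ = -1) {z : ℂ}
    (hz : R < ‖z - m‖) : windingNumber (orientedCircle m R σ) z = 0 := by
  rw [windingNumber_orientedCircle hσ]
  have : (∮ w in C((m : ℂ), R), (w - z)⁻¹) = 0 := by
    refine DiffContOnCl.circleIntegral_eq_zero hR.le (DifferentiableOn.diffContOnCl ?_)
    rw [closure_ball _ hR.ne']
    intro w hw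
    have : w - z ≠ 0 := by
      intro h
      rw [sub_eq_zero] at h
      rw [Metric.mem_closedBall, dist_eq_norm, h] at hw
      linarith
    exact ((differentiableAt_id.sub_const z).inv this).differentiableWithinAt
  rw [this, mul_zero, mul_zero]

end OrientedCircle

/-- Circles with real centres, for which the closed discs or complements of open discs on their
outer sides are disjoint. The outer side is outside of the circle if `σ k = 1`, and inside if
`σ k = -1`. -/
structure CircleDomain (n : ℕ) where
  m : Fin n → ℝ
  R : Fin n → ℝ
  σ : Fin n → ℝ
  R_pos : ∀ k, 0 < R k
  σ_eq : ∀ k, σ k = 1 ∨ σ k = -1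
  disjoint : ∀ j k, j ≠ k → ∀ z : ℂ, σ j * (R j ^ 2 - ‖z - m j‖ ^ 2) ≤ 0 →
    0 < σ k * (R k ^ 2 - ‖z - m k‖ ^ 2)
  base : ∃ x : ℝ, ∀ k, 0 < σ k * (R k ^ 2 - ‖(x : ℂ) - m k‖ ^ 2)

namespace CircleDomain

variable {n : ℕ} (c : CircleDomain n)

/-- The function that is positive on the inner side of the circle `k`. -/
noncomputable def val (k : Fin n) (z : ℂ) : ℝ := c.σ k * (c.R k ^ 2 - ‖z - c.m k‖ ^ 2)

/-- The plane domain bounded by the circles. -/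
def dom : Set ℂ := {z | ∀ k, 0 < c.val k z}

/-- The quaternionic domain bounded by the spheres. -/
def domH : Set ℍ[ℝ] := {s | ∀ k, 0 < c.σ k * (c.R k ^ 2 - ‖s - (c.m k : ℍ[ℝ])‖ ^ 2)}

/-- The boundary circles. -/
noncomputable def curve (k : Fin n) : ℝ → ℂ := orientedCircle (c.m k) (c.R k) (c.σ k)

lemma slice_domH {I : ℍ[ℝ]} (hI : I ∈ ImagUnits) : slice I c.domH = c.dom := by
  ext z
  simp only [slice, domH, dom, val, Set.mem_preimage, Set.mem_ofPred_eq]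
  have : ∀ k, ‖sliceEmb I z - (c.m k : ℍ[ℝ])‖ = ‖z - c.m k‖ := fun k => by
    rw [← sliceEmb_ofReal (I := I), ← sliceEmb_sub, norm_sliceEmb hI]
  simp only [this]

lemma continuous_val (k : Fin n) : Continuous (c.val k) := by
  unfold val; fun_prop

lemma isOpen_dom : IsOpen c.dom := by
  simp only [dom, Set.ofPred_forall]
  exact isOpen_iInter_of_finite fun k => isOpen_lt continuous_const (c.continuous_val k)

lemma isOpen_domH : IsOpen c.domH := by
  simp only [domH, Set.ofPred_forall]
  exact isOpen_iInter_of_finite fun k => isOpen_lt continuous_const (by fun_prop)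

lemma axiallySymmetric_domH : AxiallySymmetric c.domH := by
  intro I hI J hJ
  rw [c.slice_domH hI, c.slice_domH hJ]

lemma val_eq (k : Fin n) (z : ℂ) : c.val k z =
    c.σ k * (c.R k ^ 2 - (z.re ^ 2 + z.im ^ 2) + 2 * c.m k * z.re - c.m k ^ 2) := by
  rw [val, ← Complex.normSq_eq_norm_sq, Complex.normSq_apply]
  simp only [Complex.sub_re, Complex.sub_im, Complex.ofReal_re, Complex.ofReal_im, sub_zero]
  ring

/-- In the coordinates `x` and `x² + y²` the upper half of the domain is convex. -/
lemma convex_coordinates : Convex ℝ {p : ℝ × ℝ | p.1 ^ 2 ≤ p.2 ∧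
    ∀ k, 0 < c.σ k * (c.R k ^ 2 - p.2 + 2 * c.m k * p.1 - c.m k ^ 2)} := by
  rintro ⟨x, N⟩ ⟨h1, h2⟩ ⟨x', N'⟩ ⟨h1', h2'⟩ a b ha hb hab
  simp only at h1 h2 h1' h2'
  constructor
  · simp only [Prod.smul_mk, Prod.mk_add_mk, smul_eq_mul]
    obtain rfl : b = 1 - a := by linarith
    nlinarith [mul_nonneg ha hb, sq_nonneg (x - x'), mul_nonneg (mul_nonneg ha hb) (sq_nonneg (x - x')),
      mul_le_mul_of_nonneg_left h1 ha, mul_le_mul_of_nonneg_left h1' hb]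
  · intro k
    simp only [Prod.smul_mk, Prod.mk_add_mk, smul_eq_mul]
    have e : c.σ k * (c.R k ^ 2 - (a * N + b * N') + 2 * c.m k * (a * x + b * x') - c.m k ^ 2) =
        a * (c.σ k * (c.R k ^ 2 - N + 2 * c.m k * x - c.m k ^ 2)) +
        b * (c.σ k * (c.R k ^ 2 - N' + 2 * c.m k * x' - c.m k ^ 2)) := by
      obtain rfl : b = 1 - a := by linarith
      ring
    rw [e]
    rcases ha.eq_or_lt with rfl | ha'
    · have : b = 1 := by linarith
      subst this
      simpa using h2' k
    · have := mul_pos ha' (h2 k)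
      have := mul_nonneg hb (h2' k).le
      linarith

/-- In the coordinates x and N = x² + y² every circle condition is affine, so each closed half of
the domain is the continuous image of a convex set under (x, N) ↦ x ± i√(N - x²). Both halves
contain the real base point. -/
lemma isConnected_dom : IsConnected c.dom := by
  obtain ⟨x₀, hx₀⟩ := c.base
  set C : Set (ℝ × ℝ) := {p : ℝ × ℝ | p.1 ^ 2 ≤ p.2 ∧
    ∀ k, 0 < c.σ k * (c.R k ^ 2 - p.2 + 2 * c.m k * p.1 - c.m k ^ 2)} with hC
  have hx₀' : (x₀ : ℂ) ∈ c.dom := hx₀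
  refine ⟨⟨x₀, hx₀'⟩, isPreconnected_of_forall (x₀ : ℂ) fun z hz => ?_⟩
  have hsign : ∃ ε : ℝ, ε ^ 2 = 1 ∧ z.im = ε * |z.im| := by
    rcases abs_cases z.im with ⟨h, -⟩ | ⟨h, -⟩
    · exact ⟨1, by norm_num, by rw [h, one_mul]⟩
    · exact ⟨-1, by norm_num, by rw [h]; ring⟩
  obtain ⟨ε, hε, hzε⟩ := hsign
  set e : ℝ × ℝ → ℂ := fun p => (p.1 : ℂ) + ((ε * √(p.2 - p.1 ^ 2) : ℝ) : ℂ) * Complex.I with he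
  have hre : ∀ p, (e p).re = p.1 := fun p => by simp [he]
  have him : ∀ p, (e p).im = ε * √(p.2 - p.1 ^ 2) := fun p => by simp [he]
  refine ⟨e '' C, ?_, ?_, ?_, c.convex_coordinates.isPreconnected.image _ ?_⟩
  · rintro _ ⟨p, ⟨hp1, hp2⟩, rfl⟩ k
    rw [val_eq, hre, him, mul_pow, hε, one_mul, Real.sq_sqrt (by linarith)]
    convert hp2 k using 3
    ring
  · refine ⟨(x₀, x₀ ^ 2), ⟨le_rfl, fun k => ?_⟩, ?_⟩
    · have := hx₀' k
      rw [val_eq] at this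
      simpa using this
    · apply Complex.ext <;> simp [he]
  · refine ⟨(z.re, z.re ^ 2 + z.im ^ 2), ⟨by simp [sq_nonneg], fun k => ?_⟩, ?_⟩
    · have := hz k
      rwa [val_eq] at this
    · apply Complex.ext
      · rw [hre]
      · rw [him, add_sub_cancel_left, Real.sqrt_sq_eq_abs, ← hzε]
  · exact Continuous.continuousOn (by fun_prop)

lemma exists_real_mem_domH : ∃ x : ℝ, (x : ℍ[ℝ]) ∈ c.domH := by
  obtain ⟨x, hx⟩ := c.base
  refine ⟨x, fun k => ?_⟩
  rw [← Quaternion.coe_sub, Quaternion.norm_coe]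
  have := hx k
  rwa [← Complex.ofReal_sub, Complex.norm_real] at this

/-- The slices are connected copies of the plane domain, and all of them contain one real point. -/
lemma isConnected_domH : IsConnected c.domH := by
  obtain ⟨x, hx⟩ := c.exists_real_mem_domH
  refine ⟨⟨x, hx⟩, isPreconnected_of_forall (x : ℍ[ℝ]) fun s hs => ?_⟩
  obtain ⟨I, hI, z, rfl⟩ := exists_sliceEmb s
  refine ⟨sliceEmb I '' c.dom, ?_, ⟨x, ?_, sliceEmb_ofReal x⟩, ⟨z, ?_, rfl⟩,
    c.isConnected_dom.isPreconnected.image _ (continuous_sliceEmb I).continuousOn⟩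
  · rw [← c.slice_domH hI]
    exact Set.image_preimage_subset _ _
  · rw [← c.slice_domH hI]
    rwa [slice, Set.mem_preimage, sliceEmb_ofReal]
  · rw [← c.slice_domH hI]
    exact hs

lemma isSliceDomain_domH : IsSliceDomain c.domH :=
  ⟨c.isOpen_domH, c.isConnected_domH, c.exists_real_mem_domH, fun I hI => by
    rw [c.slice_domH hI]; exact c.isConnected_dom⟩

lemma val_eq_zero_iff {k : Fin n} {z : ℂ} : c.val k z = 0 ↔ ‖z - c.m k‖ = c.R k := by
  have hσ : c.σ k ≠ 0 := by rcases c.σ_eq k with h | h <;> rw [h] <;> norm_num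
  rw [val, mul_eq_zero, or_iff_right hσ, sub_eq_zero, eq_comm,
    sq_eq_sq₀ (norm_nonneg _) (c.R_pos k).le]

lemma range_curve (k : Fin n) : Set.range (c.curve k) = {z | c.val k z = 0} := by
  rw [curve, range_orientedCircle (c.R_pos k) (c.σ_eq k)]
  ext z
  exact c.val_eq_zero_iff.symm

lemma val_pos_of_nonpos {j k : Fin n} (hjk : j ≠ k) {z : ℂ} (h : c.val j z ≤ 0) : 0 < c.val k z :=
  c.disjoint j k hjk z h

lemma mem_closure_of_val_eq_zero {k : Fin n} {z : ℂ} (hz : c.val k z = 0) : z ∈ closure c.dom := by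
  have hσ2 : c.σ k * c.σ k = 1 := by rcases c.σ_eq k with h | h <;> rw [h] <;> norm_num
  -- The factor 1 - sσ moves z radially to the inner side: towards the centre if σ = 1, away from it
  -- if σ = -1. The other circle conditions are strict at z by disjointness and so persist for small
  -- s.
  set u : ℝ → ℂ := fun s => c.m k + ((1 - s * c.σ k : ℝ) : ℂ) * (z - c.m k) with hu
  have huc : Continuous u := by fun_prop
  have hu0 : u 0 = z := by simp [hu]
  have hlim : Tendsto u (𝓝[>] 0) (𝓝 z) := by
    rw [← hu0]; exact huc.continuousAt.continuousWithinAt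
  refine mem_closure_of_tendsto hlim ?_
  have h1 : ∀ᶠ s in 𝓝[>] (0 : ℝ), ∀ j, j ≠ k → 0 < c.val j (u s) := by
    refine eventually_all.2 fun j => ?_
    by_cases hj : j = k
    · simp [hj]
    · have hpos : 0 < c.val j z := c.val_pos_of_nonpos (Ne.symm hj) hz.le
      filter_upwards [((c.continuous_val j).continuousAt.tendsto.comp hlim).eventually
        (eventually_gt_nhds hpos)] with s hs _ using hs
  have h2 : ∀ᶠ s in 𝓝[>] (0 : ℝ), s ∈ Set.Ioo (0 : ℝ) 1 := Ioo_mem_nhdsGT one_pos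
  filter_upwards [h1, h2] with s hs1 hs2
  intro j
  by_cases hj : j = k
  · subst hj
    rw [val_eq_zero_iff] at hz
    have hnorm : ‖u s - c.m j‖ ^ 2 = (1 - s * c.σ j) ^ 2 * c.R j ^ 2 := by
      simp only [hu, add_sub_cancel_left, norm_mul, hz, Complex.norm_real, mul_pow, Real.norm_eq_abs,
        sq_abs]
    rw [val, hnorm]
    have hR := c.R_pos j
    have : c.σ j * (c.R j ^ 2 - (1 - s * c.σ j) ^ 2 * c.R j ^ 2) =
        (2 * (c.σ j * c.σ j) * s - s ^ 2 * (c.σ j * (c.σ j * c.σ j))) * c.R j ^ 2 := by ring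
    rw [this, hσ2]
    refine mul_pos ?_ (by positivity)
    rcases c.σ_eq j with h | h <;> rw [h] <;> nlinarith [hs2.1, hs2.2]
  · exact hs1 j hj

lemma closure_dom_subset : closure c.dom ⊆ {z | ∀ k, 0 ≤ c.val k z} := by
  refine closure_minimal (fun z hz k => (hz k).le) ?_
  simp only [Set.ofPred_forall]
  exact isClosed_iInter fun k => isClosed_le continuous_const (c.continuous_val k)

lemma closure_domH_subset :
    closure c.domH ⊆ {s | ∀ k, 0 ≤ c.σ k * (c.R k ^ 2 - ‖s - (c.m k : ℍ[ℝ])‖ ^ 2)} := by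
  refine closure_minimal (fun z hz k => (hz k).le) ?_
  simp only [Set.ofPred_forall]
  exact isClosed_iInter fun k => isClosed_le continuous_const (by fun_prop)

lemma isJordanBoundary : IsJordanBoundary c.dom c.curve := by
  refine ⟨fun k => isC1JordanCurve_orientedCircle (c.R_pos k) (c.σ_eq k), ?_⟩
  rw [c.isOpen_dom.frontier_eq]
  ext z
  simp only [Set.mem_iUnion, range_curve, Set.mem_sdiff, Set.mem_ofPred_eq]
  constructor
  · rintro ⟨k, hk⟩
    exact ⟨c.mem_closure_of_val_eq_zero hk, fun h => (h k).ne' hk⟩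
  · rintro ⟨h1, h2⟩
    simp only [dom, Set.mem_ofPred_eq, not_forall, not_lt] at h2
    obtain ⟨k, hk⟩ := h2
    exact ⟨k, le_antisymm hk (c.closure_dom_subset h1 k)⟩

lemma exists_val_neg {z : ℂ} (hz : z ∉ closure c.dom) : ∃ k, c.val k z < 0 := by
  by_contra! h
  by_cases h2 : z ∈ c.dom
  · exact hz (subset_closure h2)
  · simp only [dom, Set.mem_ofPred_eq, not_forall, not_lt] at h2
    obtain ⟨k, hk⟩ := h2
    exact hz (c.mem_closure_of_val_eq_zero (le_antisymm hk (h k)))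

/-- Together with `windingNumber_curve_of_neg`: whatever the orientation, the winding number drops
by 1 from the inner to the outer side. This makes the sums over all circles independent of the
signs. -/
lemma windingNumber_curve_of_pos {k : Fin n} {z : ℂ} (h : 0 < c.val k z) :
    windingNumber (c.curve k) z = if c.σ k = 1 then 1 else 0 := by
  have hR := c.R_pos k
  rcases c.σ_eq k with hs | hs
  · rw [curve, windingNumber_orientedCircle_of_lt (c.σ_eq k), hs]
    · simp
    · rw [val, hs] at h
      exact lt_of_pow_lt_pow_left₀ 2 hR.le (by linarith)
  · rw [curve, windingNumber_orientedCircle_of_gt hR (c.σ_eq k), hs]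
    · norm_num
    · rw [val, hs] at h
      exact lt_of_pow_lt_pow_left₀ 2 (norm_nonneg _) (by linarith)

lemma windingNumber_curve_of_neg {k : Fin n} {z : ℂ} (h : c.val k z < 0) :
    windingNumber (c.curve k) z = (if c.σ k = 1 then 1 else 0) - 1 := by
  have hR := c.R_pos k
  rcases c.σ_eq k with hs | hs
  · rw [curve, windingNumber_orientedCircle_of_gt hR (c.σ_eq k), hs]
    · simp
    · rw [val, hs] at h
      exact lt_of_pow_lt_pow_left₀ 2 (norm_nonneg _) (by linarith)
  · rw [curve, windingNumber_orientedCircle_of_lt (c.σ_eq k), hs]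
    · norm_num
    · rw [val, hs] at h
      exact lt_of_pow_lt_pow_left₀ 2 hR.le (by linarith)

/-- If exactly one circle is an outer boundary, the circles are positively oriented. -/
lemma isPositiveJordanBoundary {k₀ : Fin n} (h₀ : ∀ k, c.σ k = 1 ↔ k = k₀) :
    IsPositiveJordanBoundary c.dom c.curve := by
  have hsum : ∑ k, (if c.σ k = 1 then (1 : ℂ) else 0) = 1 := by simp [h₀]
  refine ⟨c.isJordanBoundary, fun z hz => ?_, fun z hz => ?_⟩
  · rw [← hsum]
    exact Finset.sum_congr rfl fun k _ => c.windingNumber_curve_of_pos (hz k)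
  -- The point lies on the outer side of the circle j, hence by disjointness on the inner side of
  -- all others, so the total is 1 - 1.
  · obtain ⟨j, hj⟩ := c.exists_val_neg hz
    have : ∀ k, windingNumber (c.curve k) z =
        (if c.σ k = 1 then 1 else 0) - (if k = j then 1 else 0) := by
      intro k
      by_cases hk : k = j
      · subst hk
        rw [c.windingNumber_curve_of_neg hj, if_pos (rfl : k = k)]
      · rw [c.windingNumber_curve_of_pos (c.val_pos_of_nonpos (Ne.symm hk) hj.le), if_neg hk,
          sub_zero]
    simp only [this, Finset.sum_sub_distrib, hsum]
    simp

lemma isBounded_domH {k₀ : Fin n} (h₀ : c.σ k₀ = 1) : Bornology.IsBounded c.domH := by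
  refine (Metric.isBounded_ball (x := (c.m k₀ : ℍ[ℝ])) (r := c.R k₀)).subset fun s hs => ?_
  have := hs k₀
  rw [h₀] at this
  rw [mem_ball_iff_norm]
  exact lt_of_pow_lt_pow_left₀ 2 (c.R_pos k₀).le (by linarith)

lemma isAdmissible_domH {S : Set ℍ[ℝ]} (hS : S ⊆ c.domH) : IsAdmissible S c.domH :=
  ⟨c.axiallySymmetric_domH, c.isSliceDomain_domH, hS, fun I hI =>
    ⟨n, c.curve, by rw [c.slice_domH hI]; exact c.isJordanBoundary⟩⟩

end CircleDomain

/-! ### Complements of discs, seen through `z ↦ (z - α)⁻¹` -/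

/-- Disjoint closed discs with real centres, none of whose boundaries contains the real
number `α`. -/
structure DiscFamily (n : ℕ) (α : ℝ) where
  c : Fin n → ℝ
  ρ : Fin n → ℝ
  ρ_pos : ∀ k, 0 < ρ k
  disjoint : ∀ j k, j ≠ k → ∀ z : ℂ, ‖z - c j‖ ≤ ρ j → ρ k < ‖z - c k‖
  ne : ∀ k, |α - c k| ≠ ρ k

namespace DiscFamily

variable {n : ℕ} {α : ℝ} (D : DiscFamily n α)

/-- The power of `α` with respect to the circle `k`. -/
def pow (k : Fin n) : ℝ := (D.c k - α) ^ 2 - D.ρ k ^ 2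

lemma pow_ne_zero (k : Fin n) : D.pow k ≠ 0 := by
  intro h
  rw [pow, sub_eq_zero, sq_eq_sq_iff_abs_eq_abs, abs_sub_comm, abs_of_pos (D.ρ_pos k)] at h
  exact D.ne k h

open Classical in
/-- The orientation of the transformed circle. -/
noncomputable def sign (k : Fin n) : ℝ := if D.pow k < 0 then 1 else -1

lemma sign_mul_abs (k : Fin n) : D.sign k * |D.pow k| = -D.pow k := by
  unfold sign
  split_ifs with h
  · rw [abs_of_neg h, one_mul]
  · rw [abs_of_nonneg (not_lt.1 h), neg_one_mul]

/-- With d = c - α, the right-hand side is 1 - 2d Re q + (d² - ρ²)|q|². Completing the square with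
the leading coefficient d² - ρ², the power of α, produces the centre and the radius of the image
circle. -/
lemma sign_mul_sq (k : Fin n) (q : ℂ) :
    (D.sign k * ((D.ρ k / |D.pow k|) ^ 2 - ‖q - ((D.c k - α) / D.pow k : ℝ)‖ ^ 2)) * |D.pow k| =
      ‖1 - (D.c k - α : ℝ) * q‖ ^ 2 - (D.ρ k * ‖q‖) ^ 2 := by
  have h0 := D.pow_ne_zero k
  rw [mul_right_comm, D.sign_mul_abs, mul_pow, div_pow, sq_abs]
  simp only [← Complex.normSq_eq_norm_sq, Complex.normSq_apply, Complex.sub_re, Complex.sub_im,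
    Complex.ofReal_re, Complex.ofReal_im, sub_zero, Complex.one_re, Complex.one_im,
    Complex.mul_re, Complex.mul_im, zero_mul, add_zero, zero_sub]
  have e : D.ρ k ^ 2 = (D.c k - α) ^ 2 - D.pow k := by rw [pow]; ring
  rw [e]
  field_simp
  ring

lemma norm_one_sub {q : ℂ} (hq : q ≠ 0) (k : Fin n) :
    ‖1 - (D.c k - α : ℝ) * q‖ = ‖α + q⁻¹ - D.c k‖ * ‖q‖ := by
  rw [← norm_mul]
  congr 1
  field_simp
  push_cast
  ring

/-- The outer side of the image circle is the image of the closed disc. The point q = 0 stands for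
∞, which lies in no disc, and is always on the inner side. -/
lemma sign_mul_nonpos_iff (k : Fin n) (q : ℂ) :
    D.sign k * ((D.ρ k / |D.pow k|) ^ 2 - ‖q - ((D.c k - α) / D.pow k : ℝ)‖ ^ 2) ≤ 0 ↔
      q ≠ 0 ∧ ‖α + q⁻¹ - D.c k‖ ≤ D.ρ k := by
  have h0 : 0 < |D.pow k| := abs_pos.2 (D.pow_ne_zero k)
  rw [← mul_le_mul_iff_left₀ h0, D.sign_mul_sq, zero_mul, sub_nonpos,
    sq_le_sq₀ (norm_nonneg _) (mul_nonneg (D.ρ_pos k).le (norm_nonneg _))]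
  by_cases hq : q = 0
  · subst hq
    simp
  · rw [D.norm_one_sub hq, mul_le_mul_iff_left₀ (norm_pos_iff.2 hq)]
    exact (and_iff_right hq).symm

/-- The image of the complement of the discs under `z ↦ (z - α)⁻¹`, including the image `0`
of `∞`. -/
noncomputable def toCircleDomain : CircleDomain n where
  m k := (D.c k - α) / D.pow k
  R k := D.ρ k / |D.pow k|
  σ := D.sign
  R_pos k := div_pos (D.ρ_pos k) (abs_pos.2 (D.pow_ne_zero k))
  σ_eq k := by unfold sign; split_ifs <;> simp
  disjoint j k hjk z hz := by
    rw [D.sign_mul_nonpos_iff] at hz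
    rw [← not_le, D.sign_mul_nonpos_iff]
    rintro ⟨-, h⟩
    exact absurd h (not_le.2 (D.disjoint j k hjk _ hz.2))
  base := by
    refine ⟨0, fun k => ?_⟩
    rw [← not_le, D.sign_mul_nonpos_iff]
    simp

lemma val_nonpos_iff (k : Fin n) (q : ℂ) :
    D.toCircleDomain.val k q ≤ 0 ↔ q ≠ 0 ∧ ‖α + q⁻¹ - D.c k‖ ≤ D.ρ k :=
  D.sign_mul_nonpos_iff k q

lemma val_mul_abs (k : Fin n) (q : ℂ) : D.toCircleDomain.val k q * |D.pow k| =
    ‖1 - (D.c k - α : ℝ) * q‖ ^ 2 - (D.ρ k * ‖q‖) ^ 2 := D.sign_mul_sq k q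

lemma val_eq_zero_iff (k : Fin n) (q : ℂ) :
    D.toCircleDomain.val k q = 0 ↔ q ≠ 0 ∧ ‖α + q⁻¹ - D.c k‖ = D.ρ k := by
  have h0 : |D.pow k| ≠ 0 := abs_ne_zero.2 (D.pow_ne_zero k)
  rw [← mul_eq_zero_iff_right h0, D.val_mul_abs, sub_eq_zero,
    sq_eq_sq₀ (norm_nonneg _) (mul_nonneg (D.ρ_pos k).le (norm_nonneg _))]
  by_cases hq : q = 0
  · subst hq
    simp
  · rw [D.norm_one_sub hq, mul_left_inj' (norm_ne_zero_iff.2 hq)]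
    exact (and_iff_right hq).symm

lemma val_nonneg_iff (k : Fin n) (q : ℂ) :
    0 ≤ D.toCircleDomain.val k q ↔ q = 0 ∨ D.ρ k ≤ ‖α + q⁻¹ - D.c k‖ := by
  have h1 := D.val_nonpos_iff k q
  have h2 := D.val_eq_zero_iff k q
  rw [← not_iff_not, not_or, not_le, not_le, lt_iff_le_and_ne, lt_iff_le_and_ne]
  tauto

/-- Only a disc around the pole α is mapped to the exterior of a circle, and then its boundary
becomes an outer boundary. -/
lemma σ_eq_one_iff (k : Fin n) : D.toCircleDomain.σ k = 1 ↔ |α - D.c k| < D.ρ k := by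
  change D.sign k = 1 ↔ _
  have h1 : D.sign k = 1 ↔ D.pow k < 0 := by
    unfold sign
    split_ifs with h
    · simp [h]
    · simp [h]; norm_num
  rw [h1, pow, sub_neg, sq_lt_sq, abs_of_pos (D.ρ_pos k), abs_sub_comm]

lemma curve_spec (k : Fin n) (t : ℝ) : D.toCircleDomain.curve k t ≠ 0 ∧
    ‖α + (D.toCircleDomain.curve k t)⁻¹ - D.c k‖ = D.ρ k := by
  rw [← D.val_eq_zero_iff]
  have : D.toCircleDomain.curve k t ∈ Set.range (D.toCircleDomain.curve k) := ⟨t, rfl⟩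
  rwa [D.toCircleDomain.range_curve] at this

end DiscFamily

/-! ### Discs fitted to the strip, to the neighbourhood of infinity and to the point α. -/

section Existence

lemma re_ge_of_mem_disc {a c : ℝ} {z : ℂ} (h : ‖z - c‖ ≤ c - a) : a ≤ z.re := by
  have := (Complex.abs_re_le_norm (z - c)).trans h
  rw [Complex.sub_re, Complex.ofReal_re] at this
  linarith [neg_abs_le (z.re - c)]

lemma re_le_of_mem_disc {a c : ℝ} {z : ℂ} (h : ‖z - (-c : ℝ)‖ ≤ c - a) : z.re ≤ -a := by
  have := (Complex.abs_re_le_norm (z - (-c : ℝ))).trans h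
  rw [Complex.sub_re, Complex.ofReal_re] at this
  linarith [le_abs_self (z.re - -c)]

lemma lt_norm_sub_of_re_le {c x y : ℝ} {z : ℂ} (h : z.re ≤ y) (hx : x < c - y) :
    x < ‖z - c‖ := by
  have := (neg_abs_le (z - c).re).trans' (neg_le_neg (Complex.abs_re_le_norm (z - c)))
  rw [Complex.sub_re, Complex.ofReal_re] at this
  linarith

lemma lt_norm_sub_of_le_re {c x y : ℝ} {z : ℂ} (h : y ≤ z.re) (hx : x < y - c) :
    x < ‖z - c‖ := by
  have := (le_abs_self (z - c).re).trans (Complex.abs_re_le_norm (z - c))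
  rw [Complex.sub_re, Complex.ofReal_re] at this
  linarith

/-- Large discs cover the parts of a ball that lie off a strip. -/
lemma norm_sub_lt_of_large {a b r c : ℝ} (hab : a < b)
    (hc' : (r ^ 2 - a ^ 2) / (2 * (b - a)) < c) {x N : ℝ} (hx : b ≤ x) (hN : N ≤ r ^ 2) (hc0 : 0 < c) :
    N - 2 * c * x + c ^ 2 < (c - a) ^ 2 := by
  -- In the extreme case x = b, N = r² the claim reads r² - a² < 2c(b - a).
  rw [div_lt_iff₀ (by linarith)] at hc'
  nlinarith [mul_le_mul_of_nonneg_left hx hc0.le]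

lemma quaternion_norm_sub_coe_sq (s : ℍ[ℝ]) (c : ℝ) :
    ‖s - (c : ℍ[ℝ])‖ ^ 2 = ‖s‖ ^ 2 - 2 * c * s.re + c ^ 2 := by
  simp only [sq, ← Quaternion.normSq_eq_norm_mul_self, Quaternion.normSq_def']
  simp
  ring

/-- The discs of radius c - a about ±c touch the lines Re = ±a and approach half planes as c grows.
Inside a fixed ball their complement is therefore eventually contained in the strip |Re| < b. -/
lemma exists_large (a b r x : ℝ) (hab : a < b) (hb : 0 < a) : ∃ c : ℝ, a < c ∧ x < c ∧
    ∀ s : ℍ[ℝ], c - a ≤ ‖s - (c : ℍ[ℝ])‖ → c - a ≤ ‖s - ((-c : ℝ) : ℍ[ℝ])‖ →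
      |s.re| < b ∨ r < ‖s‖ := by
  obtain ⟨c, hc⟩ := exists_gt (max (max a x) ((r ^ 2 - a ^ 2) / (2 * (b - a))))
  have h1 : a < c := ((le_max_left _ _).trans (le_max_left _ _)).trans_lt hc
  have h2 : x < c := ((le_max_right _ _).trans (le_max_left _ _)).trans_lt hc
  have h3 : (r ^ 2 - a ^ 2) / (2 * (b - a)) < c := (le_max_right _ _).trans_lt hc
  refine ⟨c, h1, h2, fun s hs1 hs2 => ?_⟩
  by_contra! h
  obtain ⟨h4, h5⟩ := h
  have hN : ‖s‖ ^ 2 ≤ r ^ 2 := by gcongr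
  have hca : 0 ≤ c - a := by linarith
  have hs1' : (c - a) ^ 2 ≤ ‖s - (c : ℍ[ℝ])‖ ^ 2 := by gcongr
  have hs2' : (c - a) ^ 2 ≤ ‖s - ((-c : ℝ) : ℍ[ℝ])‖ ^ 2 := by gcongr
  rw [quaternion_norm_sub_coe_sq] at hs1' hs2'
  rcases le_abs.1 h4 with h | h
  · have := norm_sub_lt_of_large hab h3 h hN (by linarith)
    linarith
  · have := norm_sub_lt_of_large hab h3 h hN (by linarith)
    nlinarith

/-- The complement of two large discs, as a domain that contains the strip `|Re z| ≤ ω`. -/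
def twoDiscs (a c : ℝ) (ha : 0 < a) (hc : a < c) : CircleDomain 2 where
  m := ![c, -c]
  R := fun _ => c - a
  σ := fun _ => -1
  R_pos _ := by linarith
  σ_eq _ := Or.inr rfl
  disjoint j k hjk z hz := by
    have hca : 0 ≤ c - a := by linarith
    have h1 : ‖z - (![c, -c] j : ℝ)‖ ≤ c - a :=
      le_of_sq_le_sq (by linarith) hca
    suffices h : c - a < ‖z - (![c, -c] k : ℝ)‖ by
      have := pow_lt_pow_left₀ h hca two_ne_zero
      linarith
    fin_cases j <;> fin_cases k
    · exact absurd rfl hjk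
    · exact lt_norm_sub_of_le_re (re_ge_of_mem_disc h1) (show c - a < a - -c by linarith)
    · exact lt_norm_sub_of_re_le (re_le_of_mem_disc h1) (show c - a < c - -a by linarith)
    · exact absurd rfl hjk
  base := by
    refine ⟨0, fun k => ?_⟩
    have : ‖((0 : ℝ) : ℂ) - (![c, -c] k : ℝ)‖ ^ 2 = c ^ 2 := by
      fin_cases k <;> simp
    rw [this]
    nlinarith

/-- A family of discs adapted to the point `α`: all but one of the discs, or all, lie in
`{a ≤ |Re z|}`, exactly one contains `α`, and their complement lies in the domain
`{|Re s| < b} ∪ {r < |s|}`. -/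
structure DiscFamily.IsAdapted {n : ℕ} {α : ℝ} (D : DiscFamily n α) (a b r η : ℝ) (k₀ : Fin n) :
    Prop where
  inside : ∀ k, |α - D.c k| < D.ρ k ↔ k = k₀
  cases : ∀ k, (∀ z : ℂ, ‖z - D.c k‖ ≤ D.ρ k → a ≤ z.re) ∨
    (∀ z : ℂ, ‖z - D.c k‖ ≤ D.ρ k → z.re ≤ -a) ∨
    (D.c k = α ∧ D.ρ k ≤ η ∧ |α| + D.ρ k < a)
  compl : ∀ s : ℍ[ℝ], (∀ k, D.ρ k ≤ ‖s - (D.c k : ℍ[ℝ])‖) → |s.re| < b ∨ r < ‖s‖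

/-- The point α must be cut out, because it corresponds to q = ∞. If |α| > ω, then a < |α| can be
chosen, and one of the two large discs contains α once c > |α|. Otherwise a third, small disc about
α is added. -/
lemma DiscFamily.exists_isAdapted {ω b : ℝ} (hω : 0 ≤ ω) (hb : ω < b) (r : ℝ) {η : ℝ} (hη : 0 < η)
    (α : ℝ) : ∃ (a : ℝ) (n : ℕ) (D : DiscFamily n α) (k₀ : Fin n), ω < a ∧ a < b ∧
      D.IsAdapted a b r η k₀ := by
  by_cases hα : ω < |α|
  · obtain ⟨a, ha1, ha2⟩ := exists_between (lt_min hb hα)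
    have hab : a < b := ha2.trans_le (min_le_left _ _)
    have haα : a < |α| := ha2.trans_le (min_le_right _ _)
    have ha0 : 0 < a := by linarith
    obtain ⟨c, hc1, hc2, hc3⟩ := exists_large a b r |α| hab ha0
    have hin : ∀ k : Fin 2, |α - ![c, -c] k| < c - a ↔ k = if 0 < α then 0 else 1 := by
      intro k
      rcases le_or_gt α 0 with h | h
      · rw [abs_of_nonpos h] at haα hc2
        rw [if_neg (not_lt.2 h)]
        fin_cases k
        · simp only [Fin.zero_eta, Matrix.cons_val_zero, zero_ne_one, iff_false, not_lt]
          rw [abs_of_neg (by linarith)]; linarith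
        · simp only [Fin.mk_one, Matrix.cons_val_one, Matrix.cons_val_zero, iff_true]
          rw [abs_of_pos (by linarith)]; linarith
      · rw [abs_of_pos h] at haα hc2
        rw [if_pos h]
        fin_cases k
        · simp only [Fin.zero_eta, Matrix.cons_val_zero, iff_true]
          rw [abs_of_neg (by linarith)]; linarith
        · simp only [Fin.mk_one, Matrix.cons_val_one, Matrix.cons_val_zero, one_ne_zero, iff_false,
            not_lt]
          rw [abs_of_pos (by linarith)]; linarith
    have hne : ∀ k : Fin 2, |α - ![c, -c] k| ≠ c - a := by
      intro k
      rcases le_or_gt α 0 with h | h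
      · rw [abs_of_nonpos h] at haα hc2
        fin_cases k
        · simp only [Fin.zero_eta, Matrix.cons_val_zero]
          rw [abs_of_neg (by linarith)]; intro; linarith
        · simp only [Fin.mk_one, Matrix.cons_val_one, Matrix.cons_val_zero]
          rw [abs_of_pos (by linarith)]; intro; linarith
      · rw [abs_of_pos h] at haα hc2
        fin_cases k
        · simp only [Fin.zero_eta, Matrix.cons_val_zero]
          rw [abs_of_neg (by linarith)]; intro; linarith
        · simp only [Fin.mk_one, Matrix.cons_val_one, Matrix.cons_val_zero]
          rw [abs_of_pos (by linarith)]; intro; linarith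
    refine ⟨a, 2, ⟨![c, -c], fun _ => c - a, fun _ => by linarith, ?_, hne⟩,
      if 0 < α then 0 else 1, ha1, hab, ⟨hin, ?_, ?_⟩⟩
    · intro j k hjk z hz
      fin_cases j <;> fin_cases k
      · exact absurd rfl hjk
      · exact lt_norm_sub_of_le_re (re_ge_of_mem_disc hz) (show c - a < a - -c by linarith)
      · exact lt_norm_sub_of_re_le (re_le_of_mem_disc hz) (show c - a < c - -a by linarith)
      · exact absurd rfl hjk
    · intro k
      fin_cases k
      · exact Or.inl fun z hz => re_ge_of_mem_disc hz
      · exact Or.inr (Or.inl fun z hz => re_le_of_mem_disc hz)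
    · exact fun s hs => hc3 s (hs 0) (hs 1)
  · rw [not_lt] at hα
    obtain ⟨a, ha1, hab⟩ := exists_between hb
    have ha0 : 0 < a := by linarith
    obtain ⟨c, hc1, hc2, hc3⟩ := exists_large a b r a hab ha0
    -- The bound a - |α| keeps the small disc in |Re z| < a, hence disjoint from the large ones.
    obtain ⟨e, he0, he1⟩ := exists_between (lt_min hη (show 0 < a - |α| by linarith))
    have heη : e < η := he1.trans_le (min_le_left _ _)
    have hea : e < a - |α| := he1.trans_le (min_le_right _ _)
    have hα1 := le_abs_self α
    have hα2 := neg_abs_le α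
    refine ⟨a, 3, ⟨![c, -c, α], ![c - a, c - a, e], ?_, ?_, ?_⟩, 2, ha1, hab, ⟨?_, ?_, ?_⟩⟩
    · intro k
      fin_cases k
      · exact sub_pos.2 hc1
      · exact sub_pos.2 hc1
      · exact he0
    · intro j k hjk z hz
      fin_cases j <;> fin_cases k
      · exact absurd rfl hjk
      · exact lt_norm_sub_of_le_re (re_ge_of_mem_disc hz) (show c - a < a - -c by linarith)
      · exact lt_norm_sub_of_le_re (re_ge_of_mem_disc hz) (show e < a - α by linarith)
      · exact lt_norm_sub_of_re_le (re_le_of_mem_disc hz) (show c - a < c - -a by linarith)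
      · exact absurd rfl hjk
      · exact lt_norm_sub_of_re_le (re_le_of_mem_disc hz) (show e < α - -a by linarith)
      · have hz' : ‖z - (α : ℂ)‖ ≤ α - (α - e) := by
          have : ‖z - (α : ℂ)‖ ≤ e := hz
          linarith
        have h := (le_abs_self _).trans ((Complex.abs_re_le_norm _).trans hz')
        rw [Complex.sub_re, Complex.ofReal_re] at h
        exact lt_norm_sub_of_re_le (y := α + e) (by linarith) (show c - a < c - (α + e) by linarith)
      · have hz' : ‖z - (α : ℂ)‖ ≤ α - (α - e) := by
          have : ‖z - (α : ℂ)‖ ≤ e := hz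
          linarith
        exact lt_norm_sub_of_le_re (re_ge_of_mem_disc hz')
          (show c - a < α - e - -c by linarith)
      · exact absurd rfl hjk
    · intro k
      fin_cases k
      · change |α - c| ≠ c - a
        rw [abs_of_neg (by linarith)]; intro; linarith
      · change |α - -c| ≠ c - a
        rw [abs_of_pos (by linarith)]; intro; linarith
      · change |α - α| ≠ e
        rw [sub_self, abs_zero]; exact he0.ne
    · intro k
      fin_cases k
      · change |α - c| < c - a ↔ (0 : Fin 3) = 2
        rw [abs_of_neg (by linarith)]
        simp only [Fin.isValue, Fin.reduceEq, iff_false, not_lt]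
        linarith
      · change |α - -c| < c - a ↔ (1 : Fin 3) = 2
        rw [abs_of_pos (by linarith)]
        simp only [Fin.isValue, Fin.reduceEq, iff_false, not_lt]
        linarith
      · change |α - α| < e ↔ (2 : Fin 3) = 2
        simp [he0]
    · intro k
      fin_cases k
      · exact Or.inl fun z hz => re_ge_of_mem_disc hz
      · exact Or.inr (Or.inl fun z hz => re_le_of_mem_disc hz)
      · refine Or.inr (Or.inr ⟨rfl, heη.le, ?_⟩)
        change |α| + e < a
        linarith
    · exact fun s hs => hc3 s (hs 0) (hs 1)

end Existence

/-! ### Densities of vector measures with respect to their variation -/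

section Density

variable {X : Type*} [MeasurableSpace X]

/-- Domination by ν gives absolute continuity, and it confines the Radon–Nikodym derivative to [-1,
1] almost everywhere. -/
lemma exists_bounded_density_signedMeasure (s : SignedMeasure X) (ν : Measure X)
    [IsFiniteMeasure ν] (h : ∀ E, MeasurableSet E → |s E| ≤ ν.real E) :
    ∃ g : X → ℝ, Measurable g ∧ (∀ x, |g x| ≤ 1) ∧ ∀ E, MeasurableSet E → s E = ∫ x in E, g x ∂ν := by
  have hac : s ≪ᵥ ν.toENNRealVectorMeasure := by
    refine VectorMeasure.AbsolutelyContinuous.mk fun E hE h0 => ?_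
    rw [Measure.toENNRealVectorMeasure_apply_measurable hE] at h0
    have := h E hE
    rw [Measure.real, h0, ENNReal.toReal_zero] at this
    exact abs_nonpos_iff.1 this
  set g := s.rnDeriv ν with hg
  have hgm : Measurable g := s.measurable_rnDeriv ν
  have hgi : Integrable g ν := s.integrable_rnDeriv ν
  have hs : ∀ E, MeasurableSet E → s E = ∫ x in E, g x ∂ν := fun E hE => by
    rw [← withDensityᵥ_apply hgi hE, s.withDensityᵥ_rnDeriv_eq ν hac]
  have h1 : g ≤ᵐ[ν] fun _ => 1 := by
    refine ae_le_of_forall_setIntegral_le hgi (integrable_const _) fun E hE _ => ?_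
    rw [← hs E hE, setIntegral_const, smul_eq_mul, mul_one]
    exact (le_abs_self _).trans (h E hE)
  have h2 : (fun _ => -1) ≤ᵐ[ν] g := by
    refine ae_le_of_forall_setIntegral_le (integrable_const _) hgi fun E hE _ => ?_
    rw [← hs E hE, setIntegral_const, smul_eq_mul, mul_neg, mul_one]
    exact (neg_le_neg (h E hE)).trans (neg_abs_le _)
  -- Truncation changes g on a null set only and makes the bound hold everywhere.
  refine ⟨fun x => max (-1) (min 1 (g x)), by fun_prop, fun x => ?_, fun E hE => ?_⟩
  · rw [abs_le]
    exact ⟨le_max_left _ _, max_le (by norm_num) (min_le_left _ _)⟩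
  · rw [hs E hE]
    refine setIntegral_congr_ae hE ?_
    filter_upwards [h1, h2] with x hx1 hx2 _
    rw [min_eq_right hx1, max_eq_right hx2]

/-- A vector measure of finite variation with values in a Euclidean space has a bounded density
with respect to its variation. -/
lemma exists_bounded_density_variation {E : Type*} [NormedAddCommGroup E]
    [InnerProductSpace ℝ E] [FiniteDimensional ℝ E] (μ : VectorMeasure X E)
    [IsFiniteMeasure μ.variation] :
    ∃ (h : X → E) (C : ℝ), StronglyMeasurable h ∧ (∀ x, ‖h x‖ ≤ C) ∧
      ∀ S, MeasurableSet S → μ S = ∫ x in S, h x ∂μ.variation := by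
  set b := stdOrthonormalBasis ℝ E
  -- A component along a unit vector is a signed measure dominated by the variation. Each component
  -- density is bounded by 1, so the dimension of E serves as the constant C.
  have key : ∀ i, ∃ g : X → ℝ, Measurable g ∧ (∀ x, |g x| ≤ 1) ∧
      ∀ S, MeasurableSet S → inner ℝ (b i) (μ S) = ∫ x in S, g x ∂μ.variation := by
    intro i
    refine exists_bounded_density_signedMeasure
      (μ.mapRange (innerSL ℝ (b i)).toLinearMap.toAddMonoidHom (innerSL ℝ (b i)).continuous)
      μ.variation (fun S hS => ?_)
    change |inner ℝ (b i) (μ S)| ≤ _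
    refine (abs_real_inner_le_norm _ _).trans ?_
    rw [b.orthonormal.1 i, one_mul]
    exact VectorMeasure.norm_measure_le_variation
  choose g hgm hgb hg using key
  refine ⟨fun x => ∑ i, g i x • b i, Fintype.card (Fin (Module.finrank ℝ E)), ?_, fun x => ?_,
    fun S hS => ?_⟩
  · exact Finset.stronglyMeasurable_fun_sum _ fun i _ =>
      (hgm i).stronglyMeasurable.smul_const (b i)
  · refine (norm_sum_le _ _).trans ?_
    refine (Finset.sum_le_card_nsmul _ _ 1 fun i _ => ?_).trans (by simp)
    rw [norm_smul, b.orthonormal.1 i, mul_one]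
    exact hgb i x
  · have hint : ∀ i, Integrable (g i) (μ.variation.restrict S) := fun i =>
      Integrable.of_bound (hgm i).aestronglyMeasurable 1 (.of_forall fun x => hgb i x)
    beta_reduce
    rw [integral_finsetSum _ fun i _ => (hint i).smul_const _]
    rw [← b.sum_repr' (μ S)]
    refine Finset.sum_congr rfl fun i _ => ?_
    rw [integral_smul_const, hg i S hS]

/-- Both sides are additive and L¹-continuous in f and agree on indicator functions. This turns
integrals against μ into Bochner integrals against its variation. -/
lemma vectorMeasure_integral_eq_of_density {E F G : Type*}
    [NormedAddCommGroup E] [NormedSpace ℝ E] [NormedAddCommGroup F] [NormedSpace ℝ F]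
    [CompleteSpace F] [NormedAddCommGroup G] [NormedSpace ℝ G] [CompleteSpace G]
    {μ : VectorMeasure X F} [IsFiniteMeasure μ.variation] (B : E →L[ℝ] F →L[ℝ] G)
    {h : X → F} {C : ℝ} (hm : StronglyMeasurable h) (hC : ∀ x, ‖h x‖ ≤ C)
    (hμ : ∀ S, MeasurableSet S → μ S = ∫ x in S, h x ∂μ.variation) {f : X → E}
    (hf : Integrable f μ.variation) :
    μ.integral f B = ∫ x, B (f x) (h x) ∂μ.variation := by
  have hint : ∀ f : X → E, Integrable f μ.variation →
      Integrable (fun x => B (f x) (h x)) μ.variation := fun f hf => by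
    refine (hf.norm.const_mul (‖B‖ * C)).mono'
      (B.aestronglyMeasurable_comp₂ hf.1 hm.aestronglyMeasurable) (.of_forall fun x => ?_)
    refine (B.le_opNorm₂ _ _).trans ?_
    calc ‖B‖ * ‖f x‖ * ‖h x‖ ≤ ‖B‖ * ‖f x‖ * C := by gcongr; exact hC x
      _ = ‖B‖ * C * ‖f x‖ := by ring
  have hhint : ∀ S, Integrable h (μ.variation.restrict S) := fun S =>
    Integrable.of_bound hm.aestronglyMeasurable C (.of_forall hC)
  refine Integrable.induction (fun f : X → E => μ.integral f B = ∫ x, B (f x) (h x) ∂μ.variation)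
    ?_ ?_ ?_ ?_ hf
  · intro c S hS _
    have e1 : μ.integral (S.indicator fun _ => c) B = B c (μ S) := by
      rw [VectorMeasure.integral_eq_setToFun, setToFun_indicator_const _ hS (measure_ne_top _ _)]
      rfl
    have e2 : (fun x => B (S.indicator (fun _ => c) x) (h x)) = S.indicator fun x => B c (h x) := by
      funext x
      by_cases hx : x ∈ S <;> simp [hx]
    rw [e1, e2, integral_indicator hS, hμ S hS, ContinuousLinearMap.integral_comp_comm _ (hhint S)]
  · intro f g _ hf hg ef eg
    rw [VectorMeasure.integral_add hf hg, ef, eg, ← integral_add (hint f hf) (hint g hg)]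
    simp
  · refine isClosed_eq VectorMeasure.continuous_integral ?_
    refine (LipschitzWith.of_dist_le_mul (K := Real.toNNReal (‖B‖ * C)) fun f g => ?_).continuous
    rw [dist_eq_norm, ← integral_sub (hint _ (L1.integrable_coeFn f)) (hint _ (L1.integrable_coeFn g)),
      dist_eq_norm, L1.norm_eq_integral_norm, ← integral_const_mul]
    rcases isEmpty_or_nonempty X with hX | ⟨⟨x₀⟩⟩
    · have : μ.variation = 0 := Measure.eq_zero_of_isEmpty _
      simp [this]
    have hC0 : 0 ≤ C := (norm_nonneg _).trans (hC x₀)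
    refine norm_integral_le_of_norm_le ((L1.integrable_coeFn (f - g)).norm.const_mul _) ?_
    filter_upwards [Lp.coeFn_sub f g] with x hx
    rw [hx, Real.coe_toNNReal _ (by positivity), ← sub_apply, ← map_sub]
    refine (B.le_opNorm₂ _ _).trans ?_
    calc ‖B‖ * ‖f x - g x‖ * ‖h x‖ ≤ ‖B‖ * ‖f x - g x‖ * C := by gcongr; exact hC x
      _ = ‖B‖ * C * ‖f x - g x‖ := by ring
  · intro f g hfg hf ef
    rw [← VectorMeasure.integral_congr_ae hfg, ef]
    refine integral_congr_ae ?_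
    filter_upwards [hfg] with x hx
    rw [hx]

end Density

/-- `h` is a bounded density of `μ` with respect to its variation. -/
structure IsVariationDensity (μ : VectorMeasure ℝ ℍ[ℝ]) (h : ℝ → ℍ[ℝ]) (C : ℝ) : Prop where
  stronglyMeasurable : StronglyMeasurable h
  norm_le : ∀ t, ‖h t‖ ≤ C
  apply_eq : ∀ S, MeasurableSet S → μ S = ∫ x in S, h x ∂μ.variation

lemma IsVariationDensity.nonneg {μ : VectorMeasure ℝ ℍ[ℝ]} {h : ℝ → ℍ[ℝ]} {C : ℝ}
    (hh : IsVariationDensity μ h C) : 0 ≤ C := (norm_nonneg _).trans (hh.norm_le 0)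

lemma IsVariationDensity.leftIntegral_eq {μ : VectorMeasure ℝ ℍ[ℝ]} [IsFiniteMeasure μ.variation]
    {h : ℝ → ℍ[ℝ]} {C : ℝ} (hh : IsVariationDensity μ h C) {V : Type*} [NormedAddCommGroup V]
    [NormedSpace ℝ V] [CompleteSpace V] [Module ℍ[ℝ] V] [IsScalarTower ℝ ℍ[ℝ] V]
    [IsBoundedSMul ℍ[ℝ] V] {F : ℝ → V} (hF : Integrable F μ.variation) :
    leftIntegral μ F = ∫ t, h t • F t ∂μ.variation :=
  vectorMeasure_integral_eq_of_density _ hh.stronglyMeasurable hh.norm_le hh.apply_eq hF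

/-! ### Slice regularity of the transform -/

section Exponential

lemma norm_exp_quaternion (x : ℍ[ℝ]) : ‖NormedSpace.exp x‖ = Real.exp x.re := by
  rw [Quaternion.norm_exp, ← Real.exp_eq_exp_ℝ, Real.norm_eq_abs, Real.abs_exp]

lemma norm_exp_sub_exp_le {m : ℝ} {x y : ℍ[ℝ]} (hx : x.re ≤ m) (hy : y.re ≤ m) :
    ‖NormedSpace.exp x - NormedSpace.exp y‖ ≤ Real.exp m * ‖x - y‖ := by
  -- Since x and y need not commute, the path e^(ux) e^((1-u)y) from e^y to e^x is used; its
  -- derivative contains the single factor x - y, and the norms of the exponentials depend on real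
  -- parts only.
  have hd : ∀ u : ℝ, HasDerivAt
      (fun u : ℝ => NormedSpace.exp (u • x) * NormedSpace.exp ((1 - u) • y))
      (NormedSpace.exp (u • x) * (x - y) * NormedSpace.exp ((1 - u) • y)) u := fun u => by
    have h1 := hasDerivAt_exp_smul_const (𝕂 := ℝ) x u
    have h2 := (hasDerivAt_exp_smul_const' (𝕂 := ℝ) y (1 - u)).scomp u
      ((hasDerivAt_id u).const_sub 1)
    convert! h1.mul h2 using 1
    simp only [neg_smul, one_smul, Function.comp]
    noncomm_ring
  have := norm_image_sub_le_of_norm_deriv_le_segment_01' (C := Real.exp m * ‖x - y‖)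
    (fun u _ => (hd u).hasDerivWithinAt) (fun u hu => ?_)
  · simpa using this
  · rw [norm_mul, norm_mul, norm_exp_quaternion, norm_exp_quaternion, mul_right_comm, ← Real.exp_add]
    gcongr
    simp only [Quaternion.re_smul, smul_eq_mul]
    nlinarith [hu.1, hu.2]

lemma contDiff_exp_quaternion : ContDiff ℝ 1 (NormedSpace.exp : ℍ[ℝ] → ℍ[ℝ]) :=
  contDiff_iff_contDiffAt.2 fun x => (NormedSpace.exp_analytic (𝕂 := ℝ) x).contDiffAt

/-- The exponential maps each plane ℂ_I to itself, so along ℂ_I its derivative is the complex one.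
Slice regularity needs no other directions. -/
lemma fderiv_exp_sliceEmb {I : ℍ[ℝ]} (hI : I ∈ ImagUnits) (z w : ℂ) :
    fderiv ℝ NormedSpace.exp (sliceEmb I z) (sliceEmb I w) =
      sliceEmb I (NormedSpace.exp z * w) := by
  have h1 : HasFDerivAt (fun w => NormedSpace.exp (sliceEmb I w))
      ((fderiv ℝ NormedSpace.exp (sliceEmb I z)).comp (sliceCLM I)) z :=
    ((contDiff_exp_quaternion.differentiable one_ne_zero _).hasFDerivAt).comp z
      (hasFDerivAt_sliceEmb I z)
  have h2 : HasFDerivAt (fun w : ℂ => (NormedSpace.exp w : ℂ))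
      ((ContinuousLinearMap.toSpanSingleton ℂ (NormedSpace.exp z : ℂ)).restrictScalars ℝ) z :=
    (hasDerivAt_exp (𝕂 := ℂ) (x := z)).hasFDerivAt.restrictScalars ℝ
  simp_rw [exp_sliceEmb hI] at h1
  have h3 : HasFDerivAt (fun w => sliceEmb I (NormedSpace.exp w)) _ z :=
    (hasFDerivAt_sliceEmb I (NormedSpace.exp z)).comp z h2
  have := DFunLike.congr_fun (h1.unique h3) w
  simp only [ContinuousLinearMap.comp_apply, sliceCLM_apply] at this
  rw [this]
  simp [mul_comm]

end Exponential

lemma rightSliceRegularOn_of {f : ℍ[ℝ] → ℍ[ℝ]} {U : Set ℍ[ℝ]} (hU : IsOpen U)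
    (h : ∀ I ∈ ImagUnits, ∀ z ∈ slice I U, DifferentiableAt ℝ f (sliceEmb I z) ∧
      fderiv ℝ f (sliceEmb I z) I = fderiv ℝ f (sliceEmb I z) 1 * I) :
    RightSliceRegularOn f U := by
  refine ⟨hU, fun x hx => ?_, fun I hI z hz => ?_⟩
  · obtain ⟨I, hI, z, rfl⟩ := exists_sliceEmb x
    exact (h I hI z hx).1
  · rw [(h I hI z hz).2, mul_assoc, ImagUnits.mul_self hI]
    simp

lemma RightSliceRegularOn.fderiv_sliceEmb {f : ℍ[ℝ] → ℍ[ℝ]} {U : Set ℍ[ℝ]}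
    (hf : RightSliceRegularOn f U) {I : ℍ[ℝ]} (hI : I ∈ ImagUnits) {z : ℂ} (hz : z ∈ slice I U)
    (w : ℂ) : fderiv ℝ f (sliceEmb I z) (sliceEmb I w) =
      fderiv ℝ f (sliceEmb I z) 1 * sliceEmb I w := by
  have h2 := hf.2.2 I hI z hz
  rw [smul_eq_zero_iff_right (by norm_num)] at h2
  have h3 := congrArg (· * I) h2
  simp only [add_mul, zero_mul, mul_assoc, ImagUnits.mul_self hI, mul_neg, mul_one] at h3
  rw [add_neg_eq_zero] at h3
  have e : ∀ r : ℝ, (r : ℍ[ℝ]) = r • 1 := fun r => by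
    simpa using Algebra.algebraMap_eq_smul_one (A := ℍ[ℝ]) r
  have e' : sliceEmb I w = w.re • 1 + w.im • I := by rw [sliceEmb, e]
  rw [e', map_add, map_smul, map_smul, ← h3, mul_add, mul_smul_comm, mul_smul_comm, mul_one]

lemma RightSliceRegularOn.union {f : ℍ[ℝ] → ℍ[ℝ]} {U W : Set ℍ[ℝ]}
    (hU : RightSliceRegularOn f U) (hW : RightSliceRegularOn f W) :
    RightSliceRegularOn f (U ∪ W) :=
  ⟨hU.1.union hW.1, fun x hx => hx.elim (hU.2.1 x) (hW.2.1 x),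
    fun I hI z hz => hz.elim (hU.2.2 I hI z) (hW.2.2 I hI z)⟩

lemma RightSliceRegularOn.congr {f g : ℍ[ℝ] → ℍ[ℝ]} {U : Set ℍ[ℝ]}
    (hf : RightSliceRegularOn f U) (h : ∀ x ∈ U, g x = f x) : RightSliceRegularOn g U := by
  have e : ∀ x ∈ U, g =ᶠ[𝓝 x] f := fun x hx => by
    filter_upwards [hf.1.mem_nhds hx] with y hy using h y hy
  refine ⟨hf.1, fun x hx => (hf.2.1 x hx).congr_of_eventuallyEq (e x hx), fun I hI z hz => ?_⟩
  rw [(e _ hz).fderiv_eq]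
  exact hf.2.2 I hI z hz

/-- Differentiation under the integral sign, with the derivative evaluated at vectors. -/
lemma exists_hasFDerivAt_integral_of_lip {X : Type*} [MeasurableSpace X] {ν : Measure X}
    {E G : Type*} [NormedAddCommGroup E] [NormedSpace ℝ E] [NormedAddCommGroup G] [NormedSpace ℝ G]
    [CompleteSpace G] {F : E → X → G} {x₀ : E} {F' : X → E →L[ℝ] G} {bound : X → ℝ} {s : Set E}
    (hs : s ∈ 𝓝 x₀) (hF_meas : ∀ᶠ x in 𝓝 x₀, AEStronglyMeasurable (F x) ν)
    (hF_int : Integrable (F x₀) ν) (hF'_meas : AEStronglyMeasurable F' ν)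
    (h_lip : ∀ a, ∀ x ∈ s, ∀ y ∈ s, ‖F x a - F y a‖ ≤ bound a * ‖x - y‖)
    (hb : ∀ a, 0 ≤ bound a) (bound_integrable : Integrable bound ν)
    (h_diff : ∀ a, HasFDerivAt (F · a) (F' a) x₀) :
    ∃ L : E →L[ℝ] G, HasFDerivAt (fun x => ∫ a, F x a ∂ν) L x₀ ∧
      ∀ v, Integrable (fun a => F' a v) ν ∧ L v = ∫ a, F' a v ∂ν := by
  obtain ⟨h1, h2⟩ := hasFDerivAt_integral_of_dominated_loc_of_lip (bound := bound) hs hF_meas hF_int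
    hF'_meas (.of_forall fun a => LipschitzOnWith.of_dist_le_mul fun x hx y hy => by
      rw [dist_eq_norm, dist_eq_norm, Real.coe_nnabs, abs_of_nonneg (hb a)]
      exact h_lip a x hx y hy) bound_integrable (.of_forall h_diff)
  exact ⟨_, h2, fun v => ⟨h1.apply_continuousLinearMap v, ContinuousLinearMap.integral_apply h1 v⟩⟩

/-- Differentiation of `s ↦ ∫ h(t) E(-ts)` under the integral sign. -/
lemma exists_hasFDerivAt_integral_mul_comp {A : Type*} [NormedRing A] [NormedAlgebra ℝ A]
    [CompleteSpace A] {ν : Measure ℝ} {h : ℝ → A} (hm : StronglyMeasurable h) {E : A → A}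
    (hE : ContDiff ℝ 1 E) {x₀ : A} {bound : ℝ → ℝ} {s : Set A}
    (hs : s ∈ 𝓝 x₀) (hF_int : Integrable (fun t => h t * E (-(t • x₀))) ν)
    (h_lip : ∀ t, ∀ x ∈ s, ∀ y ∈ s,
      ‖h t * E (-(t • x)) - h t * E (-(t • y))‖ ≤ bound t * ‖x - y‖)
    (hb : ∀ t, 0 ≤ bound t) (bound_integrable : Integrable bound ν) :
    ∃ L : A →L[ℝ] A, HasFDerivAt (fun x => ∫ t, h t * E (-(t • x)) ∂ν) L x₀ ∧
      ∀ v, Integrable (fun t => h t * ((-t) • fderiv ℝ E (-(t • x₀)) v)) ν ∧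
        L v = ∫ t, h t * ((-t) • fderiv ℝ E (-(t • x₀)) v) ∂ν := by
  refine exists_hasFDerivAt_integral_of_lip (F' := fun t =>
    (ContinuousLinearMap.mul ℝ A (h t)).comp ((-t) • fderiv ℝ E (-(t • x₀)))) hs
    (.of_forall fun x => ?_) hF_int ?_ h_lip hb bound_integrable fun t => ?_
  · have hc : Continuous fun t : ℝ => E (-(t • x)) := hE.continuous.comp (by fun_prop)
    exact hm.aestronglyMeasurable.mul hc.aestronglyMeasurable
  · have h1 : Continuous fun t : ℝ => (-t) • fderiv ℝ E (-(t • x₀)) :=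
      continuous_neg.smul ((hE.continuous_fderiv one_ne_zero).comp (by fun_prop))
    have h2 : StronglyMeasurable fun t => ContinuousLinearMap.mul ℝ A (h t) :=
      (ContinuousLinearMap.mul ℝ A).continuous.comp_stronglyMeasurable hm
    exact (ContinuousLinearMap.compL ℝ A A A).aestronglyMeasurable_comp₂
      h2.aestronglyMeasurable h1.aestronglyMeasurable
  · have h1 : HasFDerivAt (fun s : A => -(t • s)) (-(t • ContinuousLinearMap.id ℝ A)) x₀ :=
      ((hasFDerivAt_id x₀).const_smul t).neg
    have h2 := ((hE.differentiable one_ne_zero (-(t • x₀))).hasFDerivAt).comp x₀ h1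
    have h3 := (ContinuousLinearMap.mul ℝ A (h t)).hasFDerivAt.comp x₀ h2
    convert! h3 using 1
    refine ContinuousLinearMap.ext fun v => ?_
    simp

section Transform

variable {ν : Measure ℝ} {h : ℝ → ℍ[ℝ]} {C b : ℝ}

lemma integrable_mul_exp (hm : StronglyMeasurable h) (hC : ∀ t, ‖h t‖ ≤ C)
    (hb : Integrable (fun t => Real.exp (b * |t|)) ν) {s : ℍ[ℝ]} (hs : |s.re| ≤ b) :
    Integrable (fun t => h t * NormedSpace.exp (-(t • s))) ν := by
  have hc : Continuous fun t : ℝ => NormedSpace.exp (-(t • s)) :=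
    contDiff_exp_quaternion.continuous.comp (by fun_prop)
  refine (hb.const_mul C).mono' (hm.aestronglyMeasurable.mul hc.aestronglyMeasurable)
    (.of_forall fun t => ?_)
  rw [norm_mul, norm_exp_quaternion]
  gcongr
  · exact (norm_nonneg _).trans (hC 0)
  · exact hC t
  · simp only [Quaternion.re_neg, Quaternion.re_smul, smul_eq_mul]
    calc -(t * s.re) ≤ |t * s.re| := neg_le_abs _
      _ = |s.re| * |t| := by rw [abs_mul, mul_comm]
      _ ≤ b * |t| := by gcongr

lemma rightSliceRegularOn_integral_mul_exp (hm : StronglyMeasurable h) (hC : ∀ t, ‖h t‖ ≤ C)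
    (hb : Integrable (fun t => Real.exp (b * |t|)) ν) :
    RightSliceRegularOn (fun s => ∫ t, h t * NormedSpace.exp (-(t • s)) ∂ν) {s | |s.re| < b} := by
  have hC0 : 0 ≤ C := (norm_nonneg _).trans (hC 0)
  have hopen : IsOpen {s : ℍ[ℝ] | |s.re| < b} :=
    isOpen_lt (continuous_abs.comp Quaternion.continuous_re) continuous_const
  have key : ∀ s : ℍ[ℝ], |s.re| < b → ∃ L : ℍ[ℝ] →L[ℝ] ℍ[ℝ],
      HasFDerivAt (fun s => ∫ t, h t * NormedSpace.exp (-(t • s)) ∂ν) L s ∧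
      ∀ v, Integrable (fun t => h t * ((-t) • fderiv ℝ NormedSpace.exp (-(t • s)) v)) ν ∧
        L v = ∫ t, h t * ((-t) • fderiv ℝ NormedSpace.exp (-(t • s)) v) ∂ν := by
    intro s hs
    -- Differentiation in s brings down a factor |t|; the smaller strip |Re| < b' leaves the room b
    -- - b' in the exponent to absorb it.
    obtain ⟨b', hb1, hb2⟩ := exists_between hs
    have hopen' : IsOpen {s : ℍ[ℝ] | |s.re| < b'} :=
      isOpen_lt (continuous_abs.comp Quaternion.continuous_re) continuous_const
    have hbb : 0 < b - b' := by linarith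
    refine exists_hasFDerivAt_integral_mul_comp hm contDiff_exp_quaternion
      (s := {s : ℍ[ℝ] | |s.re| < b'})
      (bound := fun t => C * (b - b')⁻¹ * Real.exp (b * |t|)) (hopen'.mem_nhds hb1)
      (integrable_mul_exp hm hC hb hs.le) (fun t x hx y hy => ?_) (fun t => by positivity)
      (hb.const_mul _)
    rw [← mul_sub, norm_mul]
    have hre : ∀ x : ℍ[ℝ], |x.re| < b' → (-(t • x)).re ≤ b' * |t| := fun x hx => by
      simp only [Quaternion.re_neg, Quaternion.re_smul, smul_eq_mul]
      calc -(t * x.re) ≤ |t * x.re| := neg_le_abs _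
        _ = |x.re| * |t| := by rw [abs_mul, mul_comm]
        _ ≤ b' * |t| := by gcongr
    have h1 := norm_exp_sub_exp_le (hre x hx) (hre y hy)
    have h2 : ‖-(t • x) - -(t • y)‖ = |t| * ‖x - y‖ := by
      rw [neg_sub_neg, ← smul_sub, norm_smul, Real.norm_eq_abs, norm_sub_rev]
    rw [h2] at h1
    have h3 : Real.exp (b' * |t|) * |t| ≤ (b - b')⁻¹ * Real.exp (b * |t|) := by
      have h4 : b * |t| = b' * |t| + (b - b') * |t| := by ring
      have h5 : (b - b') * |t| ≤ Real.exp ((b - b') * |t|) :=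
        (by linarith : (b - b') * |t| ≤ (b - b') * |t| + 1).trans (Real.add_one_le_exp _)
      rw [h4, Real.exp_add, mul_left_comm]
      gcongr
      rw [inv_mul_eq_div, le_div_iff₀ hbb, mul_comm]
      exact h5
    calc _ ≤ C * (Real.exp (b' * |t|) * (|t| * ‖x - y‖)) := by gcongr; exact hC t
      _ = C * (Real.exp (b' * |t|) * |t|) * ‖x - y‖ := by ring
      _ ≤ C * ((b - b')⁻¹ * Real.exp (b * |t|)) * ‖x - y‖ := by gcongr
      _ = _ := by ring
  refine rightSliceRegularOn_of hopen fun I hI z hz => ?_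
  obtain ⟨L, hd, hL⟩ := key _ hz
  refine ⟨hd.differentiableAt, ?_⟩
  rw [hd.fderiv, (hL I).2, (hL 1).2, ← rightMulCLM_apply,
    ← (rightMulCLM I).integral_comp_comm (hL 1).1]
  refine integral_congr_ae (.of_forall fun t => ?_)
  have e : -(t • sliceEmb I z) = sliceEmb I (-(t • z)) := by
    rw [sliceEmb_neg, sliceEmb_real_smul]
  have h1 := fderiv_exp_sliceEmb hI (-(t • z)) Complex.I
  have h2 := fderiv_exp_sliceEmb hI (-(t • z)) 1
  rw [sliceEmb_I, sliceEmb_mul hI, sliceEmb_I] at h1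
  rw [sliceEmb_one, mul_one] at h2
  simp only [rightMulCLM_apply, e, h1, h2]
  simp [mul_assoc]

end Transform

/-! ### Removable singularities of slice regular functions -/

/-- A second order Taylor estimate for bounded holomorphic functions. -/
lemma norm_sub_sub_mul_deriv_le {c : ℂ → ℂ} {ρ M : ℝ}
    (hc : DifferentiableOn ℂ c (Metric.ball 0 ρ)) (hM : ∀ z ∈ Metric.ball (0 : ℂ) ρ, ‖c z‖ ≤ M)
    {w : ℂ} (hw : w ∈ Metric.ball (0 : ℂ) ρ) :
    ‖c w - c 0 - w * deriv c 0‖ ≤ 4 * M / ρ / ρ * ‖w‖ ^ 2 := by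
  have hρ : 0 < ρ := (dist_nonneg.trans_lt hw)
  have h0 : (0 : ℂ) ∈ Metric.ball (0 : ℂ) ρ := Metric.mem_ball_self hρ
  have hnhds : Metric.ball (0 : ℂ) ρ ∈ 𝓝 (0 : ℂ) := Metric.ball_mem_nhds _ hρ
  -- Schwarz's lemma twice: the values of c lie within 2M of c(0), so the difference quotient is at
  -- most 2M/ρ; its values lie within 4M/ρ of c'(0), so the second one is at most 4M/ρ².
  have h1 : ∀ z ∈ Metric.ball (0 : ℂ) ρ, ‖dslope c 0 z‖ ≤ 2 * M / ρ := fun z hz => by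
    refine Complex.norm_dslope_le_div_of_mapsTo_ball hc (fun y hy => ?_) hz
    rw [mem_closedBall_iff_norm]
    linarith [norm_sub_le (c y) (c 0), hM y hy, hM 0 h0]
  have h2 : DifferentiableOn ℂ (dslope c 0) (Metric.ball 0 ρ) :=
    (Complex.differentiableOn_dslope hnhds).2 hc
  have h3 : ‖dslope (dslope c 0) 0 w‖ ≤ 4 * M / ρ / ρ := by
    refine Complex.norm_dslope_le_div_of_mapsTo_ball h2 (fun y hy => ?_) hw
    rw [mem_closedBall_iff_norm]
    have e : 4 * M / ρ = 2 * M / ρ + 2 * M / ρ := by ring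
    rw [e]
    linarith [norm_sub_le (dslope c 0 y) (dslope c 0 0), h1 y hy, h1 0 h0]
  have e1 := sub_smul_dslope c 0 w
  have e2 := sub_smul_dslope (dslope c 0) 0 w
  rw [sub_zero, smul_eq_mul] at e1 e2
  rw [dslope_same] at e2
  have e : c w - c 0 - w * deriv c 0 = w ^ 2 * dslope (dslope c 0) 0 w := by
    rw [← e1, sq, mul_assoc, e2]
    ring
  rw [e, norm_mul, norm_pow, mul_comm]
  gcongr

lemma norm_complexify_rightMul_le {I : ℍ[ℝ]} (hI : I ∈ ImagUnits) (φ : ℍ[ℝ] →L[ℝ] ℝ) (v : ℍ[ℝ]) :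
    ‖complexify (rightMulCLM I) φ v‖ ≤ 2 * ‖φ‖ * ‖v‖ := by
  rw [complexify_apply, rightMulCLM_apply]
  refine (norm_sub_le _ _).trans ?_
  rw [norm_mul, Complex.norm_I, one_mul, Complex.norm_real, Complex.norm_real]
  have h1 := φ.le_opNorm v
  have h2 := φ.le_opNorm (v * I)
  rw [norm_mul, hI.2, mul_one] at h2
  linarith

/-- A slice regular function on a punctured ball that is continuous at the centre is real
differentiable there, and its derivative is the left multiplication by a quaternion. -/
lemma exists_hasFDerivAt_of_punctured {g : ℍ[ℝ] → ℍ[ℝ]} {U : Set ℍ[ℝ]} (hU : insert 0 U ∈ 𝓝 0)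
    (hg : RightSliceRegularOn g U) (hc : ContinuousAt g 0) :
    ∃ a, HasFDerivAt g (ContinuousLinearMap.mul ℝ ℍ[ℝ] a) 0 := by
  set M := ‖g 0‖ + 1 with hMdef
  have hM0 : 0 ≤ M := by positivity
  obtain ⟨ρ, hρ, hball⟩ := Metric.mem_nhds_iff.1 (Filter.inter_mem hU
    (hc.norm.eventually (gt_mem_nhds (show ‖g 0‖ < M by simp [hMdef]))))
  have hmem : ∀ I ∈ ImagUnits, ∀ z ∈ Metric.ball (0 : ℂ) ρ,
      sliceEmb I z ∈ Metric.ball (0 : ℍ[ℝ]) ρ := fun I hI z hz => by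
    rw [mem_ball_zero_iff] at hz ⊢
    rwa [norm_sliceEmb hI]
  -- the complexified components on the slices
  set c : ℍ[ℝ] → (ℍ[ℝ] →L[ℝ] ℝ) → ℂ → ℂ := fun I φ w =>
    complexify (rightMulCLM I) φ (g (sliceEmb I w)) with hcdef
  have hcb : ∀ I ∈ ImagUnits, ∀ φ, ∀ z ∈ Metric.ball (0 : ℂ) ρ, ‖c I φ z‖ ≤ 2 * ‖φ‖ * M :=
    fun I hI φ z hz => by
      refine (norm_complexify_rightMul_le hI φ _).trans ?_
      gcongr
      exact (hball (hmem I hI z hz)).2.le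
  have hcd : ∀ I ∈ ImagUnits, ∀ φ, DifferentiableOn ℂ (c I φ) (Metric.ball 0 ρ) := by
    intro I hI φ
    -- On each slice this is Riemann's removable singularity theorem.
    rw [← Complex.differentiableOn_compl_singleton_and_continuousAt_iff
      (Metric.ball_mem_nhds (0 : ℂ) hρ)]
    constructor
    · rintro z ⟨hz, hz0⟩
      have hzU : z ∈ slice I U := by
        refine (hball (hmem I hI z hz)).1.resolve_left fun h => hz0 ?_
        rw [← norm_eq_zero, norm_sliceEmb hI, norm_eq_zero] at h
        exact h
      exact ((hg.jDiffAt hI hzU).complexify (rightMulCLM_sq hI) φ).differentiableWithinAt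
    · refine (complexify (rightMulCLM I) φ).continuous.continuousAt.comp ?_
      refine ContinuousAt.comp (f := sliceEmb I) ?_ (continuous_sliceEmb I).continuousAt
      rwa [sliceEmb_zero]
  have hcd0 : ∀ I ∈ ImagUnits, ∀ φ, HasDerivAt (fun x : ℝ => c I φ x) (deriv (c I φ) 0) 0 :=
    fun I hI φ => by
      have := ((hcd I hI φ).differentiableAt (Metric.ball_mem_nhds _ hρ)).hasDerivAt
      exact HasDerivAt.comp_ofReal (z := 0) (by simpa using this)
  -- The real axis belongs to all slices, so the derivative along it determines the slice
  -- derivatives at 0 for all I at once.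
  obtain ⟨a, ha⟩ : ∃ a, HasDerivAt (fun x : ℝ => g (x : ℍ[ℝ])) a 0 := by
    obtain ⟨I, hI⟩ := exists_imagUnit
    set b := stdOrthonormalBasis ℝ ℍ[ℝ]
    refine ⟨∑ i, (deriv (c I (innerSL ℝ (b i))) 0).re • b i, ?_⟩
    have h1 : ∀ i, HasDerivAt (fun x : ℝ => inner ℝ (b i) (g (x : ℍ[ℝ])) • b i)
        ((deriv (c I (innerSL ℝ (b i))) 0).re • b i) 0 := fun i => by
      have h2 := (Complex.reCLM.hasFDerivAt.comp_hasDerivAt (0 : ℝ)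
        (hcd0 I hI (innerSL ℝ (b i)))).smul_const (b i)
      refine h2.congr_of_eventuallyEq (.of_forall fun x => ?_)
      simp only [hcdef, Function.comp, Complex.reCLM_apply, complexify_re, sliceEmb_ofReal]
      rfl
    have h3 := HasDerivAt.fun_sum (u := Finset.univ) fun i _ => h1 i
    refine h3.congr_of_eventuallyEq (.of_forall fun x => ?_)
    exact (b.sum_repr' (g x)).symm
  have hderiv : ∀ I ∈ ImagUnits, ∀ φ, deriv (c I φ) 0 = complexify (rightMulCLM I) φ a := by
    intro I hI φ
    refine (hcd0 I hI φ).unique ?_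
    have := (complexify (rightMulCLM I) φ).hasFDerivAt.comp_hasDerivAt (0 : ℝ) ha
    refine this.congr_of_eventuallyEq (.of_forall fun x => ?_)
    simp [hcdef, sliceEmb_ofReal]
  refine ⟨a, ?_⟩
  -- The Taylor bound does not depend on I. This uniformity turns differentiability on every slice
  -- into real differentiability on ℍ.
  have hO : (fun p => g p - g 0 - a * p) =O[𝓝 0] fun p => ‖p - 0‖ ^ 2 := by
    refine Asymptotics.IsBigO.of_bound (4 * (2 * M) / ρ / ρ) ?_
    filter_upwards [Metric.ball_mem_nhds (0 : ℍ[ℝ]) hρ] with p hp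
    obtain ⟨I, hI, w, rfl⟩ := exists_sliceEmb p
    rw [sub_zero, norm_pow, norm_norm, norm_sliceEmb hI]
    have hw : w ∈ Metric.ball (0 : ℂ) ρ := by
      rw [mem_ball_zero_iff] at hp ⊢
      rwa [norm_sliceEmb hI] at hp
    refine NormedSpace.norm_le_dual_bound ℝ _ (by positivity) fun φ => ?_
    have h1 := norm_sub_sub_mul_deriv_le (hcd I hI φ) (hcb I hI φ) hw
    rw [hderiv I hI φ, ← complexify_jsmul (rightMulCLM_sq hI), jsmul_rightMul] at h1
    simp only [hcdef, sliceEmb_zero] at h1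
    rw [← map_sub, ← map_sub] at h1
    have h2 := (Complex.abs_re_le_norm _).trans h1
    rw [complexify_re] at h2
    rw [Real.norm_eq_abs]
    refine h2.trans (le_of_eq ?_)
    ring
  have h1 := Asymptotics.IsBigO.hasFDerivAt (𝕜 := ℝ) hO one_lt_two
  have h2 := ((h1.add ((ContinuousLinearMap.mul ℝ ℍ[ℝ] a).hasFDerivAt)).const_add (g 0))
  rw [zero_add] at h2
  refine h2.congr_of_eventuallyEq (.of_forall fun p => ?_)
  simp

section Transport

variable {f : ℍ[ℝ] → ℍ[ℝ]} {U : Set ℍ[ℝ]} {L : ℍ[ℝ]} {α : ℝ}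

lemma invTransport_zero : invTransport f L α 0 = L := by simp [invTransport]

lemma invTransport_of_ne_zero {p : ℍ[ℝ]} (hp : p ≠ 0) :
    invTransport f L α p = f (p⁻¹ + (α : ℍ[ℝ])) := by simp [invTransport, hp]

lemma isOpen_setOf_inv_add_mem (hU : IsOpen U) (α : ℝ) :
    IsOpen {p : ℍ[ℝ] | p ≠ 0 ∧ p⁻¹ + (α : ℍ[ℝ]) ∈ U} := by
  have h : ContinuousOn (fun p : ℍ[ℝ] => p⁻¹ + (α : ℍ[ℝ])) {0}ᶜ :=
    continuousOn_inv₀.add continuousOn_const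
  exact h.isOpen_inter_preimage isOpen_compl_singleton hU

lemma tendsto_inv_add_cobounded (α : ℝ) :
    Tendsto (fun p : ℍ[ℝ] => p⁻¹ + (α : ℍ[ℝ])) (𝓝[≠] 0) (Bornology.cobounded ℍ[ℝ]) :=
  (tendsto_add_const_cobounded (α : ℍ[ℝ])).comp tendsto_inv₀_nhdsNE_zero

/-- The map p ↦ p⁻¹ + α has real coefficients, so it preserves each slice and is holomorphic there.
-/
lemma RightSliceRegularOn.comp_inv_add (hf : RightSliceRegularOn f U) :
    RightSliceRegularOn (invTransport f L α) {p | p ≠ 0 ∧ p⁻¹ + (α : ℍ[ℝ]) ∈ U} := by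
  refine RightSliceRegularOn.congr (f := fun p => f (p⁻¹ + (α : ℍ[ℝ]))) ?_
    fun p hp => invTransport_of_ne_zero hp.1
  refine rightSliceRegularOn_of (isOpen_setOf_inv_add_mem hf.1 α) fun I hI z hz => ?_
  obtain ⟨hz0, hzU⟩ : sliceEmb I z ≠ 0 ∧ (sliceEmb I z)⁻¹ + (α : ℍ[ℝ]) ∈ U := hz
  have e : (sliceEmb I z)⁻¹ + (α : ℍ[ℝ]) = sliceEmb I (z⁻¹ + α) := by
    rw [sliceEmb_add, sliceEmb_inv hI, sliceEmb_ofReal]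
  have h1 : HasFDerivAt (fun p : ℍ[ℝ] => p⁻¹ + (α : ℍ[ℝ])) _ (sliceEmb I z) :=
    (hasFDerivAt_inv' (𝕜 := ℝ) hz0).add_const _
  have h2 := HasFDerivAt.comp (g := f) (sliceEmb I z) (hf.2.1 _ hzU).hasFDerivAt h1
  have h3 : ∀ w, fderiv ℝ (fun p => f (p⁻¹ + (α : ℍ[ℝ]))) (sliceEmb I z) (sliceEmb I w) =
      fderiv ℝ f (sliceEmb I (z⁻¹ + α)) 1 * -(sliceEmb I (z⁻¹ * w * z⁻¹)) := fun w => by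
    have h4 : HasFDerivAt (fun p => f (p⁻¹ + (α : ℍ[ℝ]))) _ (sliceEmb I z) := h2
    have hzU' : z⁻¹ + α ∈ slice I U := by
      change sliceEmb I (z⁻¹ + α) ∈ U
      rwa [← e]
    rw [h4.fderiv, e]
    simp only [ContinuousLinearMap.comp_apply, neg_apply, ContinuousLinearMap.mulLeftRight_apply]
    rw [← sliceEmb_inv hI, ← sliceEmb_mul hI, ← sliceEmb_mul hI, ← sliceEmb_neg,
      hf.fderiv_sliceEmb hI hzU']
  refine ⟨h2.differentiableAt, ?_⟩
  have h5 := h3 Complex.I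
  have h6 := h3 1
  rw [sliceEmb_I] at h5
  rw [sliceEmb_one] at h6
  have h7 : sliceEmb I (z⁻¹ * Complex.I * z⁻¹) = sliceEmb I (z⁻¹ * 1 * z⁻¹) * I := by
    rw [show z⁻¹ * Complex.I * z⁻¹ = z⁻¹ * 1 * z⁻¹ * Complex.I by ring, sliceEmb_mul hI _ Complex.I,
      sliceEmb_I]
  rw [h5, h6, h7, mul_assoc _ _ I, neg_mul]

/-- Only p = 0, the image of ∞, is new. It is a removable singularity, because f has a limit at
infinity. -/
lemma RightSliceRegularOn.invTransport (hf : RightSliceRegularOn f U)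
    (hU : U ∈ Bornology.cobounded ℍ[ℝ]) (hL : Tendsto f (Bornology.cobounded ℍ[ℝ]) (𝓝 L)) :
    RightSliceRegularOn (invTransport f L α) {p | p = 0 ∨ p⁻¹ + (α : ℍ[ℝ]) ∈ U} := by
  have h1 : RightSliceRegularOn (_root_.invTransport f L α) {p | p ≠ 0 ∧ p⁻¹ + (α : ℍ[ℝ]) ∈ U} :=
    hf.comp_inv_add
  have hset : {p : ℍ[ℝ] | p = 0 ∨ p⁻¹ + (α : ℍ[ℝ]) ∈ U} =
      insert 0 {p : ℍ[ℝ] | p ≠ 0 ∧ p⁻¹ + (α : ℍ[ℝ]) ∈ U} := by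
    ext p
    simp only [Set.mem_ofPred_eq, Set.mem_insert_iff]
    tauto
  have hn : insert 0 {p : ℍ[ℝ] | p ≠ 0 ∧ p⁻¹ + (α : ℍ[ℝ]) ∈ U} ∈ 𝓝 (0 : ℍ[ℝ]) := by
    rw [insert_mem_nhds_iff]
    filter_upwards [self_mem_nhdsWithin, (tendsto_inv_add_cobounded α).eventually_mem hU]
      with p hp hp' using ⟨hp, hp'⟩
  have hc : ContinuousAt (_root_.invTransport f L α) 0 := by
    rw [continuousAt_iff_punctured_nhds, invTransport_zero]
    refine (hL.comp (tendsto_inv_add_cobounded α)).congr' ?_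
    filter_upwards [self_mem_nhdsWithin] with p hp
    exact (invTransport_of_ne_zero hp).symm
  have hopen : IsOpen {p : ℍ[ℝ] | p = 0 ∨ p⁻¹ + (α : ℍ[ℝ]) ∈ U} := by
    rw [hset]
    refine isOpen_iff_mem_nhds.2 fun p hp => ?_
    rcases hp with rfl | hp
    · exact hn
    · exact Filter.mem_of_superset (h1.1.mem_nhds hp) (Set.subset_insert _ _)
  obtain ⟨a, ha⟩ := exists_hasFDerivAt_of_punctured hn h1 hc
  refine ⟨hopen, fun p hp => ?_, fun I hI z hz => ?_⟩
  · by_cases h0 : p = 0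
    · rw [h0]
      exact ha.differentiableAt
    · exact h1.2.1 p ⟨h0, hp.resolve_left h0⟩
  · by_cases h0 : sliceEmb I z = 0
    · rw [h0, ha.fderiv]
      simp [mul_assoc, ImagUnits.mul_self hI]
    · exact h1.2.2 I hI z ⟨h0, hz.resolve_left h0⟩

end Transport

/-! ### Strongly continuous groups and the resolvents of their generators -/

section Generator

set_option linter.unusedSectionVars false

variable {V : Type*} [NormedAddCommGroup V] [NormedSpace ℝ V]
  [Module ℍ[ℝ] V] [IsScalarTower ℝ ℍ[ℝ] V] [IsBoundedSMul ℍ[ℝ] V]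
  [Module ℍ[ℝ]ᵐᵒᵖ V] [IsScalarTower ℝ ℍ[ℝ]ᵐᵒᵖ V] [IsBoundedSMul ℍ[ℝ]ᵐᵒᵖ V]
  [SMulCommClass ℍ[ℝ]ᵐᵒᵖ ℍ[ℝ] V]

omit [Module ℍ[ℝ] V] [IsScalarTower ℝ ℍ[ℝ] V] [IsBoundedSMul ℍ[ℝ] V]
  [IsBoundedSMul ℍ[ℝ]ᵐᵒᵖ V] [SMulCommClass ℍ[ℝ]ᵐᵒᵖ ℍ[ℝ] V]

lemma rightLinear_map_real_smul (A : V →L[ℍ[ℝ]ᵐᵒᵖ] V) (r : ℝ) (v : V) : A (r • v) = r • A v :=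
  map_real_smul A A.continuous r v

lemma rightLinear_mul_apply (A B : V →L[ℍ[ℝ]ᵐᵒᵖ] V) (v : V) : (A * B) v = A (B v) := rfl

/-- A right linear operator as a real linear operator. -/
noncomputable def toRealCLM (A : V →L[ℍ[ℝ]ᵐᵒᵖ] V) : V →L[ℝ] V := A.restrictScalars ℝ

lemma toRealCLM_apply (A : V →L[ℍ[ℝ]ᵐᵒᵖ] V) (v : V) : toRealCLM A v = A v := rfl

variable {T : V →ₗ.[ℍ[ℝ]ᵐᵒᵖ] V} {α : ℝ} {A : V →L[ℍ[ℝ]ᵐᵒᵖ] V}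

lemma graph_real_smul_mem {u w : V} (h : (u, w) ∈ T.graph) (r : ℝ) : (r • u, r • w) ∈ T.graph := by
  have := T.graph.smul_mem (r • (1 : ℍ[ℝ]ᵐᵒᵖ)) h
  simpa using this

lemma graph_comb_mem {u w u' w' : V} (h : (u, w) ∈ T.graph) (h' : (u', w') ∈ T.graph) (r : ℝ) :
    (u + r • u', w + r • w') ∈ T.graph := T.graph.add_mem h (graph_real_smul_mem h' r)

lemma IsRealResolvent.mem_graph (hA : IsRealResolvent T α A) (v : V) :
    (A v, v + α • A v) ∈ T.graph := (hA (A v) v).1 rfl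

/-- For real α the pencil is (T - α)², with inverse A². -/
lemma IsRealResolvent.mem_sResolventSet (hA : IsRealResolvent T α A) :
    (α : ℍ[ℝ]) ∈ sResolventSet T := by
  refine ⟨A * A, fun u w => ⟨?_, ?_⟩⟩
  · rintro rfl
    refine ⟨A w + α • A (A w), _, hA.mem_graph (A w),
      graph_comb_mem (hA.mem_graph w) (hA.mem_graph (A w)) α, ?_⟩
    simp only [rightLinear_mul_apply, Quaternion.re_coe, Quaternion.norm_coe, sq_abs,
      Real.norm_eq_abs]
    module
  · rintro ⟨u₁, u₂, h1, h2, rfl⟩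
    have e1 : A (u₁ - α • u) = u := (hA _ _).2 (by simpa using h1)
    have e2 : A (u₂ - α • u₁ - α • (u₁ - α • u)) = u₁ - α • u := (hA _ _).2 (by
      have := graph_comb_mem h2 h1 (-α)
      convert! this using 2 <;> module)
    rw [rightLinear_mul_apply, show u₂ - (2 * (α : ℍ[ℝ]).re) • u₁ + (‖(α : ℍ[ℝ])‖ ^ 2) • u =
      u₂ - α • u₁ - α • (u₁ - α • u) by
        simp only [Quaternion.re_coe, Quaternion.norm_coe, sq_abs, Real.norm_eq_abs]
        module, e2, e1]

/-- The existence of one real resolvent yields the resolvents at all real points of the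
S-resolvent set. -/
lemma exists_isRealResolvent {α₀ : ℝ} {A₀ : V →L[ℍ[ℝ]ᵐᵒᵖ] V} (hA₀ : IsRealResolvent T α₀ A₀)
    (hα : (α : ℍ[ℝ]) ∈ sResolventSet T) : ∃ A : V →L[ℍ[ℝ]ᵐᵒᵖ] V, IsRealResolvent T α A := by
  obtain ⟨Q, hQ⟩ := hα
  set d := α - α₀ with hd
  have key : ∀ w, ∃ x x₁ x₂ : V, (x, x₁) ∈ T.graph ∧ (x₁, x₂) ∈ T.graph ∧
      w = x₂ - (2 * α) • x₁ + α ^ 2 • x ∧ Q w = x := fun w => by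
    obtain ⟨x₁, x₂, h1, h2, h3⟩ := (hQ (Q w) w).1 rfl
    refine ⟨Q w, x₁, x₂, h1, h2, ?_, rfl⟩
    simpa using h3
  -- The inverse of T - α should be (T - α)Q with Q = (T - α)⁻². With x = Qw, the factorization (T -
  -- α)² - d² = (T - α₀)(T - α - d) gives (T - α)x = A₀(w - d²x) + dx, which is visibly bounded in
  -- w.
  have hval : ∀ w, (A₀ + d • Q - d ^ 2 • (A₀ * Q)) w ∈ {u | (u, w + α • u) ∈ T.graph} := by
    intro w
    obtain ⟨x, x₁, x₂, h1, h2, h3, h4⟩ := key w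
    have e : A₀ (w - d ^ 2 • x) = x₁ - (α + d) • x := (hA₀ _ _).2 (by
      have := graph_comb_mem h2 h1 (-(α + d))
      convert! this using 2
      · module
      · rw [h3, hd]; module)
    have e2 : (A₀ + d • Q - d ^ 2 • (A₀ * Q)) w = x₁ - α • x := by
      simp only [sub_apply, add_apply, smul_apply,
        rightLinear_mul_apply, h4]
      rw [map_sub, rightLinear_map_real_smul] at e
      rw [show A₀ w + d • x - d ^ 2 • A₀ x = (A₀ w - d ^ 2 • A₀ x) + d • x by module, e]
      module
    rw [e2]
    have := graph_comb_mem h2 h1 (-α)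
    change (x₁ - α • x, _) ∈ T.graph
    convert! this using 2
    · module
    · rw [h3]; module
  refine ⟨A₀ + d • Q - d ^ 2 • (A₀ * Q), fun u w => ⟨?_, fun h => ?_⟩⟩
  · rintro rfl
    exact hval w
  · set u' := (A₀ + d • Q - d ^ 2 • (A₀ * Q)) w
    have h1 := graph_comb_mem (hval w) h (-1)
    have h2 : (u' - u, α • (u' - u)) ∈ T.graph := by
      convert! h1 using 2 <;> module
    -- The difference lies in the kernel of T - α, hence in that of the pencil, which is trivial.
    have h3 : Q 0 = u' - u := (hQ _ _).2 ⟨_, _, h2, graph_real_smul_mem h2 α, by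
      simp only [Quaternion.re_coe, Quaternion.norm_coe, sq_abs, Real.norm_eq_abs]
      module⟩
    rw [map_zero] at h3
    exact (sub_eq_zero.1 h3.symm)

variable {Z : ℝ → V →L[ℍ[ℝ]ᵐᵒᵖ] V}

lemma IsStronglyContinuousGroup.comm (hZ : IsStronglyContinuousGroup Z) (s t : ℝ) (v : V) :
    Z s (Z t v) = Z t (Z s v) := by rw [← hZ.2.1, ← hZ.2.1, add_comm]

lemma IsGenerator.map_mem_graph (hZ : IsStronglyContinuousGroup Z) (hT : IsGenerator Z T) {u w : V}
    (h : (u, w) ∈ T.graph) (t : ℝ) : (Z t u, Z t w) ∈ T.graph := by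
  rw [hT] at h ⊢
  refine (((Z t).continuous.tendsto w).comp h).congr fun r => ?_
  simp only [Function.comp]
  rw [rightLinear_map_real_smul, map_sub, hZ.comm t r]

/-- The generator only provides right derivatives. Since t ↦ Z t w is continuous, the fundamental
theorem for right derivatives writes Z t u as an integral started at t - 1, and the integral is
differentiable from both sides. -/
lemma IsGenerator.hasDerivAt [CompleteSpace V] (hZ : IsStronglyContinuousGroup Z)
    (hT : IsGenerator Z T) {u w : V} (h : (u, w) ∈ T.graph) (t : ℝ) :
    HasDerivAt (fun t => Z t u) (Z t w) t := by
  have hr : ∀ t, HasDerivWithinAt (fun t => Z t u) (Z t w) (Set.Ioi t) t := fun t => by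
    have h1 := (hT _ _).1 (hT.map_mem_graph hZ h t)
    rw [hasDerivWithinAt_iff_tendsto_slope' (by simp)]
    have h2 : Tendsto (fun x => x - t) (𝓝[>] t) (𝓝[>] 0) := by
      refine tendsto_nhdsWithin_iff.2 ⟨?_, ?_⟩
      · have : Tendsto (fun x => x - t) (𝓝 t) (𝓝 (t - t)) := tendsto_id.sub_const t
        rw [sub_self] at this
        exact this.mono_left nhdsWithin_le_nhds
      · filter_upwards [self_mem_nhdsWithin] with x hx using sub_pos.2 (Set.mem_Ioi.1 hx)
    refine (h1.comp h2).congr fun x => ?_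
    simp only [Function.comp, slope, vsub_eq_sub]
    rw [← hZ.2.1, sub_add_cancel]
  have hint : ∀ x, 0 ≤ x → ∫ τ in (t - 1)..(t - 1 + x), Z τ w = Z (t - 1 + x) u - Z (t - 1) u :=
    fun x hx => intervalIntegral.integral_eq_sub_of_hasDeriv_right_of_le (by linarith)
      (hZ.2.2 u).continuousOn (fun y _ => hr y) ((hZ.2.2 w).intervalIntegrable _ _)
  have h1 : HasDerivAt (fun x => Z (t - 1) u + ∫ τ in (t - 1)..x, Z τ w) (Z t w) t :=
    (intervalIntegral.integral_hasDerivAt_right ((hZ.2.2 w).intervalIntegrable _ _)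
      ((hZ.2.2 w).stronglyMeasurableAtFilter _ _) (hZ.2.2 w).continuousAt).const_add _
  refine h1.congr_of_eventuallyEq ?_
  filter_upwards [lt_mem_nhds (show t - 1 < t by linarith)] with x hx
  have := hint (x - (t - 1)) (by linarith)
  rw [add_sub_cancel] at this
  rw [this]
  abel

lemma IsRealResolvent.comm (hZ : IsStronglyContinuousGroup Z) (hT : IsGenerator Z T)
    (hA : IsRealResolvent T α A) (t : ℝ) (v : V) : A (Z t v) = Z t (A v) := by
  rw [hA]
  have := hT.map_mem_graph hZ (hA.mem_graph v) t
  rwa [map_add, rightLinear_map_real_smul] at this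

end Generator

/-! ### Laplace transforms of groups -/

lemma integrable_exp_neg_mul_abs {c : ℝ} (hc : 0 < c) :
    Integrable fun τ : ℝ => Real.exp (-(c * |τ|)) := by
  rw [← integrableOn_univ, ← Set.Iic_union_Ioi (a := (0 : ℝ))]
  refine IntegrableOn.union ?_ ?_
  · refine (integrableOn_exp_mul_Iic hc 0).congr_fun (fun τ hτ => ?_) measurableSet_Iic
    simp only
    rw [abs_of_nonpos (Set.mem_Iic.1 hτ)]
    ring_nf
  · refine (integrableOn_exp_mul_Ioi (neg_neg_of_pos hc) 0).congr_fun (fun τ hτ => ?_)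
      measurableSet_Ioi
    simp only
    rw [abs_of_pos (Set.mem_Ioi.1 hτ)]
    ring_nf

/-- The kernel `κ` with `∫ κ(τ) e^{-τ x} dτ = (z - x)⁻¹` for `|Re x| < |Re z|`. -/
noncomputable def laplaceKernel (z : ℂ) (τ : ℝ) : ℂ :=
  open Classical in
  if 0 < z.re then (if τ ≤ 0 then Complex.exp (τ * z) else 0)
  else (if τ ≤ 0 then 0 else -Complex.exp (τ * z))

lemma measurable_laplaceKernel : Measurable fun p : ℂ × ℝ => laplaceKernel p.1 p.2 := by
  have h1 : MeasurableSet {p : ℂ × ℝ | 0 < p.1.re} :=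
    measurableSet_lt measurable_const (Complex.measurable_re.comp measurable_fst)
  have h2 : MeasurableSet {p : ℂ × ℝ | p.2 ≤ 0} :=
    measurableSet_le measurable_snd measurable_const
  have h3 : Measurable fun p : ℂ × ℝ => Complex.exp (p.2 * p.1) := by fun_prop
  exact Measurable.ite h1 (h3.ite h2 measurable_const) (measurable_const.ite h2 h3.neg)

lemma norm_laplaceKernel_le {a : ℝ} {z : ℂ} (hz : a ≤ |z.re|) (τ : ℝ) :
    ‖laplaceKernel z τ‖ ≤ Real.exp (-(a * |τ|)) := by
  have h0 := (Real.exp_pos (-(a * |τ|))).le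
  unfold laplaceKernel
  split_ifs with h1 h2 h2
  · rw [abs_of_pos h1] at hz
    rw [Complex.norm_exp, abs_of_nonpos h2]
    gcongr
    simp
    nlinarith
  · simpa using h0
  · simpa using h0
  · rw [abs_of_nonpos (not_lt.1 h1)] at hz
    rw [norm_neg, Complex.norm_exp, abs_of_pos (not_le.1 h2)]
    gcongr
    simp
    nlinarith [not_le.1 h2]

section JSmul

variable {E : Type*} [NormedAddCommGroup E] [NormedSpace ℝ E] (J : E →L[ℝ] E)

/-- Multiplication by a complex number for the complex structure `J`, as an operator. -/
def jsmulCLM (z : ℂ) : E →L[ℝ] E := z.re • ContinuousLinearMap.id ℝ E + z.im • J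

lemma jsmulCLM_apply (z : ℂ) (v : E) : jsmulCLM J z v = jsmul J z v := by
  simp [jsmulCLM, jsmul]

variable {J}

lemma jsmul_mul (hJ : ∀ v, J (J v) = -v) (z w : ℂ) (v : E) :
    jsmul J (z * w) v = jsmul J z (jsmul J w v) := by
  simp only [jsmul, Complex.mul_re, Complex.mul_im, map_add, map_smul, hJ]
  module

lemma jsmul_one (v : E) : jsmul J 1 v = v := by simp [jsmul]

lemma jsmul_ofReal (r : ℝ) (v : E) : jsmul J r v = r • v := by simp [jsmul]

lemma jsmul_sub_left (z w : ℂ) (v : E) : jsmul J (z - w) v = jsmul J z v - jsmul J w v := by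
  simp only [jsmul, Complex.sub_re, Complex.sub_im]
  module

lemma jsmul_neg_left (z : ℂ) (v : E) : jsmul J (-z) v = -jsmul J z v := by
  simp only [jsmul, Complex.neg_re, Complex.neg_im]
  module

lemma hasDerivAt_jsmul {c : ℝ → ℂ} {c' : ℂ} {u : ℝ → E} {u' : E} {t : ℝ} (hc : HasDerivAt c c' t)
    (hu : HasDerivAt u u' t) :
    HasDerivAt (fun t => jsmul J (c t) (u t)) (jsmul J (c t) u' + jsmul J c' (u t)) t := by
  have hre : HasDerivAt (fun t => (c t).re) c'.re t := Complex.reCLM.hasFDerivAt.comp_hasDerivAt t hc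
  have him : HasDerivAt (fun t => (c t).im) c'.im t := Complex.imCLM.hasFDerivAt.comp_hasDerivAt t hc
  have := (hre.smul hu).add (him.smul (J.hasFDerivAt.comp_hasDerivAt t hu))
  refine this.congr_deriv ?_
  simp only [jsmul, Function.comp]
  module

end JSmul

section Resolvent

set_option linter.unusedSectionVars false

variable {V : Type*} [NormedAddCommGroup V] [NormedSpace ℝ V]
  [Module ℍ[ℝ] V] [IsScalarTower ℝ ℍ[ℝ] V] [IsBoundedSMul ℍ[ℝ] V]
  [Module ℍ[ℝ]ᵐᵒᵖ V] [IsScalarTower ℝ ℍ[ℝ]ᵐᵒᵖ V] [IsBoundedSMul ℍ[ℝ]ᵐᵒᵖ V]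
  [SMulCommClass ℍ[ℝ]ᵐᵒᵖ ℍ[ℝ] V]

/-- `A` has the properties of `(T - α)⁻¹` for the generator `T` of a strongly continuous group `Z`
with `‖Z t‖ ≤ M e^{ω|t|}`. -/
structure IsGroupResolvent (Z : ℝ → V →L[ℍ[ℝ]ᵐᵒᵖ] V) (M ω α : ℝ) (A : V →L[ℍ[ℝ]ᵐᵒᵖ] V) : Prop where
  nonneg_type : 0 ≤ ω
  zero_apply : ∀ v, Z 0 v = v
  continuous : ∀ v, Continuous fun t => Z t v
  norm_le : ∀ t v, ‖Z t v‖ ≤ M * Real.exp (ω * |t|) * ‖v‖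
  hasDerivAt : ∀ v t, HasDerivAt (fun t => Z t (A v)) (Z t (v + α • A v)) t
  comm : ∀ t v, A (Z t v) = Z t (A v)

variable {Z : ℝ → V →L[ℍ[ℝ]ᵐᵒᵖ] V} {M ω α : ℝ} {A : V →L[ℍ[ℝ]ᵐᵒᵖ] V}

lemma norm_jsmul_laplaceKernel_le (h : IsGroupResolvent Z M ω α A) (J : V →L[ℝ] V) {a : ℝ} {z : ℂ}
    (hz : a ≤ |z.re|) (v : V) (τ : ℝ) : ‖jsmul J (laplaceKernel z τ) (Z (-τ) v)‖ ≤
      (1 + ‖J‖) * M * ‖v‖ * Real.exp (-((a - ω) * |τ|)) := by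
  refine (norm_jsmul_le J _ _).trans ?_
  have h1 := norm_laplaceKernel_le hz τ
  have h2 := h.norm_le (-τ) v
  rw [abs_neg] at h2
  calc _ ≤ Real.exp (-(a * |τ|)) * ((1 + ‖J‖) * (M * Real.exp (ω * |τ|) * ‖v‖)) := by gcongr
    _ = (1 + ‖J‖) * M * ‖v‖ * (Real.exp (-(a * |τ|)) * Real.exp (ω * |τ|)) := by ring
    _ = _ := by
      rw [← Real.exp_add]
      ring_nf

lemma integrable_laplaceKernel (h : IsGroupResolvent Z M ω α A) (J : V →L[ℝ] V) {z : ℂ}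
    (hz : ω < |z.re|) (v : V) :
    Integrable fun τ => jsmul J (laplaceKernel z τ) (Z (-τ) v) := by
  refine ((integrable_exp_neg_mul_abs (sub_pos.2 hz)).const_mul _).mono' ?_
    (.of_forall fun τ => norm_jsmul_laplaceKernel_le h J le_rfl v τ)
  refine (continuous_jsmul J).comp_aestronglyMeasurable (AEStronglyMeasurable.prodMk ?_ ?_)
  · exact (measurable_laplaceKernel.comp (measurable_const.prodMk measurable_id)).aestronglyMeasurable
  · exact ((h.continuous v).comp continuous_neg).aestronglyMeasurable

/-- The Laplace integral `∫ κ_z(τ) Z(-τ) v dτ`. -/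
noncomputable def laplaceIntegral (Z : ℝ → V →L[ℍ[ℝ]ᵐᵒᵖ] V) (J : V →L[ℝ] V) (z : ℂ) (v : V) : V :=
  ∫ τ, jsmul J (laplaceKernel z τ) (Z (-τ) v)

lemma laplaceIntegral_add (h : IsGroupResolvent Z M ω α A) (J : V →L[ℝ] V) {z : ℂ}
    (hz : ω < |z.re|) (u v : V) :
    laplaceIntegral Z J z (u + v) = laplaceIntegral Z J z u + laplaceIntegral Z J z v := by
  rw [laplaceIntegral, laplaceIntegral, laplaceIntegral,
    ← integral_add (integrable_laplaceKernel h J hz u) (integrable_laplaceKernel h J hz v)]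
  simp_rw [← jsmulCLM_apply, map_add]

lemma laplaceIntegral_smul (J : V →L[ℝ] V) (z : ℂ) (r : ℝ) (v : V) :
    laplaceIntegral Z J z (r • v) = r • laplaceIntegral Z J z v := by
  rw [laplaceIntegral, laplaceIntegral, ← integral_smul]
  simp_rw [← jsmulCLM_apply, rightLinear_map_real_smul, map_smul]

/-- The Laplace integral as an operator. -/
noncomputable def laplaceCLM (h : IsGroupResolvent Z M ω α A) (J : V →L[ℝ] V) {z : ℂ}
    (hz : ω < |z.re|) : V →L[ℝ] V :=
  LinearMap.mkContinuous
    { toFun := laplaceIntegral Z J z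
      map_add' := laplaceIntegral_add h J hz
      map_smul' := laplaceIntegral_smul J z }
    (∫ τ, (1 + ‖J‖) * M * Real.exp (-((|z.re| - ω) * |τ|))) fun v => by
      have hi := ((integrable_exp_neg_mul_abs (sub_pos.2 hz)).const_mul ((1 + ‖J‖) * M))
      rw [← integral_mul_const]
      refine norm_integral_le_of_norm_le (hi.mul_const _) (.of_forall fun τ => ?_)
      refine (norm_jsmul_laplaceKernel_le h J le_rfl v τ).trans (le_of_eq ?_)
      ring

/-- Real linear operators that commute with the group and the complex structure commute with
the Laplace integral. -/
lemma laplaceIntegral_comm [CompleteSpace V] (h : IsGroupResolvent Z M ω α A) {J : V →L[ℝ] V}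
    {z : ℂ} (hz : ω < |z.re|) {S : V →L[ℝ] V} (hSZ : ∀ t v, S (Z t v) = Z t (S v))
    (hSJ : ∀ v, S (J v) = J (S v)) (v : V) :
    S (laplaceIntegral Z J z v) = laplaceIntegral Z J z (S v) := by
  rw [laplaceIntegral, laplaceIntegral, ← S.integral_comp_comm (integrable_laplaceKernel h J hz v)]
  simp_rw [jsmul, map_add, map_smul, hSJ, hSZ]

lemma tendsto_exp_neg_mul_abs {l : Filter ℝ} (hl : Tendsto (fun τ : ℝ => |τ|) l atTop) {c : ℝ}
    (hc : 0 < c) (K : ℝ) : Tendsto (fun τ : ℝ => K * Real.exp (-(c * |τ|))) l (𝓝 0) := by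
  have := (Real.tendsto_exp_neg_atTop_nhds_zero.comp (hl.const_mul_atTop hc)).const_mul K
  simpa using this

/-- The resolvent identity for the Laplace integral. -/
lemma jsmul_laplaceIntegral [CompleteSpace V] (h : IsGroupResolvent Z M ω α A) {J : V →L[ℝ] V}
    (hJ : ∀ v, J (J v) = -v) {z : ℂ} (hz : ω < |z.re|) (v : V) :
    jsmul J (z - α) (laplaceIntegral Z J z (A v)) = laplaceIntegral Z J z v + A v := by
  set w := v + α • A v with hw
  -- The vector w is T(Av), so φ' is the integrand of the left-hand side of `key`. On the half line
  -- that carries the kernel φ decays, because |Re z| > ω, and only the boundary value φ(0) = Av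
  -- remains; the sign in the kernel for Re z < 0 makes it the same on both sides.
  set φ : ℝ → V := fun τ => jsmul J (Complex.exp (τ * z)) (Z (-τ) (A v)) with hφ
  set φ' : ℝ → V := fun τ => jsmul J (Complex.exp (τ * z)) (-(Z (-τ) w)) +
    jsmul J (Complex.exp (τ * z) * z) (Z (-τ) (A v)) with hφ'
  have hd : ∀ τ, HasDerivAt φ (φ' τ) τ := fun τ => by
    have h1 : HasDerivAt (fun τ : ℝ => Complex.exp (τ * z)) (Complex.exp (τ * z) * z) τ := by
      have := ((Complex.ofRealCLM.hasDerivAt (x := τ)).mul_const z).cexp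
      simpa using this
    have h2 : HasDerivAt (fun τ : ℝ => Z (-τ) (A v)) (-(Z (-τ) w)) τ := by
      have := (h.hasDerivAt v (-τ)).scomp τ (hasDerivAt_neg τ)
      rw [neg_one_smul] at this
      exact this
    exact hasDerivAt_jsmul h1 h2
  have hi1 := integrable_laplaceKernel h J hz (A v)
  have hi2 := integrable_laplaceKernel h J hz w
  have hi3 : Integrable fun τ => jsmul J z (jsmul J (laplaceKernel z τ) (Z (-τ) (A v))) := by
    simp_rw [← jsmulCLM_apply J z]
    exact (jsmulCLM J z).integrable_comp hi1
  have hi : Integrable fun τ => jsmul J z (jsmul J (laplaceKernel z τ) (Z (-τ) (A v))) -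
      jsmul J (laplaceKernel z τ) (Z (-τ) w) := hi3.sub hi2
  have hint : jsmul J z (laplaceIntegral Z J z (A v)) - laplaceIntegral Z J z w =
      ∫ τ, jsmul J z (jsmul J (laplaceKernel z τ) (Z (-τ) (A v))) -
        jsmul J (laplaceKernel z τ) (Z (-τ) w) := by
    rw [integral_sub hi3 hi2, laplaceIntegral, laplaceIntegral]
    simp_rw [← jsmulCLM_apply J z]
    rw [(jsmulCLM J z).integral_comp_comm hi1]
  have hφeq : ∀ (τ : ℝ) (c : ℂ), c = Complex.exp (τ * z) → jsmul J z (jsmul J c (Z (-τ) (A v))) -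
      jsmul J c (Z (-τ) w) = φ' τ := by
    rintro τ c rfl
    simp only [hφ']
    rw [← jsmul_mul hJ, mul_comm z, ← jsmulCLM_apply J _ (-(Z (-τ) w)), map_neg, jsmulCLM_apply]
    abel
  have hneg : ∀ (τ : ℝ) (c : ℂ), c = -Complex.exp (τ * z) → jsmul J z (jsmul J c (Z (-τ) (A v))) -
      jsmul J c (Z (-τ) w) = -φ' τ := by
    rintro τ c rfl
    rw [← hφeq τ _ rfl, jsmul_neg_left, jsmul_neg_left, ← jsmulCLM_apply J z, map_neg,
      jsmulCLM_apply]
    abel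
  have h0 : φ 0 = A v := by simp [hφ, jsmul_one, h.zero_apply]
  have key : jsmul J z (laplaceIntegral Z J z (A v)) - laplaceIntegral Z J z w = A v := by
    rw [hint]
    rcases lt_or_ge 0 z.re with hre | hre
    · have e : (fun τ => jsmul J z (jsmul J (laplaceKernel z τ) (Z (-τ) (A v))) -
          jsmul J (laplaceKernel z τ) (Z (-τ) w)) = (Set.Iic 0).indicator φ' := by
        funext τ
        by_cases hτ : τ ≤ 0
        · rw [Set.indicator_of_mem (by exact hτ)]
          exact hφeq τ _ (by simp [laplaceKernel, hre, hτ])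
        · rw [Set.indicator_of_notMem (by exact hτ)]
          simp [laplaceKernel, hre, hτ, jsmul]
      rw [e] at hi ⊢
      rw [integrable_indicator_iff measurableSet_Iic] at hi
      rw [integral_indicator measurableSet_Iic, integral_Iic_of_hasDerivAt_of_tendsto'
        (fun τ _ => hd τ) hi (m := 0), h0, sub_zero]
      refine squeeze_zero_norm' ?_ (tendsto_exp_neg_mul_abs tendsto_abs_atBot_atTop
        (sub_pos.2 hz) ((1 + ‖J‖) * M * ‖A v‖))
      filter_upwards [eventually_le_atBot 0] with τ hτ
      have := norm_jsmul_laplaceKernel_le h J (le_refl |z.re|) (A v) τ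
      simpa [laplaceKernel, hre, hτ] using this
    · have e : (fun τ => jsmul J z (jsmul J (laplaceKernel z τ) (Z (-τ) (A v))) -
          jsmul J (laplaceKernel z τ) (Z (-τ) w)) = (Set.Ioi 0).indicator fun τ => -φ' τ := by
        funext τ
        by_cases hτ : τ ≤ 0
        · rw [Set.indicator_of_notMem (by simpa using hτ)]
          simp [laplaceKernel, not_lt.2 hre, hτ, jsmul]
        · rw [Set.indicator_of_mem (by simpa using hτ)]
          exact hneg τ _ (by simp [laplaceKernel, not_lt.2 hre, hτ])
      rw [e] at hi ⊢
      rw [integrable_indicator_iff measurableSet_Ioi] at hi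
      rw [integral_indicator measurableSet_Ioi, integral_neg, integral_Ioi_of_hasDerivAt_of_tendsto'
        (fun τ _ => hd τ) (by simpa using hi.neg) (m := 0), h0]
      · simp
      refine squeeze_zero_norm' ?_ (tendsto_exp_neg_mul_abs tendsto_abs_atTop_atTop
        (sub_pos.2 hz) ((1 + ‖J‖) * M * ‖A v‖))
      filter_upwards [eventually_gt_atTop 0] with τ hτ
      have := norm_jsmul_laplaceKernel_le h J (le_refl |z.re|) (A v) τ
      simpa [laplaceKernel, not_lt.2 hre, not_le.2 hτ, jsmul_neg_left] using this
  rw [hw, laplaceIntegral_add h J hz, laplaceIntegral_smul] at key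
  rw [jsmul_sub_left, jsmul_ofReal]
  rw [← sub_eq_zero] at key ⊢
  rw [← key]
  abel

end Resolvent

/-! ### Invertibility of the pencils -/

section Units

set_option linter.unusedSectionVars false

variable {V : Type*} [NormedAddCommGroup V] [NormedSpace ℝ V]
  [Module ℍ[ℝ] V] [IsScalarTower ℝ ℍ[ℝ] V] [IsBoundedSMul ℍ[ℝ] V]
  [Module ℍ[ℝ]ᵐᵒᵖ V] [IsScalarTower ℝ ℍ[ℝ]ᵐᵒᵖ V] [IsBoundedSMul ℍ[ℝ]ᵐᵒᵖ V]
  [SMulCommClass ℍ[ℝ]ᵐᵒᵖ ℍ[ℝ] V]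

lemma toRealCLM_mul (A B : V →L[ℍ[ℝ]ᵐᵒᵖ] V) : toRealCLM (A * B) = toRealCLM A * toRealCLM B := rfl

lemma toRealCLM_one : toRealCLM (1 : V →L[ℍ[ℝ]ᵐᵒᵖ] V) = 1 := rfl

lemma toRealCLM_smul (r : ℝ) (A : V →L[ℍ[ℝ]ᵐᵒᵖ] V) : toRealCLM (r • A) = r • toRealCLM A := rfl

/-- A real linear inverse of a right linear operator is automatically right linear. So invertibility
can be tested among real linear operators, which also include multiplications that are not right
linear. -/
lemma isUnit_toRealCLM_iff {A : V →L[ℍ[ℝ]ᵐᵒᵖ] V} : IsUnit (toRealCLM A) ↔ IsUnit A := by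
  constructor
  · rintro ⟨u, hu⟩
    have h1 : ∀ v, A ((↑u⁻¹ : V →L[ℝ] V) v) = v := fun v => by
      rw [← toRealCLM_apply, ← hu]
      exact DFunLike.congr_fun u.mul_inv v
    have h2 : ∀ v, (↑u⁻¹ : V →L[ℝ] V) (A v) = v := fun v => by
      rw [← toRealCLM_apply, ← hu]
      exact DFunLike.congr_fun u.inv_mul v
    let B : V →L[ℍ[ℝ]ᵐᵒᵖ] V :=
      { toFun := (↑u⁻¹ : V →L[ℝ] V)
        map_add' := map_add _
        map_smul' := fun q v => by
          conv_lhs => rw [← h1 v, ← map_smul A q, h2]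
          rfl
        cont := (↑u⁻¹ : V →L[ℝ] V).continuous }
    exact ⟨⟨A, B, ContinuousLinearMap.ext h1, ContinuousLinearMap.ext h2⟩, rfl⟩
  · rintro ⟨u, rfl⟩
    exact ⟨⟨toRealCLM u, toRealCLM ↑u⁻¹, by rw [← toRealCLM_mul, u.mul_inv, toRealCLM_one],
      by rw [← toRealCLM_mul, u.inv_mul, toRealCLM_one]⟩, rfl⟩

/-- The operator `1 - 2 Re(ζ) A + |ζ|² A²`. -/
noncomputable def unitPencil (A : V →L[ℍ[ℝ]ᵐᵒᵖ] V) (ζ : ℍ[ℝ]) : V →L[ℍ[ℝ]ᵐᵒᵖ] V :=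
  1 - (2 * ζ.re) • A + (‖ζ‖ ^ 2) • (A * A)

lemma quaternion_inv_re (q : ℍ[ℝ]) : q⁻¹.re = (‖q‖ ^ 2)⁻¹ * q.re := by
  rw [Quaternion.inv_def, Quaternion.re_smul, Quaternion.re_star, Quaternion.normSq_eq_norm_mul_self,
    sq, smul_eq_mul]

/-- The substitution q = (s - α)⁻¹ links the S-spectrum of A to that of T. -/
lemma sPencil_eq_smul_unitPencil (A : V →L[ℍ[ℝ]ᵐᵒᵖ] V) {q : ℍ[ℝ]} (hq : q ≠ 0) :
    sPencil A q = (‖q‖ ^ 2) • unitPencil A q⁻¹ := by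
  have h : ‖q‖ ≠ 0 := norm_ne_zero_iff.2 hq
  rw [sPencil, unitPencil, quaternion_inv_re, norm_inv, smul_add, smul_sub, smul_smul, smul_smul,
    show ‖q‖ ^ 2 * (2 * ((‖q‖ ^ 2)⁻¹ * q.re)) = 2 * q.re by field_simp,
    show ‖q‖ ^ 2 * (‖q‖⁻¹) ^ 2 = 1 by field_simp, one_smul]
  abel

lemma isUnit_real_smul_iff {r : ℝ} (hr : r ≠ 0) {A : V →L[ℍ[ℝ]ᵐᵒᵖ] V} :
    IsUnit (r • A) ↔ IsUnit A := by
  rw [← isUnit_toRealCLM_iff, ← isUnit_toRealCLM_iff, toRealCLM_smul]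
  exact isUnit_smul_iff (Units.mk0 r hr) (toRealCLM A)

lemma isUnit_sPencil_iff {A : V →L[ℍ[ℝ]ᵐᵒᵖ] V} {q : ℍ[ℝ]} (hq : q ≠ 0) :
    IsUnit (sPencil A q) ↔ IsUnit (unitPencil A q⁻¹) := by
  rw [sPencil_eq_smul_unitPencil A hq, isUnit_real_smul_iff]
  exact pow_ne_zero 2 (norm_ne_zero_iff.2 hq)

/-- The resolvent identity `j R a = R + a` for commuting operators makes `1 - j a` invertible. -/
lemma isUnit_one_sub_mul_of {E : Type*} [Ring E] {j a R : E} (hja : j * a = a * j)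
    (hRa : R * a = a * R) (hRj : R * j = j * R) (h : j * (R * a) = R + a) :
    IsUnit (1 - j * a) := by
  have e1 : j * a * (j * R) = j * R + j * a := by
    rw [← mul_add, ← h, mul_assoc, ← mul_assoc a, ← hja, mul_assoc, hRa]
  have e2 : j * R * (j * a) = j * R + j * a := by
    rw [← mul_add, ← h, mul_assoc, ← mul_assoc R, hRj, mul_assoc]
  exact ⟨⟨1 - j * a, 1 - j * R, by
    rw [mul_sub, mul_one, sub_mul _ _ (j * R), one_mul, e1]; abel, by
    rw [mul_sub, mul_one, sub_mul _ _ (j * a), one_mul, e2]; abel⟩, rfl⟩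

variable (V) in
/-- Right multiplication by `q`. -/
noncomputable def rightActCLM (q : ℍ[ℝ]) : V →L[ℝ] V :=
  ContinuousLinearMap.lsmul ℝ ℍ[ℝ]ᵐᵒᵖ (MulOpposite.op q)

lemma rightActCLM_apply (q : ℍ[ℝ]) (v : V) : rightActCLM V q v = MulOpposite.op q • v := rfl

lemma rightActCLM_sq {I : ℍ[ℝ]} (hI : I ∈ ImagUnits) (v : V) :
    rightActCLM V I (rightActCLM V I v) = -v := by
  rw [rightActCLM_apply, rightActCLM_apply, smul_smul, ← MulOpposite.op_mul, ImagUnits.mul_self hI, MulOpposite.op_neg,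
    MulOpposite.op_one, neg_one_smul]

variable {Z : ℝ → V →L[ℍ[ℝ]ᵐᵒᵖ] V} {M ω α : ℝ} {A : V →L[ℍ[ℝ]ᵐᵒᵖ] V}

/-- Right multiplication J by I commutes with A and with the group. Over this complex structure the
pencil factors as (1 - (z - α)A)(1 - (z̄ - α)A), and the Laplace integrals invert both factors,
since z and z̄ have the same real part. -/
lemma IsGroupResolvent.isUnit_unitPencil [CompleteSpace V] (h : IsGroupResolvent Z M ω α A)
    {s : ℍ[ℝ]} (hs : ω < |s.re|) : IsUnit (unitPencil A (s - (α : ℍ[ℝ]))) := by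
  obtain ⟨I, hI, z, rfl⟩ := exists_sliceEmb s
  rw [sliceEmb_re hI] at hs
  set J := rightActCLM V I with hJdef
  have hJ : ∀ v, J (J v) = -v := rightActCLM_sq hI
  have hAJ : ∀ v, toRealCLM A (J v) = J (toRealCLM A v) := fun v => map_smul A _ _
  have hZJ : ∀ t v, J (Z t v) = Z t (J v) := fun t v => (map_smul (Z t) _ _).symm
  have key : ∀ z : ℂ, ω < |z.re| → IsUnit (1 - jsmulCLM J (z - α) * toRealCLM A) := fun z hz => by
    refine isUnit_one_sub_mul_of (R := laplaceCLM h J hz) ?_ ?_ ?_ ?_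
    · ext v
      change jsmulCLM J _ (A v) = A (jsmulCLM J _ v)
      rw [jsmulCLM_apply, jsmulCLM_apply, jsmul, jsmul, map_add, rightLinear_map_real_smul,
        rightLinear_map_real_smul]
      congr 2
      exact (hAJ v).symm
    · ext v
      exact (laplaceIntegral_comm h hz (S := toRealCLM A) h.comm hAJ v).symm
    · ext v
      change laplaceIntegral Z J z (jsmulCLM J (z - α) v) = jsmulCLM J _ (laplaceIntegral Z J z v)
      refine (laplaceIntegral_comm h hz (S := jsmulCLM J (z - α)) (fun t v => ?_) (fun v => ?_) v).symm
      · rw [jsmulCLM_apply, jsmulCLM_apply, jsmul, jsmul, map_add, rightLinear_map_real_smul,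
          rightLinear_map_real_smul, hZJ]
      · rw [jsmulCLM_apply, jsmulCLM_apply, jsmul, jsmul, map_add, map_smul, map_smul]
    · ext v
      change jsmulCLM J (z - α) (laplaceIntegral Z J z (A v)) = laplaceIntegral Z J z v + A v
      rw [jsmulCLM_apply]
      exact jsmul_laplaceIntegral h hJ hz v
  have h1 := (key z hs).mul (key ((starRingEnd ℂ) z) (by simpa using hs))
  rw [← isUnit_toRealCLM_iff]
  convert! h1 using 1
  ext v
  have e1 : (sliceEmb I z - (α : ℍ[ℝ])).re = z.re - α := by
    rw [Quaternion.re_sub, sliceEmb_re hI, Quaternion.re_coe]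
  have e2 : ‖sliceEmb I z - (α : ℍ[ℝ])‖ ^ 2 = (z.re - α) ^ 2 + z.im ^ 2 := by
    rw [← sliceEmb_ofReal (I := I), ← sliceEmb_sub, norm_sliceEmb hI, ← Complex.normSq_eq_norm_sq,
      Complex.normSq_apply]
    simp
    ring
  have hAJ' : ∀ v, A (J v) = J (A v) := hAJ
  change unitPencil A _ v = (v - jsmulCLM J _ (A v)) -
    jsmulCLM J _ (A (v - jsmulCLM J _ (A v)))
  simp only [unitPencil, e1, e2, jsmulCLM_apply, jsmul, add_apply, sub_apply, smul_apply,
    rightLinear_mul_apply, map_sub, map_add, rightLinear_map_real_smul, map_smul, hAJ', hJ,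
    Complex.sub_re, Complex.sub_im, Complex.ofReal_re, Complex.ofReal_im, Complex.conj_re,
    Complex.conj_im, one_apply_eq_self]
  module

variable {T : V →ₗ.[ℍ[ℝ]ᵐᵒᵖ] V}

/-- The domain of T² is the range of A², and the pencil of T composed with A² is `unitPencil A (s -
α)`. Hence A² times the inverse of the latter inverts the former. -/
lemma IsRealResolvent.mem_sResolventSet_of_isUnit (hA : IsRealResolvent T α A) {s : ℍ[ℝ]}
    (hs : IsUnit (unitPencil A (s - (α : ℍ[ℝ])))) : s ∈ sResolventSet T := by
  obtain ⟨N, hN⟩ := hs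
  set ζ := s - (α : ℍ[ℝ]) with hζ
  have hre : s.re = ζ.re + α := by simp [hζ]
  have hnorm : ‖s‖ ^ 2 = ‖ζ‖ ^ 2 + 2 * α * ζ.re + α ^ 2 := by
    have := quaternion_norm_sub_coe_sq s α
    rw [← hζ] at this
    rw [this, hre]
    ring
  -- the pencil on the range of `A²`
  have key : ∀ y : V, SPencilRel T s (A (A y)) (unitPencil A ζ y) := fun y => by
    refine ⟨A y + α • A (A y), _, hA.mem_graph (A y),
      graph_comb_mem (hA.mem_graph y) (hA.mem_graph (A y)) α, ?_⟩
    simp only [unitPencil, add_apply, sub_apply, smul_apply, rightLinear_mul_apply,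
      one_apply_eq_self, hre, hnorm]
    module
  have hN1 : ∀ y, (↑N⁻¹ : V →L[ℍ[ℝ]ᵐᵒᵖ] V) (unitPencil A ζ y) = y := fun y => by
    rw [← hN]
    exact DFunLike.congr_fun N.inv_mul y
  have hN2 : ∀ y, unitPencil A ζ ((↑N⁻¹ : V →L[ℍ[ℝ]ᵐᵒᵖ] V) y) = y := fun y => by
    rw [← hN]
    exact DFunLike.congr_fun N.mul_inv y
  refine ⟨A * A * ↑N⁻¹, fun u w => ⟨?_, ?_⟩⟩
  · rintro rfl
    have := key ((↑N⁻¹ : V →L[ℍ[ℝ]ᵐᵒᵖ] V) w)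
    rwa [hN2] at this
  · rintro ⟨u₁, u₂, h1, h2, rfl⟩
    have e1 : A (u₁ - α • u) = u := (hA _ _).2 (by simpa using h1)
    have e2 : A (u₂ - α • u₁ - α • (u₁ - α • u)) = u₁ - α • u := (hA _ _).2 (by
      have := graph_comb_mem h2 h1 (-α)
      convert! this using 2 <;> module)
    obtain ⟨y, hy⟩ : ∃ y, y = u₂ - α • u₁ - α • (u₁ - α • u) := ⟨_, rfl⟩
    rw [← hy] at e2
    have hu : A (A y) = u := by rw [e2, e1]
    have h3 : u₂ - (2 * s.re) • u₁ + ‖s‖ ^ 2 • u = unitPencil A ζ y := by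
      simp only [unitPencil, add_apply, sub_apply, smul_apply, rightLinear_mul_apply,
        one_apply_eq_self, e1, e2, hre, hnorm]
      rw [hy]
      module
    rw [h3, rightLinear_mul_apply, rightLinear_mul_apply, hN1, hu]

lemma IsGenerator.isGroupResolvent [CompleteSpace V] (hZ : IsStronglyContinuousGroup Z)
    (hT : IsGenerator Z T) (hω : 0 ≤ ω)
    (hb : ∀ (t : ℝ) (v : V), ‖Z t v‖ ≤ M * Real.exp (ω * |t|) * ‖v‖)
    (hA : IsRealResolvent T α A) : IsGroupResolvent Z M ω α A where
  nonneg_type := hω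
  zero_apply := hZ.1
  continuous := hZ.2.2
  norm_le := hb
  hasDerivAt v t := hT.hasDerivAt hZ (hA.mem_graph v) t
  comm t v := hA.comm hZ hT t v

end Units

/-! ### One-sided resolvents in Banach algebras that contain `ℂ` -/

section BanachAlgebra

variable {E : Type*} [NormedRing E] [NormedAlgebra ℝ E] (κ : ℂ →ₐ[ℝ] E) (a : E)

/-- The real quadratic operator `|b|² - 2 Re(b c̄) a + |c|² a²`. -/
noncomputable def quadPencil (b c : ℂ) : E :=
  (‖b‖ ^ 2) • (1 : E) - (2 * (b * (starRingEnd ℂ) c).re) • a + (‖c‖ ^ 2) • (a * a)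

/-- The solution `Y` of `b Y - c Y a = 1`. -/
noncomputable def sideResolvent (b c : ℂ) : E :=
  (κ ((starRingEnd ℂ) b) - κ ((starRingEnd ℂ) c) * a) * Ring.inverse (quadPencil a b c)

variable {κ a} {b c : ℂ}

lemma commute_quadPencil (a : E) (b c : ℂ) : Commute a (quadPencil a b c) := by
  unfold quadPencil
  exact (((Commute.one_right a).smul_right _).sub_right ((Commute.refl a).smul_right _)).add_right
    (((Commute.refl a).mul_right (Commute.refl a)).smul_right _)

lemma algHom_mul_conj (z : ℂ) : κ z * κ ((starRingEnd ℂ) z) = (‖z‖ ^ 2) • (1 : E) := by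
  rw [← map_mul, Complex.mul_conj, ← Complex.coe_algebraMap, AlgHom.commutes,
    Algebra.algebraMap_eq_smul_one, Complex.normSq_eq_norm_sq]

lemma algHom_conj_add (z : ℂ) : κ z + κ ((starRingEnd ℂ) z) = (2 * z.re) • (1 : E) := by
  rw [← map_add, Complex.add_conj, ← Complex.coe_algebraMap, AlgHom.commutes,
    Algebra.algebraMap_eq_smul_one]

/-- Here κ need not commute with a, so Y stays between them. The coefficients that arise, b b̄, c c̄
and b c̄ + c b̄, are real and reassemble the pencil. -/
lemma sideResolvent_spec (h : IsUnit (quadPencil a b c)) :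
    κ b * sideResolvent κ a b c - κ c * sideResolvent κ a b c * a = 1 := by
  have hc : Ring.inverse (quadPencil a b c) * a = a * Ring.inverse (quadPencil a b c) := by
    obtain ⟨u, hu⟩ := h
    have h1 : Commute a ↑u := hu ▸ commute_quadPencil a b c
    rw [← hu, Ring.inverse_unit]
    exact h1.units_inv_right.eq.symm
  have e : κ b * sideResolvent κ a b c - κ c * sideResolvent κ a b c * a =
      (κ b * κ ((starRingEnd ℂ) b) - (κ b * κ ((starRingEnd ℂ) c) + κ c * κ ((starRingEnd ℂ) b)) * a
        + κ c * κ ((starRingEnd ℂ) c) * (a * a)) * Ring.inverse (quadPencil a b c) := by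
    unfold sideResolvent
    simp only [mul_assoc, hc, sub_mul, mul_sub, add_mul]
    abel
  have e2 : κ b * κ ((starRingEnd ℂ) c) + κ c * κ ((starRingEnd ℂ) b) =
      (2 * (b * (starRingEnd ℂ) c).re) • (1 : E) := by
    rw [← algHom_conj_add (κ := κ), ← map_mul κ b, ← map_mul κ c]
    simp [mul_comm]
  rw [e, e2, algHom_mul_conj, algHom_mul_conj, smul_mul_assoc, one_mul, smul_mul_assoc, one_mul]
  exact Ring.mul_inverse_cancel _ h

/-- The relation yields |b|² X = κ(b̄c)Xa and |c|² Xa² = κ(bc̄)Xa. Their sum is 2 Re(bc̄) Xa, so X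
times the pencil is zero. This is the uniqueness behind all formulas for the S-resolvent. -/
lemma eq_zero_of_algHom_mul_eq (h : IsUnit (quadPencil a b c)) {X : E}
    (hX : κ b * X = κ c * X * a) : X = 0 := by
  refine (h.mul_left_eq_zero).1 ?_
  have e1 : (‖b‖ ^ 2) • X = κ ((starRingEnd ℂ) b * c) * X * a := by
    have := congrArg (κ ((starRingEnd ℂ) b) * ·) hX
    simp only [← mul_assoc, ← map_mul] at this
    rw [mul_comm ((starRingEnd ℂ) b) b, map_mul, algHom_mul_conj, smul_mul_assoc, one_mul] at this
    exact this
  have e2 : (‖c‖ ^ 2) • (X * (a * a)) = κ (b * (starRingEnd ℂ) c) * X * a := by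
    have := congrArg (κ ((starRingEnd ℂ) c) * · * a) hX
    simp only [← mul_assoc, ← map_mul] at this
    rw [mul_comm ((starRingEnd ℂ) c) c, map_mul κ c, algHom_mul_conj, smul_mul_assoc, one_mul,
      smul_mul_assoc, smul_mul_assoc, mul_comm _ b] at this
    rw [← mul_assoc, this]
  have e3 : (2 * (b * (starRingEnd ℂ) c).re) • (X * a) =
      κ (b * (starRingEnd ℂ) c) * X * a + κ ((starRingEnd ℂ) b * c) * X * a := by
    rw [← add_mul, ← add_mul]
    have := algHom_conj_add (κ := κ) (b * (starRingEnd ℂ) c)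
    rw [map_mul (starRingEnd ℂ), Complex.conj_conj] at this
    rw [this, smul_mul_assoc, one_mul, smul_mul_assoc]
  rw [quadPencil, mul_add, mul_sub, mul_smul_comm, mul_smul_comm, mul_smul_comm, mul_one, e1, e2, e3]
  abel

lemma eq_sideResolvent (h : IsUnit (quadPencil a b c)) {Y : E}
    (hY : κ b * Y - κ c * Y * a = 1) : Y = sideResolvent κ a b c := by
  rw [← sub_eq_zero]
  refine eq_zero_of_algHom_mul_eq (κ := κ) h ?_
  rw [← sub_eq_zero, ← sub_self (1 : E)]
  nth_rw 1 [← hY]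
  rw [← sideResolvent_spec (κ := κ) h]
  noncomm_ring

section Derivative

variable {b c : ℂ → ℂ} {z : ℂ}

lemma hasFDerivAt_algHom {b' : ℂ} (hb : HasDerivAt b b' z) : HasFDerivAt (fun w => κ (b w))
    ((LinearMap.toContinuousLinearMap κ.toLinearMap).comp
      ((ContinuousLinearMap.toSpanSingleton ℂ b').restrictScalars ℝ)) z :=
  (LinearMap.toContinuousLinearMap κ.toLinearMap).hasFDerivAt.comp z
    (hb.hasFDerivAt.restrictScalars ℝ)

lemma differentiableAt_quadPencil (hb : DifferentiableAt ℂ b z) (hc : DifferentiableAt ℂ c z) :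
    DifferentiableAt ℝ (fun w => quadPencil a (b w) (c w)) z := by
  have hb' := hb.restrictScalars ℝ
  have hc' := hc.restrictScalars ℝ
  have h1 : DifferentiableAt ℝ (fun w => (b w * (starRingEnd ℂ) (c w)).re) z :=
    Complex.reCLM.differentiableAt.comp z (hb'.mul
      (Complex.conjCLE.differentiableAt.comp z hc'))
  exact ((hb'.norm_sq ℝ).smul_const _).sub ((h1.const_mul 2).smul_const _)|>.add
    ((hc'.norm_sq ℝ).smul_const _)

lemma isUnit_quadPencil_eventually [CompleteSpace E] (hb : DifferentiableAt ℂ b z)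
    (hc : DifferentiableAt ℂ c z) (h : IsUnit (quadPencil a (b z) (c z))) :
    ∀ᶠ w in 𝓝 z, IsUnit (quadPencil a (b w) (c w)) :=
  (differentiableAt_quadPencil hb hc).continuousAt.eventually (Units.isOpen.mem_nhds h)

/-- The one-sided resolvent is left holomorphic. -/
lemma sideResolvent_holomorphic [CompleteSpace E] (hb : DifferentiableAt ℂ b z)
    (hc : DifferentiableAt ℂ c z) (h : IsUnit (quadPencil a (b z) (c z))) :
    ∃ D : ℂ →L[ℝ] E, HasFDerivAt (fun w => sideResolvent κ a (b w) (c w)) D z ∧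
      D Complex.I = κ Complex.I * D 1 := by
  have hconj : ∀ {b : ℂ → ℂ}, DifferentiableAt ℂ b z →
      DifferentiableAt ℝ (fun w => κ ((starRingEnd ℂ) (b w))) z := fun {b} hb =>
    (LinearMap.toContinuousLinearMap κ.toLinearMap).differentiableAt.comp z
      (Complex.conjCLE.differentiableAt.comp z (hb.restrictScalars ℝ))
  have hS : DifferentiableAt ℝ (fun w => sideResolvent κ a (b w) (c w)) z :=
    ((hconj hb).sub ((hconj hc).mul_const a)).mul ((differentiableAt_quadPencil hb hc).inverse h)
  set D := fderiv ℝ (fun w => sideResolvent κ a (b w) (c w)) z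
  refine ⟨D, hS.hasFDerivAt, ?_⟩
  have hb' := hasFDerivAt_algHom (κ := κ) hb.hasDerivAt
  have hc' := hasFDerivAt_algHom (κ := κ) hc.hasDerivAt
  -- Differentiating bY - cYa = 1 in the direction ξ gives a linear equation for D ξ whose
  -- right-hand side is κ(ξ) times a fixed element. So D i and κ(i) D 1 solve the same equation and
  -- coincide by uniqueness.
  have h1 := (hb'.mul' hS.hasFDerivAt).sub ((hc'.mul' hS.hasFDerivAt).mul_const' a)
  have h2 := h1.unique (((hasFDerivAt_const (1 : E) z)).congr_of_eventuallyEq (by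
    filter_upwards [isUnit_quadPencil_eventually hb hc h] with w hw
    exact sideResolvent_spec (κ := κ) hw))
  set S := sideResolvent κ a (b z) (c z)
  have key : ∀ ξ : ℂ, κ (b z) * D ξ - κ (c z) * D ξ * a =
      κ ξ * (κ (deriv c z) * S * a - κ (deriv b z) * S) := fun ξ => by
    have h3 : κ (b z) * D ξ + κ (ξ * deriv b z) * S -
        (κ (c z) * D ξ + κ (ξ * deriv c z) * S) * a = 0 := DFunLike.congr_fun h2 ξ
    rw [← sub_eq_zero, ← h3, map_mul, map_mul]
    noncomm_ring
  rw [← sub_eq_zero]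
  refine eq_zero_of_algHom_mul_eq (κ := κ) h ?_
  have hcomm : ∀ w, κ w * κ Complex.I = κ Complex.I * κ w := fun w => by
    rw [← map_mul, ← map_mul, mul_comm]
  have k1 := key Complex.I
  have k2 := congrArg (κ Complex.I * ·) (key 1)
  simp only [map_one, one_mul] at k2
  rw [← k2] at k1
  rw [← sub_eq_zero] at k1 ⊢
  rw [← k1]
  simp only [mul_sub, sub_mul, ← mul_assoc, hcomm]
  abel

end Derivative

end BanachAlgebra

/-! ### The S-resolvent operators -/

section SResolvent

set_option linter.unusedSectionVars false

variable {V : Type*} [NormedAddCommGroup V] [NormedSpace ℝ V]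
  [Module ℍ[ℝ] V] [IsScalarTower ℝ ℍ[ℝ] V] [IsBoundedSMul ℍ[ℝ] V]
  [Module ℍ[ℝ]ᵐᵒᵖ V] [IsScalarTower ℝ ℍ[ℝ]ᵐᵒᵖ V] [IsBoundedSMul ℍ[ℝ]ᵐᵒᵖ V]
  [SMulCommClass ℍ[ℝ]ᵐᵒᵖ ℍ[ℝ] V] {I : ℍ[ℝ]}

variable (V) in
/-- Left multiplication by elements of `ℂ_I`. -/
noncomputable def leftSliceHom (hI : I ∈ ImagUnits) : ℂ →ₐ[ℝ] (V →L[ℝ] V) :=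
  Complex.lift ⟨leftMulCLM V I, ContinuousLinearMap.ext fun v => leftMulCLM_sq hI v⟩

lemma leftSliceHom_apply (hI : I ∈ ImagUnits) (z : ℂ) (v : V) :
    leftSliceHom V hI z v = sliceEmb I z • v := by
  rw [← jsmul_leftMul, jsmul, leftSliceHom, Complex.lift_apply, Complex.liftAux_apply, add_apply,
    Algebra.algebraMap_eq_smul_one]
  rfl

variable {A : V →L[ℍ[ℝ]ᵐᵒᵖ] V}

lemma toRealCLM_sPencil (hI : I ∈ ImagUnits) (z : ℂ) :
    toRealCLM (sPencil A (sliceEmb I z)) = quadPencil (toRealCLM A) z 1 := by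
  ext v
  simp only [toRealCLM_apply, sPencil, quadPencil, sliceEmb_re hI, norm_sliceEmb hI, add_apply,
    sub_apply, smul_apply, one_apply_eq_self, map_one, mul_one, norm_one, one_pow, one_smul]
  change A (A v) - _ + _ = _ - _ + A (A v)
  abel

lemma toRealCLM_unitPencil (hI : I ∈ ImagUnits) (z : ℂ) :
    toRealCLM (unitPencil A (sliceEmb I z)) = quadPencil (toRealCLM A) 1 z := by
  ext v
  simp only [toRealCLM_apply, unitPencil, quadPencil, sliceEmb_re hI, norm_sliceEmb hI, add_apply,
    sub_apply, smul_apply, one_apply_eq_self, one_mul, norm_one, one_pow, one_smul, Complex.conj_re]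
  rfl

lemma isUnit_quadPencil_one_right (hI : I ∈ ImagUnits) (z : ℂ) :
    IsUnit (quadPencil (toRealCLM A) z 1) ↔ IsUnit (sPencil A (sliceEmb I z)) := by
  rw [← toRealCLM_sPencil hI, isUnit_toRealCLM_iff]

lemma isUnit_quadPencil_one_left (hI : I ∈ ImagUnits) (z : ℂ) :
    IsUnit (quadPencil (toRealCLM A) 1 z) ↔ IsUnit (unitPencil A (sliceEmb I z)) := by
  rw [← toRealCLM_unitPencil hI, isUnit_toRealCLM_iff]

/-- Identifies the S-resolvent with the solution Y of qY - YA = 1, where q acts by left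
multiplication. -/
lemma toRealCLM_rightSResolvent (hI : I ∈ ImagUnits) {z : ℂ}
    (h : IsUnit (sPencil A (sliceEmb I z))) : toRealCLM (rightSResolvent (sliceEmb I z) A) =
      sideResolvent (leftSliceHom V hI) (toRealCLM A) z 1 := by
  have hinv : toRealCLM (Ring.inverse (sPencil A (sliceEmb I z))) =
      Ring.inverse (quadPencil (toRealCLM A) z 1) := by
    rw [← one_mul (Ring.inverse (quadPencil (toRealCLM A) z 1)), Ring.eq_mul_inverse_iff_mul_eq _ _ _
      ((isUnit_quadPencil_one_right hI z).2 h), ← toRealCLM_sPencil hI, ← toRealCLM_mul,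
      Ring.inverse_mul_cancel _ h, toRealCLM_one]
  rw [sideResolvent, ← hinv]
  ext v
  change -(A (Ring.inverse (sPencil A (sliceEmb I z)) v) - star (sliceEmb I z) • _) =
    leftSliceHom V hI ((starRingEnd ℂ) z) _ - leftSliceHom V hI ((starRingEnd ℂ) 1) (A _)
  rw [leftSliceHom_apply, leftSliceHom_apply, map_one, sliceEmb_one, one_smul, sliceEmb_conj hI,
    neg_sub]
  rfl

lemma JDiffAt.of_sideResolvent [CompleteSpace V] (hI : I ∈ ImagUnits) {a : V →L[ℝ] V} {b c : ℂ → ℂ}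
    {z : ℂ} (hb : DifferentiableAt ℂ b z) (hc : DifferentiableAt ℂ c z)
    (h : IsUnit (quadPencil a (b z) (c z))) (v : V) :
    JDiffAt (leftMulCLM V I) (fun w => sideResolvent (leftSliceHom V hI) a (b w) (c w) v) z := by
  obtain ⟨D, hD, hDI⟩ := sideResolvent_holomorphic (κ := leftSliceHom V hI) hb hc h
  have h1 := hD.clm_apply (hasFDerivAt_const v z)
  refine ⟨h1.differentiableAt, ?_⟩
  rw [h1.fderiv]
  simp only [map_zero, add_apply, ContinuousLinearMap.comp_apply, zero_apply,
    ContinuousLinearMap.flip_apply, zero_add, hDI]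
  change leftSliceHom V hI Complex.I (D 1 v) = _
  rw [leftSliceHom_apply, sliceEmb_I, leftMulCLM_apply]

/-- The right S-resolvent operator is left holomorphic on the slices. -/
lemma jDiffAt_rightSResolvent [CompleteSpace V] (hI : I ∈ ImagUnits) {z : ℂ}
    (h : IsUnit (sPencil A (sliceEmb I z))) (v : V) :
    JDiffAt (leftMulCLM V I) (fun w => rightSResolvent (sliceEmb I w) A v) z := by
  have h' := (isUnit_quadPencil_one_right hI z).2 h
  have h1 := JDiffAt.of_sideResolvent hI (a := toRealCLM A) (b := fun w => w) (c := fun _ => 1)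
    differentiableAt_id (differentiableAt_const _) h' v
  have e : (fun w => rightSResolvent (sliceEmb I w) A v) =ᶠ[𝓝 z]
      fun w => sideResolvent (leftSliceHom V hI) (toRealCLM A) w 1 v := by
    filter_upwards [isUnit_quadPencil_eventually (b := fun w => w) (c := fun _ => 1)
      differentiableAt_id (differentiableAt_const _) h'] with w hw
    rw [← toRealCLM_rightSResolvent hI ((isUnit_quadPencil_one_right hI w).1 hw), toRealCLM_apply]
  exact ⟨h1.1.congr_of_eventuallyEq e, by rw [e.fderiv_eq]; exact h1.2⟩

lemma isOpen_setOf_isUnit_sPencil [CompleteSpace V] (hI : I ∈ ImagUnits) (A : V →L[ℍ[ℝ]ᵐᵒᵖ] V) :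
    IsOpen {z : ℂ | IsUnit (sPencil A (sliceEmb I z))} := by
  simp_rw [← isUnit_quadPencil_one_right hI]
  exact isOpen_iff_mem_nhds.2 fun z hz => isUnit_quadPencil_eventually (b := fun w => w)
    (c := fun _ => 1) differentiableAt_id (differentiableAt_const _) hz

/-- The pencil is the identity at ζ = 0 and units form an open set. As an operator of the complex
coordinate it is the same on all slices, so one η serves them all. -/
lemma exists_isUnit_unitPencil [CompleteSpace V] (A : V →L[ℍ[ℝ]ᵐᵒᵖ] V) :
    ∃ η : ℝ, 0 < η ∧ ∀ ζ : ℍ[ℝ], ‖ζ‖ < η → IsUnit (unitPencil A ζ) := by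
  obtain ⟨I, hI⟩ := exists_imagUnit
  have h0 : IsUnit (quadPencil (toRealCLM A) 1 0) := by
    simp [quadPencil]
  obtain ⟨η, hη, h⟩ := Metric.eventually_nhds_iff.1 (isUnit_quadPencil_eventually
    (a := toRealCLM A) (b := fun _ => 1) (c := fun w => w) (z := 0) (differentiableAt_const _)
    differentiableAt_id h0)
  refine ⟨η, hη, fun ζ hζ => ?_⟩
  obtain ⟨J, hJ, w, rfl⟩ := exists_sliceEmb ζ
  rw [norm_sliceEmb hJ] at hζ
  exact (isUnit_quadPencil_one_left hJ w).1 (h (by simpa using hζ))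

variable {Z : ℝ → V →L[ℍ[ℝ]ᵐᵒᵖ] V} {M ω α : ℝ}

/-- The right S-resolvent as a Laplace integral. -/
lemma IsGroupResolvent.rightSResolvent_apply [CompleteSpace V] (h : IsGroupResolvent Z M ω α A)
    (hI : I ∈ ImagUnits) {q : ℂ} (hq : q ≠ 0) (hz : ω < |(α + q⁻¹).re|) (v : V) :
    rightSResolvent (sliceEmb I q) A v = sliceEmb I q⁻¹ • v -
      sliceEmb I (q⁻¹ ^ 2) • laplaceIntegral Z (leftMulCLM V I) (α + q⁻¹) v := by
  have hunit : IsUnit (sPencil A (sliceEmb I q)) := by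
    have hq' : sliceEmb I q ≠ 0 := by rwa [← norm_ne_zero_iff, norm_sliceEmb hI, norm_ne_zero_iff]
    rw [isUnit_sPencil_iff hq', ← sliceEmb_inv hI]
    have := h.isUnit_unitPencil (s := sliceEmb I (α + q⁻¹)) (by rwa [sliceEmb_re hI])
    rwa [sliceEmb_add, sliceEmb_ofReal, add_sub_cancel_left] at this
  set κ := leftSliceHom V hI
  set R := laplaceCLM h (leftMulCLM V I) hz
  set a := toRealCLM A
  have hR : κ q⁻¹ * (R * a) = R + a := by
    ext v
    have := jsmul_laplaceIntegral h (leftMulCLM_sq hI) hz v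
    rw [add_sub_cancel_left, jsmul_leftMul, ← leftSliceHom_apply hI] at this
    exact this
  -- The resolvent identity q⁻¹RA = R + A makes q⁻¹ - q⁻²R a solution of qY - YA = 1, and the
  -- solution is unique.
  have hY : κ q * (κ q⁻¹ - κ (q⁻¹ ^ 2) * R) - κ 1 * (κ q⁻¹ - κ (q⁻¹ ^ 2) * R) * a = 1 := by
    have e1 : κ q * κ q⁻¹ = 1 := by rw [← map_mul, mul_inv_cancel₀ hq, map_one]
    have e2 : κ q * (κ (q⁻¹ ^ 2) * R) = κ q⁻¹ * R := by
      rw [← mul_assoc, ← map_mul, sq, mul_inv_cancel_left₀ hq]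
    have e3 : κ (q⁻¹ ^ 2) * R * a = κ q⁻¹ * (R + a) := by
      rw [← hR, sq, map_mul, mul_assoc, mul_assoc]
    rw [map_one, one_mul, mul_sub, e1, e2, sub_mul, e3, mul_add]
    abel
  have := eq_sideResolvent (κ := κ) ((isUnit_quadPencil_one_right hI q).2 hunit) hY
  rw [← toRealCLM_rightSResolvent hI hunit] at this
  rw [← toRealCLM_apply, ← this]
  change κ q⁻¹ v - κ (q⁻¹ ^ 2) (laplaceIntegral Z (leftMulCLM V I) (α + q⁻¹) v) = _
  rw [leftSliceHom_apply, leftSliceHom_apply]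

/-- The right S-resolvent in the variable `1/q`. -/
lemma smul_rightSResolvent_eq (hI : I ∈ ImagUnits) {q : ℂ} (hq : q ≠ 0)
    (hunit : IsUnit (unitPencil A (sliceEmb I q⁻¹))) (v : V) :
    rightSResolvent (sliceEmb I q) A v =
      sliceEmb I q⁻¹ • sideResolvent (leftSliceHom V hI) (toRealCLM A) 1 q⁻¹ v := by
  have hunit' : IsUnit (sPencil A (sliceEmb I q)) := by
    have hq' : sliceEmb I q ≠ 0 := by rwa [← norm_ne_zero_iff, norm_sliceEmb hI, norm_ne_zero_iff]
    rwa [isUnit_sPencil_iff hq', ← sliceEmb_inv hI]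
  set κ := leftSliceHom V hI
  set S := sideResolvent κ (toRealCLM A) 1 q⁻¹
  have hS := sideResolvent_spec (κ := κ) ((isUnit_quadPencil_one_left hI q⁻¹).2 hunit)
  have hY : κ q * (κ q⁻¹ * S) - κ 1 * (κ q⁻¹ * S) * toRealCLM A = 1 := by
    rw [← mul_assoc, ← map_mul, mul_inv_cancel₀ hq]
    nth_rw 2 [map_one]
    rw [one_mul]
    exact hS
  have := eq_sideResolvent (κ := κ) ((isUnit_quadPencil_one_right hI q).2 hunit') hY
  rw [← toRealCLM_rightSResolvent hI hunit'] at this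
  rw [← toRealCLM_apply, ← this, ← leftSliceHom_apply hI]
  rfl

/-- The defining equation of the resolvent in the variable `1/q`. -/
lemma sideResolvent_one_apply (hI : I ∈ ImagUnits) {w : ℂ}
    (hunit : IsUnit (unitPencil A (sliceEmb I w))) (v : V) :
    sideResolvent (leftSliceHom V hI) (toRealCLM A) 1 w v =
      v + sliceEmb I w • sideResolvent (leftSliceHom V hI) (toRealCLM A) 1 w (A v) := by
  have hS := sideResolvent_spec (κ := leftSliceHom V hI)
    ((isUnit_quadPencil_one_left hI w).2 hunit)
  rw [map_one, one_mul, sub_eq_iff_eq_add] at hS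
  have := DFunLike.congr_fun hS v
  rw [this, ← leftSliceHom_apply hI]
  rfl

end SResolvent

/-! ### The Laplace transform of a group as a resolvent of its generator -/

section LaplaceResolvent

set_option linter.unusedSectionVars false

variable {V : Type*} [NormedAddCommGroup V] [NormedSpace ℝ V] [CompleteSpace V]
  [Module ℍ[ℝ] V] [IsScalarTower ℝ ℍ[ℝ] V] [IsBoundedSMul ℍ[ℝ] V]
  [Module ℍ[ℝ]ᵐᵒᵖ V] [IsScalarTower ℝ ℍ[ℝ]ᵐᵒᵖ V] [IsBoundedSMul ℍ[ℝ]ᵐᵒᵖ V]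
  [SMulCommClass ℍ[ℝ]ᵐᵒᵖ ℍ[ℝ] V]

variable {Z : ℝ → V →L[ℍ[ℝ]ᵐᵒᵖ] V} {M ω : ℝ}

lemma norm_exp_smul_group_le (hb : ∀ (t : ℝ) (v : V), ‖Z t v‖ ≤ M * Real.exp (ω * |t|) * ‖v‖)
    (w : V) {t : ℝ} (ht : 0 < t) :
    ‖Real.exp (-((ω + 1) * t)) • Z t w‖ ≤ M * ‖w‖ * Real.exp (-t) := by
  rw [norm_smul, Real.norm_eq_abs, Real.abs_exp]
  calc _ ≤ Real.exp (-((ω + 1) * t)) * (M * Real.exp (ω * |t|) * ‖w‖) := by gcongr; exact hb t w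
    _ = M * ‖w‖ * (Real.exp (-((ω + 1) * t)) * Real.exp (ω * t)) := by rw [abs_of_pos ht]; ring
    _ = _ := by rw [← Real.exp_add]; ring_nf

lemma integrableOn_exp_smul_group (hZ : IsStronglyContinuousGroup Z)
    (hb : ∀ (t : ℝ) (v : V), ‖Z t v‖ ≤ M * Real.exp (ω * |t|) * ‖v‖) (w : V) :
    IntegrableOn (fun t => Real.exp (-((ω + 1) * t)) • Z t w) (Set.Ioi 0) := by
  refine Integrable.mono' ((integrableOn_exp_neg_Ioi 0).const_mul (M * ‖w‖)) ?_ ?_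
  · exact (Continuous.smul (by fun_prop) (hZ.2.2 w)).aestronglyMeasurable
  · filter_upwards [ae_restrict_mem measurableSet_Ioi] with t ht
    exact norm_exp_smul_group_le hb w ht

/-- The Laplace transform of a strongly continuous group at the point `ω + 1`. -/
noncomputable def groupLaplace (hZ : IsStronglyContinuousGroup Z)
    (hb : ∀ (t : ℝ) (v : V), ‖Z t v‖ ≤ M * Real.exp (ω * |t|) * ‖v‖) : V →L[ℍ[ℝ]ᵐᵒᵖ] V :=
  LinearMap.mkContinuous
    { toFun := fun w => ∫ t in Set.Ioi 0, Real.exp (-((ω + 1) * t)) • Z t w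
      map_add' := fun v w => by
        rw [← integral_add (integrableOn_exp_smul_group hZ hb v)
          (integrableOn_exp_smul_group hZ hb w)]
        simp only [map_add, smul_add]
      map_smul' := fun q w => by
        have := (rightActCLM V q.unop).integral_comp_comm (integrableOn_exp_smul_group hZ hb w)
        simp only [rightActCLM_apply, MulOpposite.op_unop] at this
        rw [RingHom.id_apply, ← this]
        refine integral_congr_ae (Eventually.of_forall fun t => ?_)
        simp only [map_smul]
        exact smul_comm _ _ _ }
    M fun w => by
      have h1 : ‖∫ t in Set.Ioi 0, Real.exp (-((ω + 1) * t)) • Z t w‖ ≤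
          ∫ t in Set.Ioi (0 : ℝ), M * ‖w‖ * Real.exp (-t) := by
        refine norm_integral_le_of_norm_le ((integrableOn_exp_neg_Ioi 0).const_mul (M * ‖w‖)) ?_
        filter_upwards [ae_restrict_mem measurableSet_Ioi] with t ht
        exact norm_exp_smul_group_le hb w ht
      rwa [integral_const_mul, integral_exp_neg_Ioi_zero, mul_one] at h1

lemma groupLaplace_apply (hZ : IsStronglyContinuousGroup Z)
    (hb : ∀ (t : ℝ) (v : V), ‖Z t v‖ ≤ M * Real.exp (ω * |t|) * ‖v‖) (w : V) :
    groupLaplace hZ hb w = ∫ t in Set.Ioi 0, Real.exp (-((ω + 1) * t)) • Z t w := rfl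

/-- The operator Z h shifts the variable of integration by h, so that only the integral over (h, ∞)
remains, multiplied by e^((ω+1)h). This makes the difference quotient of the group computable. -/
lemma map_groupLaplace (hZ : IsStronglyContinuousGroup Z)
    (hb : ∀ (t : ℝ) (v : V), ‖Z t v‖ ≤ M * Real.exp (ω * |t|) * ‖v‖) (w : V) {h : ℝ} (hh : 0 < h) :
    Z h (groupLaplace hZ hb w) = Real.exp ((ω + 1) * h) •
      (groupLaplace hZ hb w - ∫ t in (0 : ℝ)..h, Real.exp (-((ω + 1) * t)) • Z t w) := by
  have hi := integrableOn_exp_smul_group hZ hb w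
  have h1 := (toRealCLM (Z h)).integral_comp_comm hi
  simp only [toRealCLM_apply] at h1
  have h2 := (measurePreserving_add_right volume h).setIntegral_preimage_emb
    (measurableEmbedding_addRight h) (fun t => Real.exp (-((ω + 1) * t)) • Z t w) (Set.Ioi h)
  rw [Set.preimage_add_const_Ioi, sub_self] at h2
  have h3 : ∀ t : ℝ, Z h (Real.exp (-((ω + 1) * t)) • Z t w) =
      Real.exp ((ω + 1) * h) • (Real.exp (-((ω + 1) * (t + h))) • Z (t + h) w) := fun t => by
    rw [rightLinear_map_real_smul, ← hZ.2.1, smul_smul, ← Real.exp_add, add_comm h t]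
    ring_nf
  have h4 := intervalIntegral.integral_Ioi_sub_Ioi hi hh.le
  rw [groupLaplace_apply, ← h1]
  simp only [h3]
  rw [integral_smul, h2, ← h4, sub_sub_cancel]

lemma groupLaplace_mem_graph {T : V →ₗ.[ℍ[ℝ]ᵐᵒᵖ] V} (hZ : IsStronglyContinuousGroup Z)
    (hT : IsGenerator Z T)
    (hb : ∀ (t : ℝ) (v : V), ‖Z t v‖ ≤ M * Real.exp (ω * |t|) * ‖v‖) (w : V) :
    (groupLaplace hZ hb w, (ω + 1) • groupLaplace hZ hb w - w) ∈ T.graph := by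
  rw [hT]
  set R := groupLaplace hZ hb w with hR
  have hc : Continuous fun t => Real.exp (-((ω + 1) * t)) • Z t w :=
    Continuous.smul (by fun_prop) (hZ.2.2 w)
  have h1 : HasDerivAt (fun h => ∫ t in (0 : ℝ)..h, Real.exp (-((ω + 1) * t)) • Z t w) w 0 := by
    have := intervalIntegral.integral_hasDerivAt_right (hc.intervalIntegrable 0 0)
      (hc.stronglyMeasurableAtFilter _ _) hc.continuousAt
    simpa [hZ.1] using this
  have h2 : HasDerivAt (fun h : ℝ => Real.exp ((ω + 1) * h)) (ω + 1) 0 := by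
    simpa using ((hasDerivAt_id (0 : ℝ)).const_mul (ω + 1)).exp
  have h3 := h2.smul (h1.const_sub R)
  have h4 := h3.hasDerivWithinAt (s := Set.Ioi 0)
  rw [hasDerivWithinAt_iff_tendsto_slope' (by simp)] at h4
  have h5 : Real.exp ((ω + 1) * 0) • -w + (ω + 1) •
      (R - ∫ t in (0 : ℝ)..0, Real.exp (-((ω + 1) * t)) • Z t w) = (ω + 1) • R - w := by
    rw [intervalIntegral.integral_same, mul_zero, Real.exp_zero]
    module
  rw [h5] at h4
  refine h4.congr' ?_
  filter_upwards [self_mem_nhdsWithin] with h hh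
  rw [map_groupLaplace hZ hb w hh, slope_def_module]
  simp [← hR]

/-- The integrand is the derivative of -e^(-(ω+1)t) Z t u, which vanishes at infinity and has the
value -u at 0. -/
lemma groupLaplace_apply_of_mem_graph {T : V →ₗ.[ℍ[ℝ]ᵐᵒᵖ] V} (hZ : IsStronglyContinuousGroup Z)
    (hT : IsGenerator Z T)
    (hb : ∀ (t : ℝ) (v : V), ‖Z t v‖ ≤ M * Real.exp (ω * |t|) * ‖v‖) {u w : V}
    (h : (u, w) ∈ T.graph) : groupLaplace hZ hb ((ω + 1) • u - w) = u := by
  have h2 : ∀ t : ℝ, HasDerivAt (fun t : ℝ => Real.exp (-((ω + 1) * t)))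
      (-(ω + 1) * Real.exp (-((ω + 1) * t))) t := fun t => by
    have := ((hasDerivAt_id t).const_mul (-(ω + 1))).exp
    convert! this using 1
    · ext; simp only [id, neg_mul]
    · simp only [id, neg_mul, mul_one]; ring
  have h3 : ∀ t ∈ Set.Ici (0 : ℝ), HasDerivAt (fun t => -(Real.exp (-((ω + 1) * t)) • Z t u))
      (Real.exp (-((ω + 1) * t)) • Z t ((ω + 1) • u - w)) t := fun t _ => by
    convert! ((h2 t).smul (hT.hasDerivAt hZ h t)).neg using 1
    rw [map_sub, rightLinear_map_real_smul]
    module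
  have h4 : Tendsto (fun t => -(Real.exp (-((ω + 1) * t)) • Z t u)) atTop (𝓝 0) := by
    rw [← neg_zero]
    refine Tendsto.neg (squeeze_zero_norm' (a := fun t => M * ‖u‖ * Real.exp (-t)) ?_ ?_)
    · filter_upwards [eventually_gt_atTop 0] with t ht using norm_exp_smul_group_le hb u ht
    · simpa using (Real.tendsto_exp_neg_atTop_nhds_zero).const_mul (M * ‖u‖)
  rw [groupLaplace_apply,
    integral_Ioi_of_hasDerivAt_of_tendsto' h3 (integrableOn_exp_smul_group hZ hb _) h4]
  simp [hZ.1]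

/-- The point `ω + 1` lies in the resolvent set of the generator. -/
lemma IsGenerator.isRealResolvent {T : V →ₗ.[ℍ[ℝ]ᵐᵒᵖ] V} (hZ : IsStronglyContinuousGroup Z)
    (hT : IsGenerator Z T)
    (hb : ∀ (t : ℝ) (v : V), ‖Z t v‖ ≤ M * Real.exp (ω * |t|) * ‖v‖) :
    IsRealResolvent T (ω + 1) (-groupLaplace hZ hb) := by
  refine fun u w => ⟨?_, fun h => ?_⟩
  · rintro rfl
    have := T.graph.neg_mem (groupLaplace_mem_graph hZ hT hb w)
    convert! this using 1
    simp only [neg_apply, Prod.neg_mk, Prod.mk.injEq, true_and]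
    module
  · have := groupLaplace_apply_of_mem_graph hZ hT hb h
    rw [show (ω + 1) • u - (w + (ω + 1) • u) = -w by module, map_neg] at this
    rw [neg_apply, this]

end LaplaceResolvent

/-! ### Contour integrals of the S-resolvent as Laplace integrals -/

section Contour

set_option linter.unusedSectionVars false

/-- The density `g(s) ds_I` along the curve `γ`. -/
noncomputable def contourDensity (g : ℍ[ℝ] → ℍ[ℝ]) (I : ℍ[ℝ]) (γ : ℝ → ℂ) (t : ℝ) : ℍ[ℝ] :=
  g (sliceEmb I (γ t)) * (-(sliceEmb I (deriv γ t) * I))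

/-- The integral of `s⁻¹` against the density `H` along `γ`. -/
noncomputable def contourConst (I : ℍ[ℝ]) (H : ℝ → ℍ[ℝ]) (γ : ℝ → ℂ) : ℍ[ℝ] :=
  ∫ t in (0 : ℝ)..1, H t * sliceEmb I (γ t)⁻¹

/-- The superposition of Laplace kernels along `γ`. -/
noncomputable def contourKernel (I : ℍ[ℝ]) (α : ℝ) (H : ℝ → ℍ[ℝ]) (γ : ℝ → ℂ) (τ : ℝ) : ℍ[ℝ] :=
  -∫ t in (0 : ℝ)..1, H t * sliceEmb I ((γ t)⁻¹ ^ 2 * laplaceKernel (α + (γ t)⁻¹) τ)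

variable {I : ℍ[ℝ]} {α a : ℝ} {H : ℝ → ℍ[ℝ]} {γ : ℝ → ℂ}

lemma stronglyMeasurable_contourIntegrand (I : ℍ[ℝ]) (α : ℝ) (hH : Continuous H)
    (hγ : Continuous γ) (h0 : ∀ t, γ t ≠ 0) : StronglyMeasurable fun p : ℝ × ℝ =>
      H p.1 * sliceEmb I ((γ p.1)⁻¹ ^ 2 * laplaceKernel (α + (γ p.1)⁻¹) p.2) := by
  have hinv : Continuous fun p : ℝ × ℝ => (γ p.1)⁻¹ := (hγ.comp continuous_fst).inv₀ fun p => h0 _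
  have h1 : Measurable fun p : ℝ × ℝ => (γ p.1)⁻¹ ^ 2 * laplaceKernel (α + (γ p.1)⁻¹) p.2 :=
    (hinv.pow 2).measurable.mul (measurable_laplaceKernel.comp
      ((continuous_const.add hinv).measurable.prodMk measurable_snd))
  exact (hH.comp continuous_fst).stronglyMeasurable.mul
    ((continuous_sliceEmb I).comp_stronglyMeasurable h1.stronglyMeasurable)

lemma stronglyMeasurable_contourKernel (I : ℍ[ℝ]) (α : ℝ) (hH : Continuous H)
    (hγ : Continuous γ) (h0 : ∀ t, γ t ≠ 0) : StronglyMeasurable (contourKernel I α H γ) := by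
  have := (stronglyMeasurable_contourIntegrand I α hH hγ h0).integral_prod_left'
    (μ := volume.restrict (Set.Ioc (0 : ℝ) 1))
  convert! this.neg using 1
  funext τ
  simp only [contourKernel, intervalIntegral.integral_of_le zero_le_one, Pi.neg_apply]

lemma exists_contourIntegrand_bound (hI : I ∈ ImagUnits) (hH : Continuous H)
    (hγ : Continuous γ) (h0 : ∀ t, γ t ≠ 0) (ha : ∀ t, a ≤ |(α + (γ t)⁻¹).re|) :
    ∃ K, 0 ≤ K ∧ ∀ t ∈ Set.Ioc (0 : ℝ) 1, ∀ τ,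
      ‖H t * sliceEmb I ((γ t)⁻¹ ^ 2 * laplaceKernel (α + (γ t)⁻¹) τ)‖ ≤
        K * Real.exp (-(a * |τ|)) := by
  have hc : Continuous fun t => H t * sliceEmb I ((γ t)⁻¹ ^ 2) :=
    hH.mul ((continuous_sliceEmb I).comp ((hγ.inv₀ h0).pow 2))
  obtain ⟨K, hK⟩ := (isCompact_Icc (a := (0 : ℝ)) (b := 1)).exists_bound_of_continuousOn
    hc.continuousOn
  refine ⟨K, (norm_nonneg _).trans (hK 0 ⟨le_rfl, zero_le_one⟩), fun t ht τ => ?_⟩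
  rw [sliceEmb_mul hI, ← mul_assoc, norm_mul, norm_sliceEmb hI]
  exact mul_le_mul (hK t ⟨ht.1.le, ht.2⟩) (norm_laplaceKernel_le (ha t) τ) (norm_nonneg _)
    ((norm_nonneg _).trans (hK t ⟨ht.1.le, ht.2⟩))

lemma exists_contourKernel_bound (hI : I ∈ ImagUnits) (hH : Continuous H)
    (hγ : Continuous γ) (h0 : ∀ t, γ t ≠ 0) (ha : ∀ t, a ≤ |(α + (γ t)⁻¹).re|) :
    ∃ K, ∀ τ, ‖contourKernel I α H γ τ‖ ≤ K * Real.exp (-(a * |τ|)) := by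
  obtain ⟨K, hK0, hK⟩ := exists_contourIntegrand_bound (α := α) hI hH hγ h0 ha
  refine ⟨K, fun τ => ?_⟩
  rw [contourKernel, norm_neg]
  refine (intervalIntegral.norm_integral_le_of_norm_le_const fun t ht => hK t ?_ τ).trans ?_
  · rwa [Set.uIoc_of_le zero_le_one] at ht
  · simp

variable {V : Type*} [NormedAddCommGroup V] [NormedSpace ℝ V] [CompleteSpace V]
  [Module ℍ[ℝ] V] [IsScalarTower ℝ ℍ[ℝ] V] [IsBoundedSMul ℍ[ℝ] V]
  [Module ℍ[ℝ]ᵐᵒᵖ V] [IsScalarTower ℝ ℍ[ℝ]ᵐᵒᵖ V] [IsBoundedSMul ℍ[ℝ]ᵐᵒᵖ V]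
  [SMulCommClass ℍ[ℝ]ᵐᵒᵖ ℍ[ℝ] V]

lemma integral_quaternion_smul_const {X : Type*} [MeasurableSpace X] {ν : Measure X} {F : X → ℍ[ℝ]}
    (hF : Integrable F ν) (v : V) : ∫ x, F x • v ∂ν = (∫ x, F x ∂ν) • v :=
  ((ContinuousLinearMap.lsmul ℝ ℍ[ℝ]).flip v).integral_comp_comm hF

lemma integral_const_quaternion_smul {X : Type*} [MeasurableSpace X] {ν : Measure X} {F : X → V}
    (hF : Integrable F ν) (q : ℍ[ℝ]) : ∫ x, q • F x ∂ν = q • ∫ x, F x ∂ν :=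
  (leftMulCLM V q).integral_comp_comm hF

variable {Z : ℝ → V →L[ℍ[ℝ]ᵐᵒᵖ] V} {M ω : ℝ} {A : V →L[ℍ[ℝ]ᵐᵒᵖ] V}

/-- Contour integrals of the S-resolvent along curves whose images under `α + 1/q` have real
parts larger than the growth bound of the group. -/
theorem IsGroupResolvent.integral_contour (h : IsGroupResolvent Z M ω α A) (hI : I ∈ ImagUnits)
    (hH : Continuous H) (hγ : Continuous γ) (h0 : ∀ t, γ t ≠ 0)
    (ha : ∀ t, a ≤ |(α + (γ t)⁻¹).re|) (hωa : ω < a) (v : V) :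
    ∫ t in (0 : ℝ)..1, H t • rightSResolvent (sliceEmb I (γ t)) A v =
      contourConst I H γ • v + ∫ τ, contourKernel I α H γ τ • Z (-τ) v := by
  obtain ⟨K, hK0, hK⟩ := exists_contourIntegrand_bound (α := α) hI hH hγ h0 ha
  set Φ : ℝ → ℝ → ℍ[ℝ] := fun t τ =>
    H t * sliceEmb I ((γ t)⁻¹ ^ 2 * laplaceKernel (α + (γ t)⁻¹) τ) with hΦ
  have hΦm : StronglyMeasurable (Function.uncurry Φ) :=
    stronglyMeasurable_contourIntegrand I α hH hγ h0
  have hZc : Continuous fun τ => Z (-τ) v := (h.continuous v).comp continuous_neg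
  have hcinv : Continuous fun t => H t * sliceEmb I (γ t)⁻¹ :=
    hH.mul ((continuous_sliceEmb I).comp (hγ.inv₀ h0))
  have hae : ∀ᵐ p ∂((volume.restrict (Set.Ioc (0 : ℝ) 1)).prod (volume : Measure ℝ)),
      p.1 ∈ Set.Ioc (0 : ℝ) 1 := by
    rw [← Measure.restrict_univ (μ := (volume : Measure ℝ)), Measure.prod_restrict]
    filter_upwards [ae_restrict_mem (measurableSet_Ioc.prod MeasurableSet.univ)] with p hp
      using hp.1
  have hexp : Integrable fun τ : ℝ => Real.exp (-((a - ω) * |τ|)) :=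
    integrable_exp_neg_mul_abs (sub_pos.2 hωa)
  have hint : Integrable (Function.uncurry fun t τ => Φ t τ • Z (-τ) v)
      ((volume.restrict (Set.Ioc (0 : ℝ) 1)).prod volume) := by
    refine ((hexp.const_mul (K * M * ‖v‖)).comp_snd _).mono' ?_ ?_
    · exact (hΦm.smul (hZc.comp continuous_snd).stronglyMeasurable).aestronglyMeasurable
    · filter_upwards [hae] with p hp
      refine (norm_smul_le _ _).trans ?_
      have h1 := h.norm_le (-p.2) v
      rw [abs_neg] at h1
      calc _ ≤ (K * Real.exp (-(a * |p.2|))) * (M * Real.exp (ω * |p.2|) * ‖v‖) := by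
            gcongr
            exact hK p.1 hp p.2
        _ = K * M * ‖v‖ * (Real.exp (-(a * |p.2|)) * Real.exp (ω * |p.2|)) := by ring
        _ = _ := by rw [← Real.exp_add]; ring_nf
  -- Fubini's theorem collects the kernels along γ into a single density, which involves neither Z
  -- nor v.
  have hswap := integral_integral_swap hint
  have hΦi : ∀ τ, Integrable (fun t => Φ t τ) (volume.restrict (Set.Ioc (0 : ℝ) 1)) := fun τ =>
    Integrable.of_bound (hΦm.comp_measurable (measurable_id.prodMk measurable_const)).aestronglyMeasurable
      (K * Real.exp (-(a * |τ|))) (by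
        filter_upwards [ae_restrict_mem measurableSet_Ioc] with t ht using hK t ht τ)
  have hin : ∀ t, H t • rightSResolvent (sliceEmb I (γ t)) A v =
      (H t * sliceEmb I (γ t)⁻¹) • v - ∫ τ, Φ t τ • Z (-τ) v := fun t => by
    have hz : ω < |(α + (γ t)⁻¹).re| := hωa.trans_le (ha t)
    rw [h.rightSResolvent_apply hI (h0 t) hz, smul_sub, smul_smul, smul_smul, laplaceIntegral,
      ← integral_const_quaternion_smul (integrable_laplaceKernel h _ hz v)]
    simp_rw [jsmul_leftMul, smul_smul, hΦ, sliceEmb_mul hI, mul_assoc]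
  simp_rw [hin]
  rw [intervalIntegral.integral_of_le zero_le_one, integral_sub, hswap, contourConst,
    intervalIntegral.integral_of_le zero_le_one, integral_quaternion_smul_const, sub_eq_add_neg,
    ← integral_neg]
  · congr 1
    refine integral_congr_ae (.of_forall fun τ => ?_)
    simp only [contourKernel, intervalIntegral.integral_of_le zero_le_one, neg_smul]
    rw [integral_quaternion_smul_const (hΦi τ)]
  · exact hcinv.integrableOn_Ioc
  · exact (hcinv.smul continuous_const).integrableOn_Ioc
  · exact hint.integral_prod_left

end Contour

/-! ### Contour integrals along small circles about the base point -/

section Cycles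

/-- A positively oriented boundary is null homologous off the interior. -/
lemma IsPositiveJordanBoundary.isNullCycle {Ω D : Set ℂ} {n : ℕ} {γ : Fin n → ℝ → ℂ}
    (h : IsPositiveJordanBoundary D γ) (hb : Bornology.IsBounded D) (hΩ : IsOpen Ω)
    (hD : closure D ⊆ Ω) : IsNullCycle Ω γ (fun _ => 1) := by
  refine ⟨hΩ, fun k => (h.1.1 k).1, closure D, hb.isCompact_closure, hD, fun k t => ?_,
    (closure D)ᶜ, isClosed_closure.isOpen_compl, fun z => ?_, ?_, fun z hz _ => ?_⟩
  · refine frontier_subset_closure ?_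
    rw [← h.1.2]
    exact Set.mem_iUnion.2 ⟨k, t, rfl⟩
  · by_cases hz : z ∈ closure D
    · exact Or.inl (hD hz)
    · exact Or.inr hz
  · rw [← Bornology.isBounded_def]
    exact hb.closure
  · simpa using h.2.2 z hz

/-- A circle is null homologous in a larger disc. -/
lemma isNullCycle_orientedCircle {m ρ ρ' : ℝ} (hρ : 0 < ρ) (hρ' : ρ < ρ') :
    IsNullCycle (Metric.ball (m : ℂ) ρ') (fun _ : Unit => orientedCircle m ρ (-1)) (fun _ => 1) := by
  refine ⟨Metric.isOpen_ball, fun _ => contDiff_orientedCircle, Metric.closedBall (m : ℂ) ρ,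
    isCompact_closedBall _ _, Metric.closedBall_subset_ball hρ', fun _ t => ?_,
    (Metric.closedBall (m : ℂ) ρ)ᶜ, Metric.isClosed_closedBall.isOpen_compl, fun z => ?_, ?_,
    fun z hz _ => ?_⟩
  · have : orientedCircle m ρ (-1) t ∈ Set.range (orientedCircle m ρ (-1)) := ⟨t, rfl⟩
    rw [range_orientedCircle hρ (Or.inr rfl)] at this
    rw [mem_closedBall_iff_norm]
    exact le_of_eq this
  · by_cases hz : z ∈ Metric.closedBall (m : ℂ) ρ
    · exact Or.inl (Metric.closedBall_subset_ball hρ' hz)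
    · exact Or.inr hz
  · rw [← Bornology.isBounded_def]
    exact Metric.isBounded_closedBall
  · rw [Set.mem_compl_iff, mem_closedBall_iff_norm, not_le] at hz
    simp [windingNumber_orientedCircle_of_gt hρ (Or.inr rfl) hz]

lemma JDiffAt.comp_self {E : Type*} [NormedAddCommGroup E] [NormedSpace ℝ E] {J : E →L[ℝ] E}
    {Ψ : ℂ → E} {z : ℂ} (h : JDiffAt J Ψ z) : JDiffAt J (fun w => J (Ψ w)) z := by
  have h1 : HasFDerivAt (𝕜 := ℝ) (fun w => J (Ψ w)) (J.comp (fderiv ℝ Ψ z)) z :=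
    J.hasFDerivAt.comp z h.1.hasFDerivAt
  refine ⟨h1.differentiableAt, ?_⟩
  rw [h1.fderiv, ContinuousLinearMap.comp_apply, ContinuousLinearMap.comp_apply, h.2]

lemma JDiffAt.neg {E : Type*} [NormedAddCommGroup E] [NormedSpace ℝ E] {J : E →L[ℝ] E}
    {Ψ : ℂ → E} {z : ℂ} (h : JDiffAt J Ψ z) : JDiffAt J (fun w => -Ψ w) z := by
  refine ⟨h.1.neg, ?_⟩
  rw [fderiv_fun_neg, neg_apply, neg_apply, h.2, map_neg]

lemma RightSliceRegularOn.jDiffAt_mul_neg {f : ℍ[ℝ] → ℍ[ℝ]} {U : Set ℍ[ℝ]} {I : ℍ[ℝ]}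
    (hf : RightSliceRegularOn f U) (hI : I ∈ ImagUnits) {z : ℂ} (hz : z ∈ slice I U) :
    JDiffAt (rightMulCLM I) (fun w => f (sliceEmb I w) * -I) z := by
  have := (hf.jDiffAt hI hz).comp_self.neg
  simpa only [rightMulCLM_apply, mul_neg] using this

lemma mul_neg_sliceEmb_mul {I : ℍ[ℝ]} (q : ℍ[ℝ]) (z : ℂ) :
    q * (-(sliceEmb I z * I)) = q * -I * sliceEmb I z := by
  have : sliceEmb I z * I = I * sliceEmb I z := by
    simp [sliceEmb, mul_add, add_mul, Quaternion.mul_coe_eq_smul, Quaternion.coe_mul_eq_smul]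
  rw [this, mul_assoc, neg_mul]

end Cycles

section SmallCircle

set_option linter.unusedSectionVars false

variable {V : Type*} [NormedAddCommGroup V] [NormedSpace ℝ V] [CompleteSpace V]
  [Module ℍ[ℝ] V] [IsScalarTower ℝ ℍ[ℝ] V] [IsBoundedSMul ℍ[ℝ] V]
  [Module ℍ[ℝ]ᵐᵒᵖ V] [IsScalarTower ℝ ℍ[ℝ]ᵐᵒᵖ V] [IsBoundedSMul ℍ[ℝ]ᵐᵒᵖ V]
  [SMulCommClass ℍ[ℝ]ᵐᵒᵖ ℍ[ℝ] V]

variable {A : V →L[ℍ[ℝ]ᵐᵒᵖ] V} {I : ℍ[ℝ]} {α : ℝ} {γ : ℝ → ℂ} {f : ℍ[ℝ] → ℍ[ℝ]}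

/-- The contour integral along a curve that `q ↦ α + 1/q` maps to a small circle about `α`. -/
lemma integral_contour_small {O : Set ℍ[ℝ]} (hf : RightSliceRegularOn f O) (hI : I ∈ ImagUnits)
    (L : ℍ[ℝ]) {ρ ρ' : ℝ} (hρ : 0 < ρ) (hρ' : ρ < ρ')
    (hO : ∀ w : ℂ, ‖w‖ < ρ' → sliceEmb I (α + w) ∈ O)
    (hA : ∀ w : ℂ, ‖w‖ < ρ' → IsUnit (unitPencil A (sliceEmb I w)))
    (hγ : ContDiff ℝ 1 γ) (h0 : ∀ t, γ t ≠ 0)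
    (hc : ∀ t, α + (γ t)⁻¹ = orientedCircle α ρ (-1) t)
    (v : V) :
    ∫ t in (0 : ℝ)..1, contourDensity (invTransport f L α) I γ t •
        rightSResolvent (sliceEmb I (γ t)) A v =
      contourConst I (contourDensity (invTransport f L α) I γ) γ • v := by
  have hnorm : ∀ t, ‖(γ t)⁻¹‖ < ρ' := fun t => by
    have : orientedCircle α ρ (-1) t ∈ Set.range (orientedCircle α ρ (-1)) := ⟨t, rfl⟩
    rw [range_orientedCircle hρ (Or.inr rfl), ← hc] at this
    have h : ‖(γ t)⁻¹‖ = ρ := by simpa using this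
    rwa [h]
  have hball : ∀ z ∈ Metric.ball (α : ℂ) ρ', ‖z - α‖ < ρ' := fun z hz => by
    rwa [mem_ball_iff_norm] at hz
  have hd : ∀ t, deriv (orientedCircle α ρ (-1)) t = -(deriv γ t) * (γ t)⁻¹ ^ 2 := fun t => by
    have h1 : HasDerivAt (fun t => (α : ℂ) + (γ t)⁻¹) (-(deriv γ t) / γ t ^ 2) t :=
      (((hγ.differentiable one_ne_zero) t).hasDerivAt.inv (h0 t)).const_add _
    rw [show orientedCircle α ρ (-1) = fun t => (α : ℂ) + (γ t)⁻¹ from funext fun t => (hc t).symm,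
      h1.deriv, div_eq_mul_inv, inv_pow]
  set σ : ℂ → V →L[ℝ] V := sideResolvent (leftSliceHom V hI) (toRealCLM A) 1 with hσ
  have key := (isNullCycle_orientedCircle (m := α) hρ hρ').sum_integral_pairing_eq_zero hI
    (G := fun w => f (sliceEmb I w) * -I) (S := fun z => σ (z - α) (A v))
    (fun z hz => hf.jDiffAt_mul_neg hI (by
      have := hO _ (hball z hz)
      rwa [add_sub_cancel] at this))
    (fun z hz => JDiffAt.of_sideResolvent hI (b := fun _ => 1) (c := fun z => z - α)
      (differentiableAt_const _) (differentiableAt_id.sub_const _)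
      ((isUnit_quadPencil_one_left hI _).2 (hA _ (hball z hz))) (A v))
  simp only [Finset.univ_unique, Finset.sum_singleton, one_smul] at key
  have hg : ∀ t, invTransport f L α (sliceEmb I (γ t)) =
      f (sliceEmb I (orientedCircle α ρ (-1) t)) := fun t => by
    have hq' : sliceEmb I (γ t) ≠ 0 := by
      rw [← norm_ne_zero_iff, norm_sliceEmb hI, norm_ne_zero_iff]
      exact h0 t
    rw [invTransport_of_ne_zero hq', ← hc, sliceEmb_add, sliceEmb_ofReal, sliceEmb_inv hI,
      add_comm]
  have hcc : Continuous (orientedCircle α ρ (-1)) := contDiff_orientedCircle.continuous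
  have hmem : ∀ t, sliceEmb I (orientedCircle α ρ (-1) t) ∈ O := fun t => by
    rw [← hc]; exact hO _ (hnorm t)
  have hfc : Continuous fun t => f (sliceEmb I (orientedCircle α ρ (-1) t)) :=
    continuous_iff_continuousAt.2 fun t => ContinuousAt.comp
      (f := fun t => sliceEmb I (orientedCircle α ρ (-1) t)) (hf.2.1 _ (hmem t)).continuousAt
      ((continuous_sliceEmb I).comp hcc).continuousAt
  have hDc : Continuous (contourDensity (invTransport f L α) I γ) := by
    unfold contourDensity
    simp_rw [hg]
    exact hfc.mul (((continuous_sliceEmb I).comp (hγ.continuous_deriv le_rfl)).mul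
      continuous_const).neg
  -- Since dw = -q⁻² dq for w = 1/q, the second term is the form f dw paired with a left holomorphic
  -- function of w that is regular at 0. Its integral is `key`, hence zero, and only the constant
  -- part survives.
  have hpt : ∀ t, contourDensity (invTransport f L α) I γ t • rightSResolvent (sliceEmb I (γ t)) A v
      = (contourDensity (invTransport f L α) I γ t * sliceEmb I (γ t)⁻¹) • v -
        (f (sliceEmb I (orientedCircle α ρ (-1) t)) * -I *
          sliceEmb I (deriv (orientedCircle α ρ (-1)) t)) •
          σ (orientedCircle α ρ (-1) t - α) (A v) := fun t => by
    rw [smul_rightSResolvent_eq hI (h0 t) (hA _ (hnorm t)),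
      sideResolvent_one_apply hI (hA _ (hnorm t)), smul_add, smul_add, smul_smul, smul_smul,
      smul_smul, ← hc, add_sub_cancel_left, sub_eq_add_neg, ← neg_smul]
    congr 2
    rw [contourDensity, hg, hd, mul_neg_sliceEmb_mul, hc, mul_assoc, mul_assoc, ← sliceEmb_mul hI,
      ← sliceEmb_mul hI, ← mul_neg, ← sliceEmb_neg]
    congr 2
    ring
  have hi1 : Continuous fun t => contourDensity (invTransport f L α) I γ t * sliceEmb I (γ t)⁻¹ :=
    hDc.mul ((continuous_sliceEmb I).comp (hγ.continuous.inv₀ h0))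
  have hi2 : Continuous fun t => (f (sliceEmb I (orientedCircle α ρ (-1) t)) * -I *
      sliceEmb I (deriv (orientedCircle α ρ (-1)) t)) •
        σ (orientedCircle α ρ (-1) t - α) (A v) := by
    refine ((hfc.mul continuous_const).mul ((continuous_sliceEmb I).comp
      (contDiff_orientedCircle.continuous_deriv le_rfl))).smul ?_
    refine continuous_iff_continuousAt.2 fun t => ContinuousAt.comp
      (f := fun t => orientedCircle α ρ (-1) t - α) (g := fun w => σ w (A v)) ?_
      (hcc.sub continuous_const).continuousAt
    refine (JDiffAt.of_sideResolvent hI (b := fun _ => 1) (c := fun z => z)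
      (differentiableAt_const _) differentiableAt_id
      ((isUnit_quadPencil_one_left hI _).2 (hA _ ?_)) (A v)).1.continuousAt
    rw [← hc, add_sub_cancel_left]
    exact hnorm t
  simp_rw [hpt]
  have hi3 : Continuous fun t =>
      (contourDensity (invTransport f L α) I γ t * sliceEmb I (γ t)⁻¹) • v := hi1.smul continuous_const
  rw [intervalIntegral.integral_sub (hi3.intervalIntegrable _ _)
    (hi2.intervalIntegrable _ _), key, sub_zero, contourConst,
    intervalIntegral.integral_of_le zero_le_one, intervalIntegral.integral_of_le zero_le_one,
    integral_quaternion_smul_const hi1.integrableOn_Ioc]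

end SmallCircle

/-! ### Scalar groups -/

section Scalar

set_option linter.unusedSectionVars false

variable {V : Type*} [NormedAddCommGroup V] [NormedSpace ℝ V]
  [Module ℍ[ℝ] V] [IsScalarTower ℝ ℍ[ℝ] V] [IsBoundedSMul ℍ[ℝ] V]
  [Module ℍ[ℝ]ᵐᵒᵖ V] [IsScalarTower ℝ ℍ[ℝ]ᵐᵒᵖ V] [IsBoundedSMul ℍ[ℝ]ᵐᵒᵖ V]
  [SMulCommClass ℍ[ℝ]ᵐᵒᵖ ℍ[ℝ] V]

/-- The test group: for it the contour formula computes the Laplace transform of the kernel. -/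
lemma isGroupResolvent_scalar {x α : ℝ} (hx : x ≠ α) :
    IsGroupResolvent (fun t => Real.exp (t * x) • (1 : V →L[ℍ[ℝ]ᵐᵒᵖ] V)) 1 |x| α
      ((x - α)⁻¹ • (1 : V →L[ℍ[ℝ]ᵐᵒᵖ] V)) where
  nonneg_type := abs_nonneg x
  zero_apply v := by simp
  continuous v := by
    simp only [smul_apply, one_apply_eq_self]
    fun_prop
  norm_le t v := by
    rw [smul_apply, one_apply_eq_self, norm_smul, Real.norm_eq_abs, Real.abs_exp, one_mul]
    exact mul_le_mul_of_nonneg_right (Real.exp_le_exp.2 ((le_abs_self _).trans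
      (by rw [abs_mul, mul_comm]))) (norm_nonneg _)
  hasDerivAt v t := by
    simp only [smul_apply, one_apply_eq_self]
    have h1 : HasDerivAt (fun t : ℝ => Real.exp (t * x)) (Real.exp (t * x) * x) t := by
      simpa using ((hasDerivAt_id t).mul_const x).exp
    convert! h1.smul_const ((x - α)⁻¹ • v) using 1
    have : v = (x - α) • (x - α)⁻¹ • v := by
      rw [smul_smul, mul_inv_cancel₀ (sub_ne_zero.2 hx), one_smul]
    nth_rw 1 [this]
    module
  comm t v := by
    simp only [smul_apply, one_apply_eq_self]
    exact smul_comm _ _ _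

lemma isUnit_smul_one {c : ℝ} (hc : c ≠ 0) : IsUnit (c • (1 : V →L[ℍ[ℝ]ᵐᵒᵖ] V)) :=
  (isUnit_real_smul_iff hc).2 isUnit_one

lemma real_smul_one_mul (p : ℝ) (A : V →L[ℍ[ℝ]ᵐᵒᵖ] V) :
    (p • (1 : V →L[ℍ[ℝ]ᵐᵒᵖ] V)) * A = p • A := by
  ext v; simp

lemma isUnit_unitPencil_scalar {p : ℝ} {ζ : ℍ[ℝ]} (h : ‖ζ‖ * |p| < 1) :
    IsUnit (unitPencil (p • (1 : V →L[ℍ[ℝ]ᵐᵒᵖ] V)) ζ) := by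
  have e : unitPencil (p • (1 : V →L[ℍ[ℝ]ᵐᵒᵖ] V)) ζ =
      (1 - 2 * ζ.re * p + ‖ζ‖ ^ 2 * p ^ 2) • (1 : V →L[ℍ[ℝ]ᵐᵒᵖ] V) := by
    rw [unitPencil, real_smul_one_mul]
    module
  rw [e]
  refine isUnit_smul_one (ne_of_gt ?_)
  have h1 : |ζ.re| ≤ ‖ζ‖ := by
    obtain ⟨I, hI, w, rfl⟩ := exists_sliceEmb ζ
    rw [sliceEmb_re hI, norm_sliceEmb hI]
    exact Complex.abs_re_le_norm w
  have h2 : ζ.re * p ≤ ‖ζ‖ * |p| :=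
    (le_abs_self _).trans (by rw [abs_mul]; gcongr)
  have h3 : ‖ζ‖ ^ 2 * p ^ 2 = (‖ζ‖ * |p|) ^ 2 := by rw [mul_pow, sq_abs]
  nlinarith [sq_pos_of_pos (sub_pos.2 h)]

/-- For a real scalar operator the S-resolvent is the Cauchy kernel, which makes Cauchy's formula
available. -/
lemma rightSResolvent_scalar {p : ℝ} {s : ℍ[ℝ]} (h : s ≠ p) (v : V) :
    rightSResolvent s (p • (1 : V →L[ℍ[ℝ]ᵐᵒᵖ] V)) v = (s - p)⁻¹ • v := by
  have hc : ‖s - (p : ℍ[ℝ])‖ ^ 2 ≠ 0 := pow_ne_zero 2 (norm_ne_zero_iff.2 (sub_ne_zero.2 h))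
  have e : sPencil (p • (1 : V →L[ℍ[ℝ]ᵐᵒᵖ] V)) s =
      (‖s - (p : ℍ[ℝ])‖ ^ 2) • (1 : V →L[ℍ[ℝ]ᵐᵒᵖ] V) := by
    rw [sPencil, real_smul_one_mul, quaternion_norm_sub_coe_sq]
    module
  have e2 : Ring.inverse ((‖s - (p : ℍ[ℝ])‖ ^ 2) • (1 : V →L[ℍ[ℝ]ᵐᵒᵖ] V)) =
      (‖s - (p : ℍ[ℝ])‖ ^ 2)⁻¹ • (1 : V →L[ℍ[ℝ]ᵐᵒᵖ] V) := by
    refine Ring.inverse_unit (M₀ := V →L[ℍ[ℝ]ᵐᵒᵖ] V) ⟨_, (‖s - (p : ℍ[ℝ])‖ ^ 2)⁻¹ • 1, ?_, ?_⟩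
    · rw [real_smul_one_mul, smul_smul, mul_inv_cancel₀ hc, one_smul]
    · rw [real_smul_one_mul, smul_smul, inv_mul_cancel₀ hc, one_smul]
  rw [rightSResolvent, e, e2, rightLinear_mul_apply]
  simp only [neg_apply, sub_apply, smul_apply, one_apply_eq_self]
  rw [Quaternion.inv_def, Quaternion.normSq_eq_norm_mul_self, ← sq, star_sub, Quaternion.star_coe,
    smul_assoc, sub_smul, real_smul_eq_quaternion_smul, smul_sub, neg_sub, smul_comm (star s),
    smul_comm p]

end Scalar

/-! ### The contour integral over an adapted family of circles -/

namespace DiscFamily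

variable {n : ℕ} {α a b r η : ℝ} {D : DiscFamily n α} {k₀ : Fin n} {I : ℍ[ℝ]}

variable (D) in
/-- The disc `k` lies in `{a ≤ |Re z|}`. -/
def IsOuter (a : ℝ) (k : Fin n) : Prop := ∀ z : ℂ, ‖z - D.c k‖ ≤ D.ρ k → a ≤ |z.re|

variable (D) in
/-- The constant part of the contour integral. -/
noncomputable def const (g : ℍ[ℝ] → ℍ[ℝ]) (I : ℍ[ℝ]) : ℍ[ℝ] :=
  ∑ k, contourConst I (contourDensity g I (D.toCircleDomain.curve k)) (D.toCircleDomain.curve k)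

variable (D) in
open Classical in
/-- The Laplace density of the contour integral. -/
noncomputable def kernel (a : ℝ) (g : ℍ[ℝ] → ℍ[ℝ]) (I : ℍ[ℝ]) (τ : ℝ) : ℍ[ℝ] :=
  ∑ k with D.IsOuter a k, contourKernel I α (contourDensity g I (D.toCircleDomain.curve k))
    (D.toCircleDomain.curve k) τ

lemma IsAdapted.of_not_isOuter (hD : D.IsAdapted a b r η k₀) {k : Fin n} (h : ¬ D.IsOuter a k) :
    D.c k = α ∧ D.ρ k ≤ η ∧ |α| + D.ρ k < a := by
  rcases hD.cases k with h1 | h1 | h1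
  · exact absurd (fun z hz => (h1 z hz).trans (le_abs_self _)) h
  · exact absurd (fun z hz => by
      have := h1 z hz
      exact (by linarith : a ≤ -z.re).trans (neg_le_abs _)) h
  · exact h1

lemma IsAdapted.isPositiveJordanBoundary (hD : D.IsAdapted a b r η k₀) :
    IsPositiveJordanBoundary D.toCircleDomain.dom D.toCircleDomain.curve :=
  D.toCircleDomain.isPositiveJordanBoundary fun k => (D.σ_eq_one_iff k).trans (hD.inside k)

lemma IsAdapted.isBounded_domH (hD : D.IsAdapted a b r η k₀) :
    Bornology.IsBounded D.toCircleDomain.domH :=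
  D.toCircleDomain.isBounded_domH (k₀ := k₀) ((D.σ_eq_one_iff k₀).2 ((hD.inside k₀).2 rfl))

lemma IsAdapted.isBounded_dom (hD : D.IsAdapted a b r η k₀) :
    Bornology.IsBounded D.toCircleDomain.dom := by
  obtain ⟨I, hI⟩ := exists_imagUnit
  obtain ⟨C, hC⟩ := hD.isBounded_domH.exists_norm_le
  rw [isBounded_iff_forall_norm_le]
  refine ⟨C, fun z hz => ?_⟩
  rw [← D.toCircleDomain.slice_domH hI] at hz
  have := hC _ hz
  rwa [norm_sliceEmb hI] at this

/-- The domain of the transported function. -/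
def transportDomain (α b r : ℝ) : Set ℍ[ℝ] :=
  {p | p = 0 ∨ p⁻¹ + (α : ℍ[ℝ]) ∈ {s : ℍ[ℝ] | |s.re| < b} ∪ {s | r < ‖s‖}}

lemma IsAdapted.sliceEmb_mem (hD : D.IsAdapted a b r η k₀) (hI : I ∈ ImagUnits) {q : ℂ}
    (hq : ∀ k, 0 ≤ D.toCircleDomain.val k q) : sliceEmb I q ∈ transportDomain α b r := by
  by_cases h0 : q = 0
  · left
    rw [h0, sliceEmb_zero]
  · right
    have h1 : ∀ k, D.ρ k ≤ ‖(sliceEmb I q)⁻¹ + (α : ℍ[ℝ]) - (D.c k : ℍ[ℝ])‖ := fun k => by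
      have := ((D.val_nonneg_iff k q).1 (hq k)).resolve_left h0
      rwa [← norm_sliceEmb hI, sliceEmb_sub, sliceEmb_add, sliceEmb_ofReal, sliceEmb_ofReal,
        sliceEmb_inv hI, add_comm (α : ℍ[ℝ])] at this
    exact hD.compl _ h1

lemma IsAdapted.closure_dom_subset (hD : D.IsAdapted a b r η k₀) (hI : I ∈ ImagUnits) :
    closure D.toCircleDomain.dom ⊆ slice I (transportDomain α b r) := fun _ hq =>
  hD.sliceEmb_mem hI (D.toCircleDomain.closure_dom_subset hq)

lemma IsAdapted.closure_domH_subset (hD : D.IsAdapted a b r η k₀) :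
    closure D.toCircleDomain.domH ⊆ transportDomain α b r := fun s hs => by
  have h := D.toCircleDomain.closure_domH_subset hs
  obtain ⟨I, hI, q, rfl⟩ := exists_sliceEmb s
  refine hD.sliceEmb_mem hI fun k => ?_
  have := h k
  rwa [← sliceEmb_ofReal (I := I), ← sliceEmb_sub, norm_sliceEmb hI] at this

lemma curve_mem_closure (k : Fin n) (t : ℝ) :
    D.toCircleDomain.curve k t ∈ closure D.toCircleDomain.dom := by
  refine D.toCircleDomain.mem_closure_of_val_eq_zero (k := k) ?_
  have : D.toCircleDomain.curve k t ∈ Set.range (D.toCircleDomain.curve k) := ⟨t, rfl⟩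
  rwa [D.toCircleDomain.range_curve] at this

lemma contDiff_curve (k : Fin n) : ContDiff ℝ 1 (D.toCircleDomain.curve k) :=
  contDiff_orientedCircle

lemma IsAdapted.continuous_density (hD : D.IsAdapted a b r η k₀) (hI : I ∈ ImagUnits)
    {g : ℍ[ℝ] → ℍ[ℝ]} (hg : RightSliceRegularOn g (transportDomain α b r)) (k : Fin n) :
    Continuous (contourDensity g I (D.toCircleDomain.curve k)) := by
  have hc := (contDiff_curve (D := D) k).continuous
  have h1 : Continuous fun t => g (sliceEmb I (D.toCircleDomain.curve k t)) :=
    continuous_iff_continuousAt.2 fun t => ContinuousAt.comp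
      (f := fun t => sliceEmb I (D.toCircleDomain.curve k t))
      (hg.2.1 _ (hD.closure_dom_subset hI (curve_mem_closure k t))).continuousAt
      ((continuous_sliceEmb I).comp hc).continuousAt
  exact h1.mul (((continuous_sliceEmb I).comp ((contDiff_curve k).continuous_deriv le_rfl)).mul
    continuous_const).neg

lemma IsOuter.le_abs_re {k : Fin n} (h : D.IsOuter a k) (t : ℝ) :
    a ≤ |(α + (D.toCircleDomain.curve k t)⁻¹).re| := h _ (D.curve_spec k t).2.le

lemma IsAdapted.stronglyMeasurable_kernel (hD : D.IsAdapted a b r η k₀) (hI : I ∈ ImagUnits)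
    {g : ℍ[ℝ] → ℍ[ℝ]} (hg : RightSliceRegularOn g (transportDomain α b r)) :
    StronglyMeasurable (D.kernel a g I) :=
  Finset.stronglyMeasurable_fun_sum _ fun k _ => stronglyMeasurable_contourKernel I α
    (hD.continuous_density hI hg k) (contDiff_curve k).continuous fun t => (D.curve_spec k t).1

lemma IsAdapted.exists_kernel_bound (hD : D.IsAdapted a b r η k₀) (hI : I ∈ ImagUnits)
    {g : ℍ[ℝ] → ℍ[ℝ]} (hg : RightSliceRegularOn g (transportDomain α b r)) :
    ∃ K, ∀ τ, ‖D.kernel a g I τ‖ ≤ K * Real.exp (-(a * |τ|)) := by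
  classical
  have h : ∀ k, ∃ K, D.IsOuter a k → ∀ τ, ‖contourKernel I α
      (contourDensity g I (D.toCircleDomain.curve k)) (D.toCircleDomain.curve k) τ‖ ≤
        K * Real.exp (-(a * |τ|)) := fun k => by
    by_cases ho : D.IsOuter a k
    · obtain ⟨K, hK⟩ := exists_contourKernel_bound (α := α) hI (hD.continuous_density hI hg k)
        (contDiff_curve k).continuous (fun t => (D.curve_spec k t).1) ho.le_abs_re
      exact ⟨K, fun _ => hK⟩
    · exact ⟨0, fun h => absurd h ho⟩
  choose K hK using h
  refine ⟨∑ k with D.IsOuter a k, K k, fun τ => ?_⟩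
  rw [Finset.sum_mul]
  refine (norm_sum_le _ _).trans (Finset.sum_le_sum fun k hk => ?_)
  exact hK k (Finset.mem_filter.1 hk).2 τ

section Operators

set_option linter.unusedSectionVars false

variable {V : Type*} [NormedAddCommGroup V] [NormedSpace ℝ V]
  [Module ℍ[ℝ] V] [IsScalarTower ℝ ℍ[ℝ] V] [IsBoundedSMul ℍ[ℝ] V]
  [Module ℍ[ℝ]ᵐᵒᵖ V] [IsScalarTower ℝ ℍ[ℝ]ᵐᵒᵖ V] [IsBoundedSMul ℍ[ℝ]ᵐᵒᵖ V]
  [SMulCommClass ℍ[ℝ]ᵐᵒᵖ ℍ[ℝ] V]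

variable {Z : ℝ → V →L[ℍ[ℝ]ᵐᵒᵖ] V} {M ω : ℝ} {A : V →L[ℍ[ℝ]ᵐᵒᵖ] V}

lemma _root_.IsGroupResolvent.integrable_smul (h : IsGroupResolvent Z M ω α A) {k : ℝ → ℍ[ℝ]}
    (hk : StronglyMeasurable k) {K : ℝ} (hK : ∀ τ, ‖k τ‖ ≤ K * Real.exp (-(a * |τ|))) (hωa : ω < a)
    (v : V) : Integrable fun τ => k τ • Z (-τ) v := by
  refine ((integrable_exp_neg_mul_abs (sub_pos.2 hωa)).const_mul (K * M * ‖v‖)).mono' ?_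
    (.of_forall fun τ => ?_)
  · exact (hk.smul ((h.continuous v).comp continuous_neg).stronglyMeasurable).aestronglyMeasurable
  · refine (norm_smul_le _ _).trans ?_
    have h1 := h.norm_le (-τ) v
    rw [abs_neg] at h1
    calc _ ≤ (K * Real.exp (-(a * |τ|))) * (M * Real.exp (ω * |τ|) * ‖v‖) :=
          mul_le_mul (hK τ) h1 (norm_nonneg _) ((norm_nonneg _).trans (hK τ))
      _ = K * M * ‖v‖ * (Real.exp (-(a * |τ|)) * Real.exp (ω * |τ|)) := by ring
      _ = _ := by rw [← Real.exp_add]; ring_nf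

/-- A circle centred at α corresponds to the positively oriented circle of radius 1/ρ about 0;
inversion reverses the orientation, hence the -1. -/
lemma add_inv_curve_of_center {k : Fin n} (hc : D.c k = α) (t : ℝ) :
    α + (D.toCircleDomain.curve k t)⁻¹ = orientedCircle α (D.ρ k) (-1) t := by
  have hρ := D.ρ_pos k
  have hσ : D.toCircleDomain.σ k = 1 := by
    rw [D.σ_eq_one_iff, hc, sub_self, abs_zero]
    exact hρ
  have hm : D.toCircleDomain.m k = 0 := by
    change (D.c k - α) / D.pow k = 0
    rw [hc, sub_self, zero_div]
  have hR : D.toCircleDomain.R k = (D.ρ k)⁻¹ := by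
    change D.ρ k / |D.pow k| = _
    rw [pow, hc, sub_self, zero_pow two_ne_zero, zero_sub, abs_neg, abs_of_pos (by positivity)]
    field_simp
  have hρ' : (D.ρ k : ℂ) ≠ 0 := by exact_mod_cast hρ.ne'
  rw [CircleDomain.curve, hσ, hm, hR, orientedCircle, orientedCircle, circleMap, circleMap]
  push_cast
  rw [zero_add, mul_inv, inv_inv, ← Complex.exp_neg]
  ring_nf

/-- The contour integral over the circles of an adapted family, in terms of the group. -/
theorem IsAdapted.sum_integral_eq [CompleteSpace V] (hD : D.IsAdapted a b r η k₀)
    (hI : I ∈ ImagUnits) {f : ℍ[ℝ] → ℍ[ℝ]} {L : ℍ[ℝ]} (hab : a < b)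
    (hf : RightSliceRegularOn f ({s : ℍ[ℝ] | |s.re| < b} ∪ {s | r < ‖s‖}))
    (hg : RightSliceRegularOn (invTransport f L α) (transportDomain α b r))
    (h : IsGroupResolvent Z M ω α A) (hωa : ω < a)
    (hA : ∀ k, ¬ D.IsOuter a k → ∃ ρ', D.ρ k < ρ' ∧ ∀ ζ : ℍ[ℝ], ‖ζ‖ < ρ' → IsUnit (unitPencil A ζ))
    (v : V) :
    ∑ k, ∫ t in (0 : ℝ)..1, contourDensity (invTransport f L α) I (D.toCircleDomain.curve k) t •
        rightSResolvent (sliceEmb I (D.toCircleDomain.curve k t)) A v =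
      D.const (invTransport f L α) I • v + ∫ τ, D.kernel a (invTransport f L α) I τ • Z (-τ) v := by
  classical
  set g := invTransport f L α
  set H := fun k => contourDensity g I (D.toCircleDomain.curve k)
  have hH : ∀ k, Continuous (H k) := hD.continuous_density hI hg
  have hγ : ∀ k, Continuous (D.toCircleDomain.curve k) := fun k => (contDiff_curve k).continuous
  have h0 : ∀ k t, D.toCircleDomain.curve k t ≠ 0 := fun k t => (D.curve_spec k t).1
  have hterm : ∀ k, ∫ t in (0 : ℝ)..1, H k t •
      rightSResolvent (sliceEmb I (D.toCircleDomain.curve k t)) A v =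
      contourConst I (H k) (D.toCircleDomain.curve k) • v + if D.IsOuter a k then
        ∫ τ, contourKernel I α (H k) (D.toCircleDomain.curve k) τ • Z (-τ) v else 0 := by
    intro k
    split_ifs with ho
    · exact h.integral_contour hI (hH k) (hγ k) (h0 k) ho.le_abs_re hωa v
    · rw [add_zero]
      obtain ⟨h1, -, h2⟩ := hD.of_not_isOuter ho
      obtain ⟨ρ', h3, h4⟩ := hA k ho
      -- Within ρ' the pencil of A is invertible, and within b - |α| the point α + w stays in the
      -- strip, where f is regular.
      have hlt : D.ρ k < min ρ' (b - |α|) := lt_min h3 (by linarith)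
      refine integral_contour_small hf hI L (D.ρ_pos k) hlt (fun w hw => Or.inl ?_)
        (fun w hw => h4 _ ?_) (contDiff_curve k) (h0 k) (add_inv_curve_of_center h1) v
      · have h5 : ‖w‖ < b - |α| := hw.trans_le (min_le_right _ _)
        change |(sliceEmb I (α + w)).re| < b
        rw [sliceEmb_re hI, Complex.add_re, Complex.ofReal_re]
        have h6 := abs_add_le α w.re
        have h7 := Complex.abs_re_le_norm w
        linarith
      · rw [norm_sliceEmb hI]
        exact hw.trans_le (min_le_left _ _)
  rw [Finset.sum_congr rfl fun k _ => hterm k, Finset.sum_add_distrib, ← Finset.sum_smul,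
    ← Finset.sum_filter, ← integral_finsetSum]
  · simp_rw [const, kernel, Finset.sum_smul]
    rfl
  · intro k hk
    have ho := (Finset.mem_filter.1 hk).2
    obtain ⟨K, hK⟩ := exists_contourKernel_bound (α := α) hI (hH k) (hγ k) (h0 k) ho.le_abs_re
    exact h.integrable_smul (stronglyMeasurable_contourKernel I α (hH k) (hγ k) (h0 k)) hK hωa v

end Operators

/-- The function `f` on the real line as a Laplace transform. -/
theorem IsAdapted.laplace_eq (hD : D.IsAdapted a b r η k₀)
    (hI : I ∈ ImagUnits) {f : ℍ[ℝ] → ℍ[ℝ]} {L : ℍ[ℝ]} (hab : a < b)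
    (hf : RightSliceRegularOn f ({s : ℍ[ℝ] | |s.re| < b} ∪ {s | r < ‖s‖}))
    (hg : RightSliceRegularOn (invTransport f L α) (transportDomain α b r))
    {x : ℝ} (hxa : |x| < a) (hxα : x ≠ α) (hxρ : ∀ k, ¬ D.IsOuter a k → D.ρ k < |x - α|) :
    D.const (invTransport f L α) I +
      ∫ τ, Real.exp (-(τ * x)) • D.kernel a (invTransport f L α) I τ =
      (2 * Real.pi) • f x := by
  set p : ℝ := (x - α)⁻¹ with hp
  have hxα' : x - α ≠ 0 := sub_ne_zero.2 hxα
  have hp0 : p ≠ 0 := inv_ne_zero hxα'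
  -- The contour formula for the scalar group e^(tx) on V = ℍ, applied to v = 1. The constant and
  -- the kernel are the same as for any other group.
  have h1 := hD.sum_integral_eq hI hab hf hg (isGroupResolvent_scalar (V := ℍ[ℝ]) hxα) hxa
    (fun k hk => ⟨|x - α|, hxρ k hk, fun ζ hζ => isUnit_unitPencil_scalar (by
      rw [abs_inv, ← div_eq_mul_inv, div_lt_one (abs_pos.2 hxα')]
      exact hζ)⟩) (1 : ℍ[ℝ])
  -- The point p corresponds to z = x, which lies in none of the discs.
  have hpdom : (p : ℂ) ∈ D.toCircleDomain.dom := fun k => by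
    rw [← not_le, D.val_nonpos_iff]
    rintro ⟨-, h⟩
    have e : (α : ℂ) + (p : ℂ)⁻¹ = (x : ℂ) := by
      rw [hp]; push_cast; rw [inv_inv]; ring
    rw [e] at h
    by_cases ho : D.IsOuter a k
    · have := ho _ h
      rw [Complex.ofReal_re] at this
      linarith
    · rw [(hD.of_not_isOuter ho).1, ← Complex.ofReal_sub, Complex.norm_real, Real.norm_eq_abs] at h
      linarith [hxρ k ho]
  obtain ⟨δ, hδ, hball⟩ := Metric.isOpen_iff.1 D.toCircleDomain.isOpen_dom _ hpdom
  have hdist : ∀ k t, δ ≤ ‖D.toCircleDomain.curve k t - p‖ := fun k t => by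
    by_contra! h
    have h2 : D.toCircleDomain.curve k t ∈ D.toCircleDomain.dom :=
      hball (by rwa [mem_ball_iff_norm])
    have h3 : D.toCircleDomain.curve k t ∈ Set.range (D.toCircleDomain.curve k) := ⟨t, rfl⟩
    rw [D.toCircleDomain.range_curve] at h3
    exact (h2 k).ne' h3
  have hne : ∀ k t, sliceEmb I (D.toCircleDomain.curve k t) ≠ (p : ℍ[ℝ]) := fun k t h => by
    rw [← sliceEmb_ofReal (I := I), ← sub_eq_zero, ← sliceEmb_sub, ← norm_eq_zero,
      norm_sliceEmb hI] at h
    linarith [hdist k t]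
  have hpΩ : (p : ℂ) ∈ slice I (transportDomain α b r) :=
    hD.closure_dom_subset hI (subset_closure hpdom)
  -- Cauchy's formula at p evaluates the same integral: the winding numbers add up to 1, and the
  -- factor 2πI cancels against the -I of ds_I, leaving 2π g(p) = 2π f(x).
  have h2 := (hD.isPositiveJordanBoundary.isNullCycle hD.isBounded_dom
    (hg.1.preimage (continuous_sliceEmb I)) (hD.closure_dom_subset hI)).sum_integral_jsmul_inv_sub
    (rightMulCLM_sq hI) (fun z hz => hg.jDiffAt_mul_neg hI hz) hpΩ hδ hdist
  have hgp : invTransport f L α (sliceEmb I p) = f x := by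
    rw [sliceEmb_ofReal, invTransport_of_ne_zero (fun h => hp0 (Quaternion.coe_injective h)), ← Quaternion.coe_inv, hp,
      inv_inv, ← Quaternion.coe_add, sub_add_cancel]
  have hII : sliceEmb I (2 * Real.pi * Complex.I) = (2 * Real.pi) • I := by
    simp [sliceEmb]
  simp only [Complex.ofReal_one, one_mul, hD.isPositiveJordanBoundary.2.1 _ hpdom, mul_one,
    jsmul_rightMul, hgp, one_smul, hII] at h2
  rw [show f x * -I * ((2 * Real.pi) • I) = (2 * Real.pi) • f x by
    rw [mul_smul_comm, mul_assoc, neg_mul, ImagUnits.mul_self hI, neg_neg, mul_one]] at h2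
  simp only [smul_eq_mul, mul_one, smul_apply, one_apply_eq_self] at h1
  have hR : ∫ τ, Real.exp (-(τ * x)) • D.kernel a (invTransport f L α) I τ =
      ∫ τ, D.kernel a (invTransport f L α) I τ * Real.exp (-τ * x) • (1 : ℍ[ℝ]) := by
    refine integral_congr_ae (.of_forall fun τ => ?_)
    simp
  rw [hR, ← h1, ← h2]
  refine Finset.sum_congr rfl fun k _ => intervalIntegral.integral_congr fun t _ => ?_
  rw [rightSResolvent_scalar (hne k t), smul_eq_mul, mul_one, contourDensity,
    mul_neg_sliceEmb_mul, ← sliceEmb_ofReal (I := I), ← sliceEmb_sub, ← sliceEmb_inv hI,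
    sliceEmb_mul hI, mul_assoc]

end DiscFamily

/-! ### Uniqueness of bilateral Laplace transforms -/

section LaplaceUniqueness

/-- Finite measures with exponential moments are determined by their Laplace transforms on an
interval. -/
lemma Measure.ext_of_laplace {P N : Measure ℝ} [IsFiniteMeasure P] [IsFiniteMeasure N] {a x₀ x₁ : ℝ}
    (hP : ∀ c < a, Integrable (fun t => Real.exp (c * |t|)) P)
    (hN : ∀ c < a, Integrable (fun t => Real.exp (c * |t|)) N) (ha : 0 < a) (h01 : x₀ < x₁)
    (h0 : -a ≤ x₀) (h1 : x₁ ≤ a)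
    (h : ∀ x ∈ Set.Ioo x₀ x₁, ∫ t, Real.exp (-(t * x)) ∂P = ∫ t, Real.exp (-(t * x)) ∂N) : P = N := by
  have hint : ∀ Q : Measure ℝ, (∀ c < a, Integrable (fun t => Real.exp (c * |t|)) Q) →
      Set.Ioo (-a) a ⊆ interior (ProbabilityTheory.integrableExpSet id Q) := fun Q hQ => by
    refine interior_maximal (fun y hy => ?_) isOpen_Ioo
    refine (hQ |y| (abs_lt.2 hy)).mono' (by fun_prop) (.of_forall fun t => ?_)
    rw [Real.norm_eq_abs, Real.abs_exp]
    refine Real.exp_le_exp.2 ((le_abs_self _).trans ?_)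
    rw [abs_mul, id]
  -- The complex moment generating functions are analytic on this strip and agree on a real
  -- interval, so by the identity theorem they agree on the imaginary axis, where they are the
  -- characteristic functions.
  set S : Set ℂ := {z | z.re ∈ Set.Ioo (-a) a} with hS
  have hSp : IsPreconnected S :=
    ((convex_Ioo (-a) a).linear_preimage Complex.reLm).isPreconnected
  have hPa : AnalyticOnNhd ℂ (ProbabilityTheory.complexMGF id P) S :=
    ProbabilityTheory.analyticOnNhd_complexMGF.mono fun z hz => hint P hP hz
  have hNa : AnalyticOnNhd ℂ (ProbabilityTheory.complexMGF id N) S :=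
    ProbabilityTheory.analyticOnNhd_complexMGF.mono fun z hz => hint N hN hz
  have heq : ∀ y ∈ Set.Ioo (-x₁) (-x₀), ProbabilityTheory.complexMGF id P y =
      ProbabilityTheory.complexMGF id N y := fun y hy => by
    rw [ProbabilityTheory.complexMGF_ofReal, ProbabilityTheory.complexMGF_ofReal]
    have := h (-y) ⟨by linarith [hy.2], by linarith [hy.1]⟩
    simp only [mul_neg, neg_neg] at this
    simp only [ProbabilityTheory.mgf, id, mul_comm y]
    rw [this]
  obtain ⟨y, hy⟩ : (Set.Ioo (-x₁) (-x₀)).Nonempty := Set.nonempty_Ioo.2 (by linarith)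
  have hfreq : ∃ᶠ z in 𝓝[≠] (y : ℂ), ProbabilityTheory.complexMGF id P z =
      ProbabilityTheory.complexMGF id N z := by
    have h2 : ∃ᶠ x : ℝ in 𝓝[≠] y, ProbabilityTheory.complexMGF id P x =
        ProbabilityTheory.complexMGF id N x := by
      refine Eventually.frequently ?_
      filter_upwards [mem_nhdsWithin_of_mem_nhds (isOpen_Ioo.mem_nhds hy)] with x hx using heq x hx
    refine Tendsto.frequently (f := fun x : ℝ => (x : ℂ)) ?_ h2
    refine tendsto_nhdsWithin_iff.2 ⟨?_, ?_⟩
    · exact (Complex.continuous_ofReal.tendsto y).mono_left nhdsWithin_le_nhds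
    · filter_upwards [self_mem_nhdsWithin] with x hx
      simpa using hx
  have hE := hPa.eqOn_of_preconnected_of_frequently_eq hNa hSp (z₀ := (y : ℂ))
    (show (y : ℂ).re ∈ Set.Ioo (-a) a from
      ⟨by rw [Complex.ofReal_re]; linarith [hy.1], by rw [Complex.ofReal_re]; linarith [hy.2]⟩) hfreq
  refine Measure.ext_of_charFun (funext fun t => ?_)
  rw [← ProbabilityTheory.complexMGF_id_mul_I, ← ProbabilityTheory.complexMGF_id_mul_I]
  exact hE (by simp [hS, ha])

section Parts

variable {E : Type*} [NormedAddCommGroup E] [NormedSpace ℝ E] {ν : Measure ℝ} {φ : ℝ → ℝ} {a c M : ℝ}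

lemma integrable_smul_of_le_exp (hφm : Measurable φ)
    (hφ : ∀ c < a, Integrable (fun t => Real.exp (c * |t|) * φ t) ν) {G : ℝ → E}
    (hG : StronglyMeasurable G) (hGb : ∀ t, ‖G t‖ ≤ M * Real.exp (c * |t|)) (hc : c < a) :
    Integrable (fun t => φ t • G t) ν := by
  refine ((hφ c hc).norm.const_mul M).mono'
    (hφm.stronglyMeasurable.smul hG).aestronglyMeasurable (.of_forall fun t => ?_)
  rw [norm_smul, norm_mul, Real.norm_of_nonneg (Real.exp_pos _).le]
  calc _ ≤ ‖φ t‖ * (M * Real.exp (c * |t|)) := by gcongr; exact hGb t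
    _ = _ := by ring

lemma integrable_withDensity_of_le_exp (hφm : Measurable φ)
    (hφ : ∀ c < a, Integrable (fun t => Real.exp (c * |t|) * φ t) ν) {G : ℝ → E}
    (hG : StronglyMeasurable G) (hGb : ∀ t, ‖G t‖ ≤ M * Real.exp (c * |t|)) (hc : c < a) :
    Integrable G (ν.withDensity fun t => ENNReal.ofReal (φ t)) := by
  rw [integrable_withDensity_iff_integrable_smul' hφm.ennreal_ofReal (by simp)]
  refine (integrable_smul_of_le_exp hφm hφ hG hGb hc).mono
    (hφm.ennreal_ofReal.ennreal_toReal.stronglyMeasurable.smul hG).aestronglyMeasurable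
    (.of_forall fun t => ?_)
  rw [norm_smul, norm_smul, ENNReal.toReal_ofReal', Real.norm_eq_abs, Real.norm_eq_abs,
    abs_of_nonneg (le_max_right _ _)]
  gcongr
  exact max_le (le_abs_self _) (abs_nonneg _)

lemma integral_withDensity_sub (hφm : Measurable φ)
    (hφ : ∀ c < a, Integrable (fun t => Real.exp (c * |t|) * φ t) ν) {G : ℝ → E}
    (hG : StronglyMeasurable G) (hGb : ∀ t, ‖G t‖ ≤ M * Real.exp (c * |t|)) (hc : c < a) :
    ∫ t, G t ∂(ν.withDensity fun t => ENNReal.ofReal (φ t)) -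
      ∫ t, G t ∂(ν.withDensity fun t => ENNReal.ofReal (-φ t)) = ∫ t, φ t • G t ∂ν := by
  have hφ' : ∀ c < a, Integrable (fun t => Real.exp (c * |t|) * -φ t) ν := fun c hc => by
    simpa using (hφ c hc).neg
  have hm : Measurable fun t => -φ t := hφm.neg
  have h1 := integrable_withDensity_of_le_exp hφm hφ hG hGb hc
  have h2 := integrable_withDensity_of_le_exp hm hφ' hG hGb hc
  rw [integrable_withDensity_iff_integrable_smul' hφm.ennreal_ofReal (by simp)] at h1
  rw [integrable_withDensity_iff_integrable_smul' hm.ennreal_ofReal (by simp)] at h2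
  rw [integral_withDensity_eq_integral_toReal_smul hφm.ennreal_ofReal (by simp),
    integral_withDensity_eq_integral_toReal_smul hm.ennreal_ofReal (by simp)]
  rw [← integral_sub h1 h2]
  refine integral_congr_ae (.of_forall fun t => ?_)
  simp only [ENNReal.toReal_ofReal', ← sub_smul]
  congr 1
  rcases le_total 0 (φ t) with h | h
  · rw [max_eq_left h, max_eq_right (by linarith), sub_zero]
  · rw [max_eq_right h, max_eq_left (by linarith)]; ring

variable {ι : Type*} [Fintype ι] {ν : ι → Measure ℝ} {φ : ι → ℝ → ℝ} {x₀ x₁ : ℝ}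

lemma integral_sum_withDensity_sub (hφm : ∀ i, Measurable (φ i))
    (hφ : ∀ i, ∀ c < a, Integrable (fun t => Real.exp (c * |t|) * φ i t) (ν i)) {G : ℝ → E}
    (hG : StronglyMeasurable G) (hGb : ∀ t, ‖G t‖ ≤ M * Real.exp (c * |t|)) (hc : c < a) :
    ∫ t, G t ∂(∑ i, (ν i).withDensity fun t => ENNReal.ofReal (φ i t)) -
      ∫ t, G t ∂(∑ i, (ν i).withDensity fun t => ENNReal.ofReal (-φ i t)) =
      ∑ i, ∫ t, φ i t • G t ∂(ν i) := by
  rw [integral_finsetSum_measure fun i _ =>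
      integrable_withDensity_of_le_exp (hφm i) (hφ i) hG hGb hc,
    integral_finsetSum_measure fun i _ => integrable_withDensity_of_le_exp (φ := fun t => -φ i t)
      (hφm i).neg (fun c hc => by simpa using (hφ i c hc).neg) hG hGb hc, ← Finset.sum_sub_distrib]
  exact Finset.sum_congr rfl fun i _ => integral_withDensity_sub (hφm i) (hφ i) hG hGb hc

/-- A linear combination of real Laplace transforms that vanishes on an interval vanishes for all
vector valued functions of smaller growth. -/
lemma sum_integral_smul_eq_zero_of_laplace (hφm : ∀ i, Measurable (φ i))
    (hφ : ∀ i, ∀ c < a, Integrable (fun t => Real.exp (c * |t|) * φ i t) (ν i)) (ha : 0 < a)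
    (h01 : x₀ < x₁) (h0 : -a ≤ x₀) (h1 : x₁ ≤ a)
    (h : ∀ x ∈ Set.Ioo x₀ x₁, ∑ i, ∫ t, Real.exp (-(t * x)) * φ i t ∂(ν i) = 0) {F : ℝ → E}
    (hF : StronglyMeasurable F) (hFb : ∀ t, ‖F t‖ ≤ M * Real.exp (c * |t|)) (hc : c < a) :
    ∑ i, ∫ t, φ i t • F t ∂(ν i) = 0 := by
  have hφ' : ∀ i, ∀ c < a, Integrable (fun t => Real.exp (c * |t|) * -φ i t) (ν i) := fun i c hc => by
    simpa using (hφ i c hc).neg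
  have hm : ∀ i, Measurable fun t => -φ i t := fun i => (hφm i).neg
  -- Collecting the positive and the negative parts of the densities turns the relation into an
  -- equality of the Laplace transforms of two finite positive measures.
  set P : Measure ℝ := ∑ i, (ν i).withDensity fun t => ENNReal.ofReal (φ i t) with hP
  set N : Measure ℝ := ∑ i, (ν i).withDensity fun t => ENNReal.ofReal (-φ i t) with hN
  have hfin : ∀ i, Integrable (φ i) (ν i) := fun i => by simpa using hφ i 0 ha
  have : ∀ i, IsFiniteMeasure ((ν i).withDensity fun t => ENNReal.ofReal (φ i t)) := fun i =>
    isFiniteMeasure_withDensity_ofReal (hfin i).2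
  have : ∀ i, IsFiniteMeasure ((ν i).withDensity fun t => ENNReal.ofReal (-φ i t)) := fun i =>
    isFiniteMeasure_withDensity_ofReal (hfin i).neg.2
  have : IsFiniteMeasure P := by rw [hP]; infer_instance
  have : IsFiniteMeasure N := by rw [hN]; infer_instance
  have hexpm : ∀ c : ℝ, StronglyMeasurable fun t : ℝ => Real.exp (c * |t|) := fun c =>
    Continuous.stronglyMeasurable (by fun_prop)
  have hexpb : ∀ c t : ℝ, ‖Real.exp (c * |t|)‖ ≤ 1 * Real.exp (c * |t|) := fun c t => by simp
  have hPN : P = N := by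
    refine Measure.ext_of_laplace (a := a) (fun c hc => ?_) (fun c hc => ?_) ha h01 h0 h1
      fun x hx => ?_
    · exact integrable_finsetSum_measure.2 fun i _ =>
        integrable_withDensity_of_le_exp (hφm i) (hφ i) (hexpm c) (hexpb c) hc
    · exact integrable_finsetSum_measure.2 fun i _ =>
        integrable_withDensity_of_le_exp (hm i) (hφ' i) (hexpm c) (hexpb c) hc
    · rw [← sub_eq_zero]
      have hxa : |x| < a := abs_lt.2 ⟨by linarith [hx.1], by linarith [hx.2]⟩
      rw [integral_sum_withDensity_sub hφm hφ (G := fun t : ℝ => Real.exp (-(t * x))) (M := 1) (c := |x|)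
        (Continuous.stronglyMeasurable (by fun_prop)) (fun t => ?_) hxa]
      · rw [← h x hx]
        refine Finset.sum_congr rfl fun i _ => integral_congr_ae (.of_forall fun t => ?_)
        simp [mul_comm]
      · rw [Real.norm_eq_abs, Real.abs_exp, one_mul]
        refine Real.exp_le_exp.2 ((le_abs_self _).trans ?_)
        rw [abs_neg, abs_mul, mul_comm]
  rw [← integral_sum_withDensity_sub hφm hφ hF hFb hc, ← hP, ← hN, hPN, sub_self]

end Parts

section Quaternionic

variable {V : Type*} [NormedAddCommGroup V] [NormedSpace ℝ V] [Module ℍ[ℝ] V]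
  [IsScalarTower ℝ ℍ[ℝ] V] [IsBoundedSMul ℍ[ℝ] V]
variable {ι : Type*} [Fintype ι] {ν : ι → Measure ℝ} {φ : ι → ℝ → ℍ[ℝ]} {a c M x₀ x₁ : ℝ}

/-- A linear combination of quaternionic Laplace transforms that vanishes on an interval vanishes
for all vector valued functions of smaller growth. -/
lemma sum_integral_quaternion_smul_eq_zero_of_laplace (hφm : ∀ i, StronglyMeasurable (φ i))
    (hφ : ∀ i, ∀ c < a, Integrable (fun t => Real.exp (c * |t|) • φ i t) (ν i)) (ha : 0 < a)
    (h01 : x₀ < x₁) (h0 : -a ≤ x₀) (h1 : x₁ ≤ a)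
    (h : ∀ x ∈ Set.Ioo x₀ x₁, ∑ i, ∫ t, Real.exp (-(t * x)) • φ i t ∂(ν i) = 0) {F : ℝ → V}
    (hF : StronglyMeasurable F) (hFb : ∀ t, ‖F t‖ ≤ M * Real.exp (c * |t|)) (hc : c < a) :
    ∑ i, ∫ t, φ i t • F t ∂(ν i) = 0 := by
  -- The product φ • F is the sum of ⟨b j, φ⟩ • (b j • F). The densities become real, and the
  -- quaternionic factors are absorbed into the vector function.
  set b := stdOrthonormalBasis ℝ ℍ[ℝ]
  have hψm : ∀ j i, Measurable fun t => inner ℝ (b j) (φ i t) := fun j i =>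
    ((innerSL ℝ (b j)).continuous.comp_stronglyMeasurable (hφm i)).measurable
  have hψ : ∀ j i, ∀ c < a, Integrable (fun t => Real.exp (c * |t|) * inner ℝ (b j) (φ i t)) (ν i) :=
    fun j i c hc => by
      have := (innerSL ℝ (b j)).integrable_comp (hφ i c hc)
      simpa only [innerSL_apply_apply, inner_smul_right] using this
  have hFm : ∀ j, StronglyMeasurable fun t => b j • F t := fun j =>
    (leftMulCLM V (b j)).continuous.comp_stronglyMeasurable hF
  have hFmb : ∀ j t, ‖b j • F t‖ ≤ M * Real.exp (c * |t|) := fun j t => by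
    refine (norm_smul_le _ _).trans ?_
    rw [b.orthonormal.1 j, one_mul]
    exact hFb t
  have key : ∀ j, ∑ i, ∫ t, inner ℝ (b j) (φ i t) • b j • F t ∂(ν i) = 0 := fun j => by
    refine sum_integral_smul_eq_zero_of_laplace (hψm j) (hψ j) ha h01 h0 h1 (fun x hx => ?_)
      (hFm j) (hFmb j) hc
    have hxa : |x| < a := abs_lt.2 ⟨by linarith [hx.1], by linarith [hx.2]⟩
    have h2 := congrArg (innerSL ℝ (b j)) (h x hx)
    rw [map_sum, map_zero] at h2
    rw [← h2]
    refine Finset.sum_congr rfl fun i _ => ?_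
    rw [← ContinuousLinearMap.integral_comp_comm]
    · simp only [innerSL_apply_apply, inner_smul_right]
    · refine (hφ i |x| hxa).mono ?_ (.of_forall fun t => ?_)
      · have hc : Continuous fun t : ℝ => Real.exp (-(t * x)) := by fun_prop
        exact (hc.stronglyMeasurable.smul (hφm i)).aestronglyMeasurable
      · rw [norm_smul, norm_smul, Real.norm_of_nonneg (Real.exp_pos _).le,
          Real.norm_of_nonneg (Real.exp_pos _).le]
        gcongr
        refine (le_abs_self _).trans ?_
        rw [abs_neg, abs_mul, mul_comm]
  have e : ∀ i, ∫ t, φ i t • F t ∂(ν i) =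
      ∑ j, ∫ t, inner ℝ (b j) (φ i t) • b j • F t ∂(ν i) := fun i => by
    rw [← integral_finsetSum _ fun j _ =>
      integrable_smul_of_le_exp (hψm j i) (hψ j i) (hFm j) (hFmb j) hc]
    refine integral_congr_ae (.of_forall fun t => ?_)
    beta_reduce
    nth_rw 1 [← b.sum_repr' (φ i t)]
    rw [Finset.sum_smul]
    exact Finset.sum_congr rfl fun j _ => smul_assoc _ _ _
  rw [Finset.sum_congr rfl fun i _ => e i, Finset.sum_comm]
  exact Finset.sum_eq_zero fun j _ => key j

/-- If the Laplace transform of `φ dν` is on an interval that of `q δ₀ + κ dt`, the integrals of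
vector valued functions of smaller growth coincide. -/
lemma integral_smul_eq_of_laplace {ν : Measure ℝ} {φ κ : ℝ → ℍ[ℝ]} {q : ℍ[ℝ]} [CompleteSpace V]
    (hφm : StronglyMeasurable φ) (hκm : StronglyMeasurable κ)
    (hφ : ∀ c < a, Integrable (fun t => Real.exp (c * |t|) • φ t) ν)
    (hκ : ∀ c < a, Integrable fun t => Real.exp (c * |t|) • κ t) (ha : 0 < a)
    (h01 : x₀ < x₁) (h0 : -a ≤ x₀) (h1 : x₁ ≤ a)
    (h : ∀ x ∈ Set.Ioo x₀ x₁, ∫ t, Real.exp (-(t * x)) • φ t ∂ν =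
      q + ∫ t, Real.exp (-(t * x)) • κ t) {F : ℝ → V}
    (hF : StronglyMeasurable F) (hFb : ∀ t, ‖F t‖ ≤ M * Real.exp (c * |t|)) (hc : c < a) :
    ∫ t, φ t • F t ∂ν = q • F 0 + ∫ t, κ t • F t := by
  -- The relation is written as one vanishing combination of ν, δ₀ and Lebesgue measure, with
  -- densities φ, -q and -κ.
  set ν' : Fin 3 → Measure ℝ := Fin.cons ν (Fin.cons (Measure.dirac 0) fun _ => volume) with hν'
  set φ' : Fin 3 → ℝ → ℍ[ℝ] := Fin.cons φ (Fin.cons (fun _ => -q) fun _ t => -κ t) with hφ'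
  have key := sum_integral_quaternion_smul_eq_zero_of_laplace (ν := ν') (φ := φ') (a := a)
    (x₀ := x₀) (x₁ := x₁) (Fin.forall_fin_succ.2 ⟨hφm, Fin.forall_fin_succ.2
      ⟨stronglyMeasurable_const, fun _ => hκm.neg⟩⟩)
    (Fin.forall_fin_succ.2 ⟨hφ, Fin.forall_fin_succ.2 ⟨fun c' _ => ?_, fun _ c' hc' => ?_⟩⟩)
    ha h01 h0 h1 (fun x hx => ?_) hF hFb hc
  · have e : ∑ i, ∫ t, φ' i t • F t ∂(ν' i) = ∫ t, φ t • F t ∂ν +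
        (∫ t, -q • F t ∂(Measure.dirac 0) + ∫ t, -κ t • F t) := by
      rw [Fin.sum_univ_succ, Fin.sum_univ_succ, Fin.sum_univ_one]
      rfl
    rw [e, integral_dirac] at key
    simp only [neg_smul, integral_neg] at key
    rw [← sub_eq_zero, ← key]
    abel
  · change Integrable (fun t : ℝ => Real.exp (c' * |t|) • -q) (Measure.dirac 0)
    exact integrable_dirac (by simp)
  · change Integrable (fun t : ℝ => Real.exp (c' * |t|) • -κ t) volume
    simp only [smul_neg]
    exact (hκ c' hc').neg
  · have e : ∑ i, ∫ t, Real.exp (-(t * x)) • φ' i t ∂(ν' i) = ∫ t, Real.exp (-(t * x)) • φ t ∂ν +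
        (∫ t, Real.exp (-(t * x)) • -q ∂(Measure.dirac 0) + ∫ t, Real.exp (-(t * x)) • -κ t) := by
      rw [Fin.sum_univ_succ, Fin.sum_univ_succ, Fin.sum_univ_one]
      rfl
    rw [e, integral_dirac, h x hx]
    simp only [smul_neg, integral_neg, zero_mul, neg_zero, Real.exp_zero, one_smul]
    abel

end Quaternionic

end LaplaceUniqueness

/-! ### Independence of the contour -/

section Independence

set_option linter.unusedSectionVars false

variable {V : Type*} [NormedAddCommGroup V] [NormedSpace ℝ V] [CompleteSpace V]
  [Module ℍ[ℝ] V] [IsScalarTower ℝ ℍ[ℝ] V] [IsBoundedSMul ℍ[ℝ] V]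
  [Module ℍ[ℝ]ᵐᵒᵖ V] [IsScalarTower ℝ ℍ[ℝ]ᵐᵒᵖ V] [IsBoundedSMul ℍ[ℝ]ᵐᵒᵖ V]
  [SMulCommClass ℍ[ℝ]ᵐᵒᵖ ℍ[ℝ] V]

lemma isBounded_slice {I : ℍ[ℝ]} (hI : I ∈ ImagUnits) {U : Set ℍ[ℝ]} (hU : Bornology.IsBounded U) :
    Bornology.IsBounded (slice I U) := by
  obtain ⟨C, hC⟩ := hU.exists_norm_le
  rw [isBounded_iff_forall_norm_le]
  exact ⟨C, fun z hz => (norm_sliceEmb hI (z := z)) ▸ hC _ hz⟩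

lemma closure_slice_subset (I : ℍ[ℝ]) (U : Set ℍ[ℝ]) : closure (slice I U) ⊆ slice I (closure U) :=
  closure_minimal (Set.preimage_mono subset_closure)
    (isClosed_closure.preimage (continuous_sliceEmb I))

lemma IsJordanBoundary.mem_frontier {D : Set ℂ} {n : ℕ} {γ : Fin n → ℝ → ℂ}
    (h : IsJordanBoundary D γ) (k : Fin n) (t : ℝ) : γ k t ∈ frontier D := by
  rw [← h.2]
  exact Set.mem_iUnion.2 ⟨k, t, rfl⟩

variable {A : V →L[ℍ[ℝ]ᵐᵒᵖ] V} {g : ℍ[ℝ] → ℍ[ℝ]} {I : ℍ[ℝ]} {U₁ U₂ O₁ O₂ : Set ℍ[ℝ]} {n m : ℕ}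
  {γ₁ : Fin n → ℝ → ℂ} {γ₂ : Fin m → ℝ → ℂ}

lemma frontier_slice_subset (hU : IsOpen U₁) (hs : boundedSSpectrum A ⊆ U₁) (hO : closure U₁ ⊆ O₁) :
    frontier (slice I U₁) ⊆ slice I O₁ ∩ {z | IsUnit (sPencil A (sliceEmb I z))} := by
  have h1 : IsOpen (slice I U₁) := hU.preimage (continuous_sliceEmb I)
  rw [h1.frontier_eq]
  refine fun z hz => ⟨hO (closure_slice_subset I U₁ hz.1), ?_⟩
  by_contra h
  exact hz.2 (hs h)

/-- The value of the integral that defines the S-functional calculus does not depend on the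
contour. -/
theorem sum_integral_rightSResolvent_eq (hI : I ∈ ImagUnits)
    (hU₁ : IsOpen U₁) (hb₁ : Bornology.IsBounded U₁) (hs₁ : boundedSSpectrum A ⊆ U₁)
    (hO₁ : closure U₁ ⊆ O₁) (hg₁ : RightSliceRegularOn g O₁)
    (hγ₁ : IsPositiveJordanBoundary (slice I U₁) γ₁)
    (hU₂ : IsOpen U₂) (hb₂ : Bornology.IsBounded U₂) (hs₂ : boundedSSpectrum A ⊆ U₂)
    (hO₂ : closure U₂ ⊆ O₂) (hg₂ : RightSliceRegularOn g O₂)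
    (hγ₂ : IsPositiveJordanBoundary (slice I U₂) γ₂) (v : V) :
    ∑ k, ∫ t in (0 : ℝ)..1, contourDensity g I (γ₁ k) t • rightSResolvent (sliceEmb I (γ₁ k t)) A v =
      ∑ k, ∫ t in (0 : ℝ)..1,
        contourDensity g I (γ₂ k) t • rightSResolvent (sliceEmb I (γ₂ k t)) A v := by
  set Ω : Set ℂ := slice I (O₁ ∪ O₂) ∩ {z | IsUnit (sPencil A (sliceEmb I z))} with hΩ
  set D₁ := slice I U₁
  set D₂ := slice I U₂
  have hD₁ : IsOpen D₁ := hU₁.preimage (continuous_sliceEmb I)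
  have hD₂ : IsOpen D₂ := hU₂.preimage (continuous_sliceEmb I)
  have hg := hg₁.union hg₂
  have hB₁ := isBounded_slice hI hb₁
  have hB₂ := isBounded_slice hI hb₂
  have hcl₁ : closure D₁ ⊆ slice I (O₁ ∪ O₂) := fun z hz =>
    Or.inl (hO₁ (closure_slice_subset I U₁ hz))
  have hcl₂ : closure D₂ ⊆ slice I (O₁ ∪ O₂) := fun z hz =>
    Or.inr (hO₂ (closure_slice_subset I U₂ hz))
  -- The difference of the two contours is null homologous where g is regular and the pencil is
  -- invertible. A point outside Ω lies either off both closures, with winding 0 - 0, or in the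
  -- spectrum and hence in both domains, with winding 1 - 1.
  have hnull : IsNullCycle Ω (Sum.elim γ₁ γ₂) (Sum.elim (fun _ => 1) fun _ => -1) := by
    refine ⟨(hg.1.preimage (continuous_sliceEmb I)).inter (isOpen_setOf_isUnit_sPencil hI A),
      ?_, frontier D₁ ∪ frontier D₂, ?_, ?_, ?_,
      (closure D₁ ∪ closure D₂)ᶜ ∪ (D₁ ∩ D₂), ?_, fun z => ?_, ?_, fun z hz hzK => ?_⟩
    · rintro (k | k)
      · exact (hγ₁.1.1 k).1
      · exact (hγ₂.1.1 k).1
    · exact (hB₁.isCompact_closure.of_isClosed_subset isClosed_frontier frontier_subset_closure).union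
        (hB₂.isCompact_closure.of_isClosed_subset isClosed_frontier frontier_subset_closure)
    · rintro z (hz | hz)
      · have := frontier_slice_subset hU₁ hs₁ hO₁ hz
        exact ⟨Or.inl this.1, this.2⟩
      · have := frontier_slice_subset hU₂ hs₂ hO₂ hz
        exact ⟨Or.inr this.1, this.2⟩
    · rintro (k | k) t
      · exact Or.inl (hγ₁.1.mem_frontier k t)
      · exact Or.inr (hγ₂.1.mem_frontier k t)
    · exact (isClosed_closure.union isClosed_closure).isOpen_compl.union (hD₁.inter hD₂)
    · by_cases h1 : z ∈ closure D₁ ∪ closure D₂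
      · by_cases h2 : z ∈ D₁ ∩ D₂
        · exact Or.inr (Or.inr h2)
        · refine Or.inl ⟨h1.elim (fun h => hcl₁ h) fun h => hcl₂ h, ?_⟩
          by_contra h
          exact h2 ⟨hs₁ h, hs₂ h⟩
      · exact Or.inr (Or.inl h1)
    · refine mem_of_superset ?_ Set.subset_union_left
      rw [← Bornology.isBounded_def]
      exact hB₁.closure.union hB₂.closure
    · simp only [Fintype.sum_sum_type, Sum.elim_inl, Sum.elim_inr, Complex.ofReal_one, one_mul,
        Complex.ofReal_neg, neg_mul, Finset.sum_neg_distrib]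
      rcases hz with hz | hz
      · rw [Set.mem_compl_iff, Set.mem_union, not_or] at hz
        rw [hγ₁.2.2 z hz.1, hγ₂.2.2 z hz.2, neg_zero, add_zero]
      · rw [hγ₁.2.1 z hz.1, hγ₂.2.1 z hz.2, add_neg_cancel]
  have key := hnull.sum_integral_pairing_eq_zero hI (G := fun w => g (sliceEmb I w) * -I)
    (S := fun z => rightSResolvent (sliceEmb I z) A v) (fun z hz => hg.jDiffAt_mul_neg hI hz.1)
    (fun z hz => jDiffAt_rightSResolvent hI hz.2 v)
  simp only [Fintype.sum_sum_type, Sum.elim_inl, Sum.elim_inr, one_smul, neg_smul,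
    Finset.sum_neg_distrib, ← mul_neg_sliceEmb_mul] at key
  exact add_neg_eq_zero.1 key

end Independence

/-! ### Location of the S-spectrum of A and reduction of g[A] to one contour. -/

section Value

set_option linter.unusedSectionVars false

variable {V : Type*} [NormedAddCommGroup V] [NormedSpace ℝ V] [CompleteSpace V]
  [Module ℍ[ℝ] V] [IsScalarTower ℝ ℍ[ℝ] V] [IsBoundedSMul ℍ[ℝ] V]
  [Module ℍ[ℝ]ᵐᵒᵖ V] [IsScalarTower ℝ ℍ[ℝ]ᵐᵒᵖ V] [IsBoundedSMul ℍ[ℝ]ᵐᵒᵖ V]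
  [SMulCommClass ℍ[ℝ]ᵐᵒᵖ ℍ[ℝ] V]

variable {Z : ℝ → V →L[ℍ[ℝ]ᵐᵒᵖ] V} {M ω : ℝ} {A : V →L[ℍ[ℝ]ᵐᵒᵖ] V} {n : ℕ} {α a b r η : ℝ}
  {D : DiscFamily n α} {k₀ : Fin n}

/-- A point q off the domain has z = α + 1/q in one of the discs. In an outer disc |Re z| > ω and
the Laplace integral inverts the pencil; in the small disc about α invertibility is the hypothesis
`hA`. -/
lemma DiscFamily.IsAdapted.boundedSSpectrum_subset (hD : D.IsAdapted a b r η k₀)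
    (h : IsGroupResolvent Z M ω α A) (hωa : ω < a)
    (hA : ∀ k, ¬ D.IsOuter a k → ∃ ρ', D.ρ k < ρ' ∧ ∀ ζ : ℍ[ℝ], ‖ζ‖ < ρ' → IsUnit (unitPencil A ζ)) :
    boundedSSpectrum A ⊆ D.toCircleDomain.domH := by
  intro s hs
  obtain ⟨I, hI, q, rfl⟩ := exists_sliceEmb s
  change q ∈ slice I D.toCircleDomain.domH
  rw [D.toCircleDomain.slice_domH hI]
  intro k
  rw [← not_le, D.val_nonpos_iff]
  rintro ⟨hq, h1⟩
  refine hs ?_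
  have hq' : sliceEmb I q ≠ 0 := by rwa [← norm_ne_zero_iff, norm_sliceEmb hI, norm_ne_zero_iff]
  rw [isUnit_sPencil_iff hq', ← sliceEmb_inv hI]
  by_cases ho : D.IsOuter a k
  · have := h.isUnit_unitPencil (s := sliceEmb I (α + q⁻¹))
      (by rw [sliceEmb_re hI]; exact hωa.trans_le (ho _ h1))
    rwa [sliceEmb_add, sliceEmb_ofReal, add_sub_cancel_left] at this
  · obtain ⟨ρ', h2, h3⟩ := hA k ho
    refine h3 _ ?_
    rw [norm_sliceEmb hI]
    rw [(hD.of_not_isOuter ho).1, add_sub_cancel_left] at h1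
    exact h1.trans_lt h2

/-- The bounded S-functional calculus is determined by the contour integrals over one adapted
family of circles. -/
theorem DiscFamily.IsAdapted.isBoundedSCalculus (hD : D.IsAdapted a b r η k₀)
    {g : ℍ[ℝ] → ℍ[ℝ]} (hg : RightSliceRegularOn g (DiscFamily.transportDomain α b r))
    (hs : boundedSSpectrum A ⊆ D.toCircleDomain.domH) {B : V →L[ℍ[ℝ]ᵐᵒᵖ] V}
    (hB : ∀ I ∈ ImagUnits, ∀ v, ∑ k, ∫ t in (0 : ℝ)..1,
      contourDensity g I (D.toCircleDomain.curve k) t •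
        rightSResolvent (sliceEmb I (D.toCircleDomain.curve k t)) A v = (2 * Real.pi) • B v) :
    IsBoundedSCalculus A g B := by
  have hadm := D.toCircleDomain.isAdmissible_domH hs
  have hpos : ∀ I ∈ ImagUnits,
      IsPositiveJordanBoundary (slice I D.toCircleDomain.domH) D.toCircleDomain.curve :=
    fun I hI => by
      rw [D.toCircleDomain.slice_domH hI]
      exact hD.isPositiveJordanBoundary
  refine ⟨⟨D.toCircleDomain.domH, hD.isBounded_domH, hadm, ⟨_, hD.closure_domH_subset, hg⟩,
    fun I hI => ⟨n, _, hpos I hI⟩⟩, ?_⟩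
  rintro U hUb hU ⟨O, hO, hgO⟩ I hI m γ hγ v
  have := sum_integral_rightSResolvent_eq hI hU.2.1.1 hUb hU.2.2.1 hO hgO hγ
    D.toCircleDomain.isOpen_domH hD.isBounded_domH hs hD.closure_domH_subset hg (hpos I hI) v
  have hpi : (2 * Real.pi) ≠ 0 := by positivity
  rw [← inv_smul_smul₀ hpi (B v), ← hB I hI v, ← this]
  rfl

end Value

/-! ### The operator given by the measure -/

section Final

set_option linter.unusedSectionVars false

/-- Provides real test points x < a for the comparison of Laplace transforms; they have to avoid α
and the small disc. -/
lemma DiscFamily.IsAdapted.exists_interval {n : ℕ} {α a b r η : ℝ} {D : DiscFamily n α} {k₀ : Fin n}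
    (hD : D.IsAdapted a b r η k₀) (ha : 0 < a) : ∃ x₀, 0 ≤ x₀ ∧ x₀ < a ∧ ∀ x ∈ Set.Ioo x₀ a,
      x ≠ α ∧ ∀ k, ¬ D.IsOuter a k → D.ρ k < |x - α| := by
  by_cases h : ∃ k, ¬ D.IsOuter a k
  · obtain ⟨k, hk⟩ := h
    obtain ⟨h1, -, h2⟩ := hD.of_not_isOuter hk
    -- A disc that is not outer is centred at α and so contains α, which only one disc does.
    have huniq : ∀ j, ¬ D.IsOuter a j → j = k := fun j hj => by
      have hc : ∀ i, D.c i = α → i = k₀ := fun i hi => (hD.inside i).1 (by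
        rw [hi, sub_self, abs_zero]; exact D.ρ_pos i)
      rw [hc j (hD.of_not_isOuter hj).1, hc k h1]
    have hρ := D.ρ_pos k
    refine ⟨|α| + D.ρ k, by positivity, h2, fun x hx => ?_⟩
    have h3 : D.ρ k < x - α := by linarith [hx.1, le_abs_self α]
    refine ⟨by linarith, fun j hj => ?_⟩
    rw [huniq j hj]
    exact h3.trans_le (le_abs_self _)
  · by_cases hα : |α| < a
    · exact ⟨|α|, abs_nonneg α, hα, fun x hx => ⟨by linarith [hx.1, le_abs_self α],
        fun k hk => absurd ⟨k, hk⟩ h⟩⟩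
    · refine ⟨0, le_rfl, ha, fun x hx => ⟨?_, fun k hk => absurd ⟨k, hk⟩ h⟩⟩
      rintro rfl
      rw [abs_of_pos hx.1] at hα
      exact hα hx.2

lemma integrable_exp_smul_of_bounded {E : Type*} [NormedAddCommGroup E] [NormedSpace ℝ E]
    {ν : Measure ℝ} {φ : ℝ → E} (hφ : StronglyMeasurable φ) {C : ℝ} (hC : ∀ t, ‖φ t‖ ≤ C) {b c : ℝ}
    (hb : Integrable (fun t => Real.exp (b * |t|)) ν) (hc : c ≤ b) :
    Integrable (fun t => Real.exp (c * |t|) • φ t) ν := by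
  have hem : Continuous fun t : ℝ => Real.exp (c * |t|) := by fun_prop
  refine (hb.mul_const C).mono' (hem.stronglyMeasurable.smul hφ).aestronglyMeasurable
    (.of_forall fun t => ?_)
  rw [norm_smul, Real.norm_of_nonneg (Real.exp_pos _).le]
  gcongr
  exact hC t

lemma integrable_exp_smul_of_decay {E : Type*} [NormedAddCommGroup E] [NormedSpace ℝ E]
    {κ : ℝ → E} (hκ : StronglyMeasurable κ) {K a c : ℝ} (hK : ∀ t, ‖κ t‖ ≤ K * Real.exp (-(a * |t|)))
    (hc : c < a) : Integrable fun t => Real.exp (c * |t|) • κ t := by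
  have hem : Continuous fun t : ℝ => Real.exp (c * |t|) := by fun_prop
  refine ((integrable_exp_neg_mul_abs (sub_pos.2 hc)).const_mul K).mono'
    (hem.stronglyMeasurable.smul hκ).aestronglyMeasurable (.of_forall fun t => ?_)
  rw [norm_smul, Real.norm_of_nonneg (Real.exp_pos _).le]
  calc _ ≤ Real.exp (c * |t|) * (K * Real.exp (-(a * |t|))) := by gcongr; exact hK t
    _ = K * (Real.exp (c * |t|) * Real.exp (-(a * |t|))) := by ring
    _ = _ := by rw [← Real.exp_add]; ring_nf

variable {V : Type*} [NormedAddCommGroup V] [NormedSpace ℝ V] [CompleteSpace V]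
  [Module ℍ[ℝ] V] [IsScalarTower ℝ ℍ[ℝ] V] [IsBoundedSMul ℍ[ℝ] V]
  [Module ℍ[ℝ]ᵐᵒᵖ V] [IsScalarTower ℝ ℍ[ℝ]ᵐᵒᵖ V] [IsBoundedSMul ℍ[ℝ]ᵐᵒᵖ V]
  [SMulCommClass ℍ[ℝ]ᵐᵒᵖ ℍ[ℝ] V]

variable {Z : ℝ → V →L[ℍ[ℝ]ᵐᵒᵖ] V} {M ω b : ℝ} {μ : VectorMeasure ℝ ℍ[ℝ]} {ρ : ℝ → ℍ[ℝ]} {C : ℝ}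

/-- The contour integrals over an adapted family of circles have the value `2π ∫ dμ(t) Z(-t) v`. -/
lemma DiscFamily.IsAdapted.sum_integral_eq_integral {n : ℕ} {α a r η : ℝ} {D : DiscFamily n α}
    {k₀ : Fin n} {A : V →L[ℍ[ℝ]ᵐᵒᵖ] V} {I : ℍ[ℝ]} (hD : D.IsAdapted a b r η k₀)
    (hI : I ∈ ImagUnits) {f : ℍ[ℝ] → ℍ[ℝ]} {L : ℍ[ℝ]} (hab : a < b)
    (hf : RightSliceRegularOn f ({s : ℍ[ℝ] | |s.re| < b} ∪ {s | r < ‖s‖}))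
    (hg : RightSliceRegularOn (invTransport f L α) (DiscFamily.transportDomain α b r))
    (h : IsGroupResolvent Z M ω α A) (hωa : ω < a)
    (hA : ∀ k, ¬ D.IsOuter a k → ∃ ρ', D.ρ k < ρ' ∧ ∀ ζ : ℍ[ℝ], ‖ζ‖ < ρ' → IsUnit (unitPencil A ζ))
    (hρ : IsVariationDensity μ ρ C) (hb : Integrable (fun t => Real.exp (b * |t|)) μ.variation)
    (hfμ : ∀ x : ℝ, |x| < b → f x = ∫ t, Real.exp (-(t * x)) • ρ t ∂μ.variation) (v : V) :
    ∑ k, ∫ t in (0 : ℝ)..1, contourDensity (invTransport f L α) I (D.toCircleDomain.curve k) t •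
        rightSResolvent (sliceEmb I (D.toCircleDomain.curve k t)) A v =
      (2 * Real.pi) • ∫ t, ρ t • Z (-t) v ∂μ.variation := by
  rw [hD.sum_integral_eq hI hab hf hg h hωa hA v]
  set c := D.const (invTransport f L α) I
  set κ := D.kernel a (invTransport f L α) I
  have ha : 0 < a := h.nonneg_type.trans_lt hωa
  obtain ⟨x₀, hx0, hxa, hx⟩ := hD.exists_interval ha
  have hκm : StronglyMeasurable κ := hD.stronglyMeasurable_kernel hI hg
  obtain ⟨K, hK⟩ := hD.exists_kernel_bound hI hg
  -- Uniqueness for 2πμ and c δ₀ + κ dτ, tested on F(t) = Z(-t)v, whose growth ω is below the decay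
  -- rate a of κ.
  have key := integral_smul_eq_of_laplace (ν := μ.variation) (φ := fun t => (2 * Real.pi) • ρ t)
    (κ := κ) (q := c) (a := a) (x₀ := x₀) (x₁ := a) (F := fun t => Z (-t) v) (M := M * ‖v‖) (c := ω)
    (hρ.stronglyMeasurable.const_smul (2 * Real.pi)) hκm (fun c' hc' => ?_) (fun c' hc' => ?_) ha hxa
    (by linarith) le_rfl (fun x hxI => ?_)
    ((h.continuous v).comp continuous_neg).stronglyMeasurable (fun t => ?_) hωa
  · simp only [neg_zero, h.zero_apply, smul_assoc] at key
    rw [← key, integral_smul]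
  · refine integrable_exp_smul_of_bounded (hρ.stronglyMeasurable.const_smul (2 * Real.pi))
      (C := 2 * Real.pi * C) (fun t => ?_) hb (hc'.trans hab).le
    rw [Pi.smul_apply, norm_smul, Real.norm_of_nonneg (by positivity : (0 : ℝ) ≤ 2 * Real.pi)]
    exact mul_le_mul_of_nonneg_left (hρ.norm_le t) (by positivity)
  · exact integrable_exp_smul_of_decay hκm hK hc'
  · have hxa' : |x| < a := abs_lt.2 ⟨by linarith [hxI.1], hxI.2⟩
    rw [hD.laplace_eq hI hab hf hg hxa' (hx x hxI).1 (hx x hxI).2, hfμ x (hxa'.trans hab),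
      ← integral_smul]
    exact integral_congr_ae (.of_forall fun t => smul_comm _ _ _)
  · have := h.norm_le (-t) v
    rw [abs_neg] at this
    exact this.trans (le_of_eq (by ring))

lemma integrable_group (hZ : IsStronglyContinuousGroup Z)
    (hb : ∀ (t : ℝ) (v : V), ‖Z t v‖ ≤ M * Real.exp (ω * |t|) * ‖v‖) {ν : Measure ℝ}
    (hν : Integrable (fun t => Real.exp (ω * |t|)) ν) (v : V) :
    Integrable (fun t => Z (-t) v) ν := by
  refine ((hν.const_mul M).mul_const ‖v‖).mono'
    ((hZ.2.2 v).comp continuous_neg).aestronglyMeasurable (.of_forall fun t => ?_)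
  have := hb (-t) v
  rwa [abs_neg] at this

lemma IsVariationDensity.integrable_smul (hρ : IsVariationDensity μ ρ C) {F : ℝ → V}
    (hF : Integrable F μ.variation) : Integrable (fun t => ρ t • F t) μ.variation := by
  refine (hF.norm.const_mul C).mono' (hρ.stronglyMeasurable.aestronglyMeasurable.smul hF.1)
    (.of_forall fun t => (norm_smul_le _ _).trans ?_)
  gcongr
  exact hρ.norm_le t

/-- The operator `v ↦ ∫ dμ(t) Z(-t) v`. -/
noncomputable def groupIntegral (hρ : IsVariationDensity μ ρ C) (hZ : IsStronglyContinuousGroup Z)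
    (hb : ∀ (t : ℝ) (v : V), ‖Z t v‖ ≤ M * Real.exp (ω * |t|) * ‖v‖)
    (hν : Integrable (fun t => Real.exp (ω * |t|)) μ.variation) : V →L[ℍ[ℝ]ᵐᵒᵖ] V :=
  LinearMap.mkContinuous
    { toFun := fun v => ∫ t, ρ t • Z (-t) v ∂μ.variation
      map_add' := fun v w => by
        rw [← integral_add (hρ.integrable_smul (integrable_group hZ hb hν v))
          (hρ.integrable_smul (integrable_group hZ hb hν w))]
        simp only [map_add, smul_add]
      map_smul' := fun q v => by
        have := (rightActCLM V q.unop).integral_comp_comm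
          (hρ.integrable_smul (integrable_group hZ hb hν v))
        simp only [rightActCLM_apply, MulOpposite.op_unop] at this
        rw [RingHom.id_apply, ← this]
        refine integral_congr_ae (Eventually.of_forall fun t => ?_)
        simp only [map_smul]
        exact (smul_comm q (ρ t) (Z (-t) v)).symm }
    (∫ t, C * (M * Real.exp (ω * |t|)) ∂μ.variation) fun v => by
      rw [← integral_mul_const]
      refine norm_integral_le_of_norm_le (((hν.const_mul M).const_mul C).mul_const _)
        (.of_forall fun t => (norm_smul_le _ _).trans ?_)
      have := hb (-t) v
      rw [abs_neg] at this
      calc _ ≤ C * (M * Real.exp (ω * |t|) * ‖v‖) :=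
            mul_le_mul (hρ.norm_le t) this (norm_nonneg _) hρ.nonneg
        _ = _ := by ring

lemma twoDiscs_mem_domH {a c : ℝ} (ha : 0 < a) (hc : a < c) {s : ℍ[ℝ]} (hs : |s.re| < a) :
    s ∈ (twoDiscs a c ha hc).domH := by
  obtain ⟨I, hI, z, rfl⟩ := exists_sliceEmb s
  rw [sliceEmb_re hI] at hs
  change z ∈ slice I (twoDiscs a c ha hc).domH
  rw [CircleDomain.slice_domH _ hI]
  obtain ⟨h1, h2⟩ := abs_lt.1 hs
  have hca : 0 ≤ c - a := by linarith
  intro k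
  have h : c - a < ‖z - (![c, -c] k : ℝ)‖ := by
    fin_cases k
    · exact lt_norm_sub_of_re_le (y := z.re) le_rfl (show c - a < c - z.re by linarith)
    · exact lt_norm_sub_of_le_re (y := z.re) le_rfl (show c - a < z.re - -c by linarith)
  have h3 : (c - a) ^ 2 < ‖z - (![c, -c] k : ℝ)‖ ^ 2 := pow_lt_pow_left₀ h hca two_ne_zero
  change 0 < (-1 : ℝ) * ((c - a) ^ 2 - ‖z - (![c, -c] k : ℝ)‖ ^ 2)
  linarith

lemma closure_twoDiscs_subset {a c : ℝ} (ha : 0 < a) (hc : a < c) {s : ℍ[ℝ]}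
    (hs : s ∈ closure (twoDiscs a c ha hc).domH) :
    c - a ≤ ‖s - (c : ℍ[ℝ])‖ ∧ c - a ≤ ‖s - ((-c : ℝ) : ℍ[ℝ])‖ := by
  have h := (twoDiscs a c ha hc).closure_domH_subset hs
  have h0 : 0 ≤ (-1 : ℝ) * ((c - a) ^ 2 - ‖s - (c : ℍ[ℝ])‖ ^ 2) := h 0
  have h1 : 0 ≤ (-1 : ℝ) * ((c - a) ^ 2 - ‖s - ((-c : ℝ) : ℍ[ℝ])‖ ^ 2) := h 1
  exact ⟨le_of_sq_le_sq (by linarith) (norm_nonneg _), le_of_sq_le_sq (by linarith) (norm_nonneg _)⟩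

end Final

theorem theorem4p4 {V : Type*} [NormedAddCommGroup V] [NormedSpace ℝ V] [CompleteSpace V]
    [Module ℍ[ℝ] V] [IsScalarTower ℝ ℍ[ℝ] V] [IsBoundedSMul ℍ[ℝ] V]
    [Module ℍ[ℝ]ᵐᵒᵖ V] [IsScalarTower ℝ ℍ[ℝ]ᵐᵒᵖ V] [IsBoundedSMul ℍ[ℝ]ᵐᵒᵖ V]
    [SMulCommClass ℍ[ℝ]ᵐᵒᵖ ℍ[ℝ] V]
    (Z : ℝ → V →L[ℍ[ℝ]ᵐᵒᵖ] V) (hZ : IsStronglyContinuousGroup Z)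
    (T : V →ₗ.[ℍ[ℝ]ᵐᵒᵖ] V) (hT : IsGenerator Z T)
    (M ω : ℝ) (hM : 0 < M) (hω : 0 ≤ ω)
    (hZbound : ∀ (t : ℝ) (v : V), ‖Z t v‖ ≤ M * Real.exp (ω * |t|) * ‖v‖)
    (f : ℍ[ℝ] → ℍ[ℝ]) (μ : VectorMeasure ℝ ℍ[ℝ]) (hf : IsTransformOf ω f μ)
    (hf_inf : RightSliceRegularAtInfinity f) :
    ∃ B : V →L[ℍ[ℝ]ᵐᵒᵖ] V,
      (∀ v : V, Integrable (fun t : ℝ => Z (-t) v) μ.variation ∧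
        B v = leftIntegral μ fun t : ℝ => Z (-t) v) ∧
      IsSCalculus T f B := by
  obtain ⟨ε, hε, hexp, hfμ⟩ := hf
  obtain ⟨r, -, hfr⟩ := hf_inf.1
  set b := ω + ε with hbdef
  have hωb : ω < b := by linarith
  -- The exponential weight is at least 1, so its integrability makes the variation finite, as the
  -- bounded density requires.
  have hfin : IsFiniteMeasure μ.variation := by
    have h1 : Integrable (fun _ : ℝ => (1 : ℝ)) μ.variation :=
      hexp.mono' aestronglyMeasurable_const (.of_forall fun t => by
        rw [norm_one]
        exact Real.one_le_exp (by positivity))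
    exact (integrable_const_iff.1 h1).resolve_left one_ne_zero
  obtain ⟨ρ, C, hρ1, hρ2, hρ3⟩ := exists_bounded_density_variation μ
  have hρ : IsVariationDensity μ ρ C := ⟨hρ1, hρ2, hρ3⟩
  have hexpω : Integrable (fun t => Real.exp (ω * |t|)) μ.variation :=
    hexp.mono' (Continuous.aestronglyMeasurable (by fun_prop)) (.of_forall fun t => by
      rw [Real.norm_eq_abs, Real.abs_exp]
      gcongr)
  have hZi := integrable_group hZ hZbound hexpω
  have hfstrip : ∀ s : ℍ[ℝ], |s.re| < b →
      f s = ∫ t, ρ t * NormedSpace.exp (-(t • s)) ∂μ.variation := fun s hs => by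
    rw [hfμ s hs, laplaceStieltjes, hρ.leftIntegral_eq]
    · rfl
    · simpa using integrable_mul_exp (h := fun _ => (1 : ℍ[ℝ])) (C := 1) stronglyMeasurable_const
        (fun _ => by simp) hexp hs.le
  have hfreal : ∀ x : ℝ, |x| < b → f x = ∫ t, Real.exp (-(t * x)) • ρ t ∂μ.variation :=
    fun x hx => by
      rw [hfstrip x (by rwa [Quaternion.re_coe])]
      refine integral_congr_ae (.of_forall fun t => ?_)
      have e : -(t • (x : ℍ[ℝ])) = ((-(t * x) : ℝ) : ℍ[ℝ]) := by
        rw [Quaternion.coe_neg, Quaternion.coe_mul, Quaternion.coe_mul_eq_smul]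
      simp only [e, Quaternion.exp_coe, Quaternion.mul_coe_eq_smul]
      rw [← Real.exp_eq_exp_ℝ]
  have hfreg : RightSliceRegularOn f ({s : ℍ[ℝ] | |s.re| < b} ∪ {s | r < ‖s‖}) :=
    ((rightSliceRegularOn_integral_mul_exp hρ1 hρ2 hexp).congr fun s hs => hfstrip s hs).union hfr
  have hcob : {s : ℍ[ℝ] | |s.re| < b} ∪ {s | r < ‖s‖} ∈ Bornology.cobounded ℍ[ℝ] :=
    mem_of_superset (tendsto_norm_cobounded_atTop.eventually_gt_atTop r) Set.subset_union_right
  have hA₀ := hT.isRealResolvent hZ hZbound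
  have hG₀ := hT.isGroupResolvent hZ hω hZbound hA₀
  refine ⟨groupIntegral hρ hZ hZbound hexpω, fun v => ⟨hZi v, (hρ.leftIntegral_eq (hZi v)).symm⟩,
    ⟨_, hA₀.mem_sResolventSet⟩, ?_, hf_inf, fun L hL α hα => ?_⟩
  -- The complement of the two large discs is T-admissible: it contains the strip |Re s| ≤ ω,
  -- outside of which the pencil of T is invertible, and its closure lies where f is regular.
  · obtain ⟨a, hωa, hab⟩ := exists_between hωb
    obtain ⟨c, hac, -, hc⟩ := exists_large a b r 0 hab (hω.trans_lt hωa)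
    refine ⟨_, (twoDiscs a c (hω.trans_lt hωa) hac).isAdmissible_domH fun s hs => ?_, _,
      fun s hs => ?_, hfreg⟩
    · refine twoDiscs_mem_domH _ _ (lt_of_le_of_lt ?_ hωa)
      by_contra! h
      exact hs (hA₀.mem_sResolventSet_of_isUnit (hG₀.isUnit_unitPencil h))
    · have := closure_twoDiscs_subset _ _ hs
      exact hc s this.1 this.2
  · obtain ⟨A, hA⟩ := exists_isRealResolvent hA₀ hα
    have hG := hT.isGroupResolvent hZ hω hZbound hA
    obtain ⟨η, hη, hunit⟩ := exists_isUnit_unitPencil A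
    -- The bound η/2 on the radius of a small disc leaves a larger concentric disc, of radius η, on
    -- which the pencil of A is invertible; Cauchy's theorem needs this margin.
    obtain ⟨a, n, D, k₀, hωa, hab, hD⟩ := DiscFamily.exists_isAdapted hω hωb r (half_pos hη) α
    have hsmall : ∀ k, ¬ D.IsOuter a k → ∃ ρ', D.ρ k < ρ' ∧
        ∀ ζ : ℍ[ℝ], ‖ζ‖ < ρ' → IsUnit (unitPencil A ζ) := fun k hk =>
      ⟨η, (hD.of_not_isOuter hk).2.1.trans_lt (half_lt_self hη), hunit⟩
    have hg : RightSliceRegularOn (invTransport f L α) (DiscFamily.transportDomain α b r) :=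
      hfreg.invTransport hcob hL
    exact ⟨A, hA, hD.isBoundedSCalculus hg (hD.boundedSSpectrum_subset hG hωa hsmall) fun I hI v =>
      hD.sum_integral_eq_integral hI hab hfreg hg hG hωa hsmall hρ hexp hfreal v⟩
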